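/- Let $n\ge 1$ and let $M,\bar M,L$ be smooth $n$-manifolds without boundary. Let $\mathscr C\subset M\times\bar M$ be a closed set (the cut locus), and let $h$ be a pseudo-Riemannian metric on $(M\times\bar M)\setminus\mathscr C$ which vanishes on pairs of vectors tangent to the same factor and for which every point of $(M\times\bar M)\setminus\mathscr C$ has a neighbourhood carrying a $C^4$ function $c$ with $h(V,\bar W)=-\tfrac12 V\bar W c$ for $V\in T_xM$, $\bar W\in T_{\bar x}\bar M$. Let $K=I_{TM}\oplus(-I)_{T\bar M}$ and $\omega=h(K\cdot,\cdot)$. Let $\rho\,dx$ and $\bar\rho\,d\bar x$ be nowhere vanishing $n$-forms of class $C^2$ on $M$ and $\bar M$, and put $\Omega=\tau\rho(x)\,dx+\bar\tau\bar\rho(\bar x)\,d\bar x$, where $\mathbf k^2=1$, $\tau=\frac12(1+\mathbf k)$, $\bar\tau=\frac12(1-\mathbf k)$. Assume that $\rho\bar\rho/\det(-c_{i\bar s})>0$ off $\mathscr C$ (this quantity does not depend on the coordinates) and define $\psi$ by $e^{2n\psi}=\rho\bar\rho/\det(-c_{i\bar s})$. Let $F:L\times[0,T)\to (M\times\bar M)\setminus\mathscr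 C$, $0<T<\infty$, be a generalized Lagrangian mean curvature flow: a family, of class $C^3$ jointly in space and time, of immersions $F_t=F(\cdot,t)$ that are spacelike ($g=g(t)=F_t^*h$ is positive definite) and Lagrangian ($F_t^*\omega=0$), such that $$\Big(\frac{\partial F}{\partial t}\Big)^{\perp}=\vec H-n(\hat\nabla\psi)^{\perp},$$ where $\vec H$ is the mean curvature vector of $F_t$, and $\hat\nabla\psi$ the gradient of $\psi$, with respect to $h$. Orient $L$ by $F_t^*(\rho\,dx)$. Then: 1. For each $t\in[0,T)$ and $p\in L$ there is exactly one real number $\theta(p,t)$, the Lagrangian angle, with $\Omega|_L=e^{\mathbf k\theta+n\psi}\,d\mathrm{Vol}_L$ on $T_pL$, where $e^{\mathbf k\theta}=\cosh\theta+\mathbf k\sinh\theta$ and $d\mathrm{Vol}_L$ is the volume form of $g(t)$; and $\theta(\cdot,t)$ is of class $C^2$ on $L$. 2. The derivative of $\theta$ along the normal trajectories of the flow satisfies $$\frac{d}{dt}\theta=\Delta_g\theta+n\,g(\nabla\psi,\nabla\theta)$$ on $L\times[0,T)$, where $\nabla\psi$ is the $g$-gradient of $\psi\circ F_t$. That is,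 $\partial_t\theta-d\theta(X)=\Delta_g\theta+n\,g(\nabla\psi,\nabla\theta)$, where $X(\cdot,t)$ is the vector field on $L$ for which $dF_t(X)$ is the tangential part of $\partial F/\partial t$; in particular $\partial_t\theta=\Delta_g\theta+n\,g(\nabla\psi,\nabla\theta)$ wherever $\partial F/\partial t=\vec H-n(\hat\nabla\psi)^\perp$. (Time derivatives at $t=0$ are one-sided.) 3. If $L$ is compact and non-empty, then $\theta(\cdot,0)$ attains a minimum and a maximum, and $\min_L\theta(\cdot,0)\le\theta(p,t)\le\max_L\theta(\cdot,0)$ for all $p\in L$ and $t\in[0,T)$. -/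

import Mathlib

open scoped Manifold ContDiff

noncomputable section

namespace KimMcCann

/-! ### Metrics, Christoffel symbols and traces

Mathlib identifies every tangent space of a manifold modelled on `V` with `V` itself, through the
preferred chart at the base point. Tangent vectors are therefore written as elements of `V`, and
a field of bilinear forms on the tangent spaces of `N` as a map `N → V →L[ℝ] V →L[ℝ] ℝ`. -/

section Metric

variable {V : Type*} [NormedAddCommGroup V] [NormedSpace ℝ V]
  {H : Type*} [TopologicalSpace H] (J : ModelWithCorners ℝ V H)
  {N : Type*} [TopologicalSpace N] [ChartedSpace H N]

/-- The vector dual to the linear form `α` with respect to a nondegenerate bilinear form `B`, that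
is, the unique `v` with `B v = α`. -/
def sharp (B : V →L[ℝ] V →L[ℝ] ℝ) (α : V →L[ℝ] ℝ) : V :=
  ContinuousLinearMap.inverse B α

/-- The differential `df` at `z` of a real function. -/
def differential (f : N → ℝ) (z : N) : V →L[ℝ] ℝ := mfderiv J 𝓘(ℝ, ℝ) f z

/-- The gradient at `z` of a function `f` with respect to the field of bilinear forms `B`. -/
def grad (B : N → V →L[ℝ] V →L[ℝ] ℝ) (f : N → ℝ) (z : N) : V :=
  sharp (B z) (differential J f z)

/-- The field of bilinear forms `B` written in the preferred chart at `z₀`: the coefficients of `B`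
at the point with coordinates `w`. -/
def inChart (B : N → V →L[ℝ] V →L[ℝ] ℝ) (z₀ : N) (w : V) : V →L[ℝ] V →L[ℝ] ℝ :=
  let D : V →L[ℝ] V := mfderiv 𝓘(ℝ, V) J (extChartAt J z₀).symm w
  (B ((extChartAt J z₀).symm w)).bilinearComp D D

/-- The Christoffel symbols `Γ(u, v)` of the Levi-Civita connection of `B` at `z₀`, in the preferred
chart at `z₀`:
`B(Γ(u, v), w) = (1 / 2) (∂ᵤ B(v, w) + ∂ᵥ B(u, w) - ∂_w B(u, v))` for all `w`. -/
def christoffel (B : N → V →L[ℝ] V →L[ℝ] ℝ) (z₀ : N) (u v : V) : V :=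
  let D : V →L[ℝ] V →L[ℝ] V →L[ℝ] ℝ := fderiv ℝ (inChart J B z₀) (extChartAt J z₀ z₀)
  sharp (B z₀) ((1 / 2 : ℝ) • (D u v + D v u - (D.flip u).flip v))

end Metric

/-- The model space `ℝⁿ`. -/
abbrev Rn (n : ℕ) : Type := EuclideanSpace ℝ (Fin n)

/-- The `i`-th coordinate vector. -/
def coordVec {n : ℕ} (i : Fin n) : Rn n := EuclideanSpace.single i 1

/-- The trace `∑ᵢⱼ gⁱʲ A(eᵢ, eⱼ)` of a bilinear map `A` with respect to `g`; the vector
`∑ⱼ gⁱʲ eⱼ` is the `g`-dual of the `i`-th coordinate form. -/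
def metricTrace {n : ℕ} {W : Type*} [AddCommMonoid W] (g : Rn n →L[ℝ] Rn n →L[ℝ] ℝ)
    (A : Rn n → Rn n → W) : W :=
  ∑ i : Fin n, A (coordVec i) (sharp g (EuclideanSpace.proj i))

section Laplacian

variable {n : ℕ} {L : Type*} [TopologicalSpace L] [ChartedSpace (Rn n) L]

/-- The Laplace-Beltrami operator `Δ_g f = gⁱʲ (∂ᵢ∂ⱼ f - Γᵢⱼᵏ ∂ₖ f)` at `p`. -/
def laplacian (g : L → Rn n →L[ℝ] Rn n →L[ℝ] ℝ) (f : L → ℝ) (p : L) : ℝ :=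
  metricTrace (g p) fun u v =>
    fderiv ℝ (fderiv ℝ (f ∘ (extChartAt 𝓘(ℝ, Rn n) p).symm)) (extChartAt 𝓘(ℝ, Rn n) p p) u v
      - differential 𝓘(ℝ, Rn n) f p (christoffel 𝓘(ℝ, Rn n) g p u v)

end Laplacian

/-! ### Para-complex numbers -/

/-- The para-complex numbers `a + b 𝐤` with `𝐤² = 1`. -/
abbrev ParaComplex : Type := QuadraticAlgebra ℝ 1 0

/-- `τ = (1 + 𝐤) / 2`. -/
def tau : ParaComplex := ⟨1 / 2, 1 / 2⟩

/-- `τ̄ = (1 - 𝐤) / 2`. -/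
def tauBar : ParaComplex := ⟨1 / 2, -(1 / 2)⟩

/-- `exp (𝐤 θ) = cosh θ + 𝐤 sinh θ`. -/
def expK (θ : ℝ) : ParaComplex := ⟨Real.cosh θ, Real.sinh θ⟩

/-! ### Generalized Kim-McCann manifolds -/

section GKM

variable {n : ℕ} {M : Type*} [TopologicalSpace M] [ChartedSpace (Rn n) M]
  {M' : Type*} [TopologicalSpace M'] [ChartedSpace (Rn n) M']

/-- The model with corners of the product manifold `M × M'`. -/
abbrev prodModel (n : ℕ) : ModelWithCorners ℝ (Rn n × Rn n) (ModelProd (Rn n) (Rn n)) :=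
  (𝓘(ℝ, Rn n)).prod 𝓘(ℝ, Rn n)

/-- The para-complex structure `K = I ⊕ (-I)` on `T(M × M')`. -/
def K (V : Rn n × Rn n) : Rn n × Rn n := (V.1, -V.2)

/-- The mixed second derivative `V W̄ c` at `z = (x, x̄)`, for `V ∈ T_x M` and `W̄ ∈ T_x̄ M'`. -/
def mixedDeriv (c : M × M' → ℝ) (z : M × M') (V W : Rn n) : ℝ :=
  differential 𝓘(ℝ, Rn n)
    (fun x : M => differential 𝓘(ℝ, Rn n) (fun y : M' => c (x, y)) z.2 W) z.1 V

/-- The density `ρ(x)` with `ρ = ρ(x) dx¹ ∧ ⋯ ∧ dxⁿ` of an `n`-form, in the preferred chart at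
`x₀`. -/
def coordDensity (ρ : M → Rn n [⋀^Fin n]→ₗ[ℝ] ℝ) (x₀ : M) (w : Rn n) : ℝ :=
  ρ ((extChartAt 𝓘(ℝ, Rn n) x₀).symm w) fun i =>
    (mfderiv 𝓘(ℝ, Rn n) 𝓘(ℝ, Rn n) (extChartAt 𝓘(ℝ, Rn n) x₀).symm w : Rn n →L[ℝ] Rn n)
      (coordVec i)

/-- An `n`-form on `M` (a field of alternating forms on the tangent spaces) is of class `C²`. -/
def IsC2Form (ρ : M → Rn n [⋀^Fin n]→ₗ[ℝ] ℝ) : Prop :=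
  ∀ x₀ : M, ContDiffOn ℝ 2 (coordDensity ρ x₀) (extChartAt 𝓘(ℝ, Rn n) x₀).target

/-- The quantity `ρ ρ̄ / det (-c_{i s̄})` at `z`, where `-c_{i s̄} = 2 h(∂ᵢ, ∂_s̄)`. It does not
depend on the coordinates. -/
def densityRatio (h : M × M' → (Rn n × Rn n) →L[ℝ] (Rn n × Rn n) →L[ℝ] ℝ)
    (ρ : M → Rn n [⋀^Fin n]→ₗ[ℝ] ℝ) (ρ' : M' → Rn n [⋀^Fin n]→ₗ[ℝ] ℝ) (z : M × M') : ℝ :=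
  ρ z.1 coordVec * ρ' z.2 coordVec /
    (Matrix.of fun i s : Fin n => 2 * h z (coordVec i, 0) (0, coordVec s)).det

variable (n M M') in
/-- A generalized Kim-McCann structure on `M × M'`: a Kim-McCann metric `h`, defined off the cut
locus, with a nowhere vanishing para-holomorphic form `Ω = τ ρ(x) dx + τ̄ ρ̄(x̄) dx̄` for which the
equation `exp (2 n ψ) = ρ ρ̄ / det (-c_{i s̄})` can be solved. -/
structure GKM where
  /-- The cut locus, off which the metric is defined. -/
  cut : Set (M × M')
  isClosed_cut : IsClosed cut
  /-- The Kim-McCann metric; its values on the cut locus are irrelevant. -/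
  h : M × M' → (Rn n × Rn n) →L[ℝ] (Rn n × Rn n) →L[ℝ] ℝ
  h_symm : ∀ z ∉ cut, ∀ U V, h z U V = h z V U
  h_nondegenerate : ∀ z ∉ cut, ∀ U, (∀ V, h z U V = 0) → U = 0
  h_left : ∀ z ∉ cut, ∀ V W : Rn n, h z (V, 0) (W, 0) = 0
  h_right : ∀ z ∉ cut, ∀ V W : Rn n, h z (0, V) (0, W) = 0
  /-- Near every point off the cut locus, `h(V, W̄) = -(1 / 2) V W̄ c` for a local cost `c`. -/
  exists_cost : ∀ z₀ ∉ cut, ∃ (U : Set (M × M')) (c : M × M' → ℝ),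
    IsOpen U ∧ z₀ ∈ U ∧ ContMDiffOn (prodModel n) 𝓘(ℝ, ℝ) 4 c U ∧
      ∀ z ∈ U, ∀ V W : Rn n, h z (V, 0) (0, W) = -(1 / 2) * mixedDeriv c z V W
  /-- The `n`-form `ρ(x) dx` on `M`. -/
  ρ : M → Rn n [⋀^Fin n]→ₗ[ℝ] ℝ
  /-- The `n`-form `ρ̄(x̄) dx̄` on `M'`. -/
  ρ' : M' → Rn n [⋀^Fin n]→ₗ[ℝ] ℝ
  ρ_contDiff : IsC2Form ρ
  ρ'_contDiff : IsC2Form ρ'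
  ρ_ne_zero : ∀ x, ρ x ≠ 0
  ρ'_ne_zero : ∀ x', ρ' x' ≠ 0
  densityRatio_pos : ∀ z ∉ cut, 0 < densityRatio h ρ ρ' z

namespace GKM

variable (G : GKM n M M')

/-- The para-Kähler form `ω = h(K ·, ·)`. -/
def kahlerForm (z : M × M') (U V : Rn n × Rn n) : ℝ := G.h z (K U) V

/-- The para-holomorphic `(n, 0)`-form `Ω = τ ρ(x) dx + τ̄ ρ̄(x̄) dx̄`. -/
def Ω (z : M × M') (V : Fin n → Rn n × Rn n) : ParaComplex :=
  G.ρ z.1 (fun i => (V i).1) • tau + G.ρ' z.2 (fun i => (V i).2) • tauBar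

/-- The function `ψ = (1 / 2n) (ln ρ + ln ρ̄ - ln det (-c_{i s̄}))`. -/
def ψ (z : M × M') : ℝ := 1 / (2 * n) * Real.log (densityRatio G.h G.ρ G.ρ' z)

/-! ### Spacelike Lagrangian immersions and their mean curvature -/

section Immersion

variable {L : Type*} [TopologicalSpace L] [ChartedSpace (Rn n) L] (F : L → M × M')

/-- The differential of a map `F : L → M × M'`. -/
def dF (p : L) : Rn n →L[ℝ] Rn n × Rn n := mfderiv 𝓘(ℝ, Rn n) (prodModel n) F p

/-- The induced metric `g = F^* h`. -/
def induced (p : L) : Rn n →L[ℝ] Rn n →L[ℝ] ℝ :=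
  (G.h (F p)).bilinearComp (dF F p) (dF F p)

/-- `F` is spacelike: the induced metric is positive definite. (In particular `F` is an
immersion.) -/
def IsSpacelike : Prop := ∀ p : L, ∀ u : Rn n, u ≠ 0 → 0 < G.induced F p u u

/-- `F` is Lagrangian: `F^* ω = 0`. -/
def IsLagrangian : Prop := ∀ p : L, ∀ u v : Rn n, G.kahlerForm (F p) (dF F p u) (dF F p v) = 0

/-- The vector `X ∈ T_p L` for which `dF(X)` is the tangential part of `w`. -/
def tangential (p : L) (w : Rn n × Rn n) : Rn n :=
  sharp (G.induced F p) ((G.h (F p) w).comp (dF F p))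

/-- The normal part `w^⊥` of `w ∈ T_{F(p)} (M × M')`. -/
def normal (p : L) (w : Rn n × Rn n) : Rn n × Rn n := w - dF F p (G.tangential F p w)

/-- The second fundamental form `A(u, v) = (∇̂_{dF u} dF v)^⊥`, with `∇̂` the Levi-Civita
connection of `h`, in the preferred charts at `p` and `F p`. -/
def secondFF (p : L) (u v : Rn n) : Rn n × Rn n :=
  G.normal F p
    (fderiv ℝ (fderiv ℝ (writtenInExtChartAt 𝓘(ℝ, Rn n) (prodModel n) p F))
        (extChartAt 𝓘(ℝ, Rn n) p p) u v
      + christoffel (prodModel n) G.h (F p) (dF F p u) (dF F p v))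

/-- The mean curvature vector `gⁱʲ A(∂ᵢ, ∂ⱼ)`. -/
def meanCurvature (p : L) : Rn n × Rn n := metricTrace (G.induced F p) (G.secondFF F p)

/-- The generalized mean curvature vector `H - n (∇̂ψ)^⊥`. -/
def genMeanCurvature (p : L) : Rn n × Rn n :=
  G.meanCurvature F p - (n : ℝ) • G.normal F p (grad (prodModel n) G.h G.ψ (F p))

/-- `θ` is the Lagrangian angle of `F` at `p`: `Ω|_L = exp (𝐤 θ + n ψ) dVol_L` on `T_p L`. Here `L`
is oriented by the form `ρ dx`, and `dVol_L` takes the value `√(det g(vᵢ, vⱼ))` on a positively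
oriented frame `(vᵢ)`. -/
def IsLagrangianAngle (p : L) (θ : ℝ) : Prop :=
  ∀ v : Fin n → Rn n, 0 < G.ρ (F p).1 (fun i => (dF F p (v i)).1) →
    G.Ω (F p) (fun i => dF F p (v i)) =
      (Real.exp (n * G.ψ (F p)) *
        √(Matrix.of fun i j : Fin n => G.induced F p (v i) (v j)).det) • expK θ

end Immersion

/-! ### The flow -/

section Flow

variable {L : Type*} [TopologicalSpace L] [ChartedSpace (Rn n) L] (T : ℝ) (F : ℝ → L → M × M')

/-- The velocity `∂F/∂t` (one-sided at `t = 0`) of a family of maps on the time interval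
`[0, T)`. -/
def velocity (t : ℝ) (p : L) : Rn n × Rn n :=
  (mfderivWithin 𝓘(ℝ, ℝ) (prodModel n) (fun s => F s p) (Set.Ico 0 T) t : ℝ →L[ℝ] Rn n × Rn n) 1

/-- `F` is a generalized Lagrangian mean curvature flow on `[0, T)`: a family, jointly of class `C³`,
of spacelike Lagrangian immersions into the complement of the cut locus with
`(∂F/∂t)^⊥ = H - n (∇̂ψ)^⊥`. -/
structure IsGLMCF : Prop where
  contMDiffOn : ContMDiffOn ((𝓘(ℝ, ℝ)).prod 𝓘(ℝ, Rn n)) (prodModel n) 3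
    (fun q : ℝ × L => F q.1 q.2) (Set.Ico 0 T ×ˢ Set.univ)
  notMem_cut : ∀ t ∈ Set.Ico 0 T, ∀ p, F t p ∉ G.cut
  isSpacelike : ∀ t ∈ Set.Ico 0 T, G.IsSpacelike (F t)
  isLagrangian : ∀ t ∈ Set.Ico 0 T, G.IsLagrangian (F t)
  flow : ∀ t ∈ Set.Ico 0 T, ∀ p,
    G.normal (F t) p (velocity T F t p) = G.genMeanCurvature (F t) p

end Flow

end GKM

end GKM

end KimMcCann

end

/-!
# The Lagrangian angle along the generalized Lagrangian mean curvature flow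

Write `a = ρ(dx)` and `b = ρ̄(dx̄)` for the values of the two forms on a frame of `T_p L`. The metric
`h` only pairs the two factors, and on a Lagrangian subspace the induced metric is
`g(u, v) = 2 h(dx u, dx̄ v)`; hence `a b = exp (2nψ) det g` (`GKM.density_mul_density`), and in the
basis `τ, τ̄` of the para-complex numbers the equation for the Lagrangian angle has the unique
solution `θ = (log |a| - log |b|) / 2` (`IsSpacelikeLagrangian.isLagrangianAngle_iff`). Logarithmic
differentiation of `a` and `b` by Jacobi's formula gives the differential of `θ`
(`differential_angle`) and that of `log |a b|` (`logDeriv_densities`).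

*The mean curvature form.* The trilinear form `h(∇̂_{dF u} dF v, K dF w)` is totally symmetric: this
is the derivative of the Lagrangian condition, together with the symmetry of the third derivatives
of the cost. Its metric trace over `u, v` is therefore a trace of endomorphisms in which `w` is the
direction of differentiation (`IsLagrangianJet.metricTrace_secondFF_form`). Since `2n dψ` is the
logarithmic derivative of `ρ ρ̄ / det (-c_{i s̄})`, subtracting the term with `ψ` leaves
`h(H - n ∇̂ψ, K dF w) = -dθ(w)` (`genMeanCurvature_apply_K`), so that the generalized mean curvature
vector is `K dF(∇θ)`.

*The evolution equation.* The velocity of the flow is thus `dF(X) + K dF(∇θ)`, with `X` its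
tangential part: its two components are `dx(X + ∇θ)` and `dx̄(X - ∇θ)`. In fixed charts the time
derivative of `dx` is the space derivative of the first component of the velocity, and the time
derivative of `2θ` becomes the divergence of `X + ∇θ` for the density `a` minus the divergence of
`X - ∇θ` for the density `b`. The terms in `X` give `2 dθ(X)`. Those in `∇θ` give twice the
divergence of `∇θ` for the density `|a b|^(1/2)`, which is `exp (nψ) √(det g)`, that is
`2 (Δθ + n g(∇ψ, ∇θ))` (`GKM.IsGLMCF.hasDerivWithinAt_angle`, with `laplacian_eq_divergence`).

*The maximum principle.* At a spatial maximum of `θ` both first order terms vanish and `Δθ ≤ 0`. On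
a compact `L` the function `θ - ε t` therefore attains its maximum over `[0, t₁] × L` at time `0`,
for all `ε > 0` (`le_of_deriv_nonpos_at_max`); minima are treated in the same way.
-/

noncomputable section

open scoped Topology

set_option linter.unusedSectionVars false

namespace KimMcCann

/-! ### Traces, determinants and Jacobi's formula -/

section LinearAlgebra

variable {n : ℕ} {V : Type*} [NormedAddCommGroup V] [NormedSpace ℝ V]

lemma isInvertible_of_nondegenerate [FiniteDimensional ℝ V] (B : V →L[ℝ] V →L[ℝ] ℝ)
    (hB : ∀ u, (∀ v, B u v = 0) → u = 0) : B.IsInvertible := by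
  have hinj : Function.Injective (B : V →ₗ[ℝ] V →L[ℝ] ℝ) := by
    rw [← LinearMap.ker_eq_bot, LinearMap.ker_eq_bot']
    intro u hu
    exact hB u fun v => by simpa using congrArg (fun α : V →L[ℝ] ℝ => α v) hu
  have hdim : Module.finrank ℝ V = Module.finrank ℝ (V →L[ℝ] ℝ) := by
    rw [← (LinearMap.toContinuousLinearMap (𝕜 := ℝ) (E := V) (F' := ℝ)).finrank_eq]
    exact (Subspace.dual_finrank_eq (K := ℝ) (V := V)).symm
  refine ⟨(LinearMap.linearEquivOfInjective _ hinj hdim).toContinuousLinearEquiv, ?_⟩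
  ext u
  rfl

lemma apply_sharp {B : V →L[ℝ] V →L[ℝ] ℝ} (hB : B.IsInvertible) (α : V →L[ℝ] ℝ) :
    B (sharp B α) = α := by
  obtain ⟨e, rfl⟩ := hB
  simp [sharp]

lemma sharp_apply {B : V →L[ℝ] V →L[ℝ] ℝ} (hB : B.IsInvertible) (v : V) :
    sharp B (B v) = v := by
  obtain ⟨e, rfl⟩ := hB
  simp [sharp]

lemma eq_of_forall_apply_eq {B : V →L[ℝ] V →L[ℝ] ℝ} (hB : B.IsInvertible) {u v : V}
    (h : ∀ w, B u w = B v w) : u = v := by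
  rw [← sharp_apply hB u, ← sharp_apply hB v]
  congr 1
  ext w
  exact h w

lemma comp_inverse_apply {A : V →L[ℝ] V} (hA : A.IsInvertible) (v : V) : A (A.inverse v) = v := by
  obtain ⟨e, rfl⟩ := hA
  simp

lemma inverse_comp_apply {A : V →L[ℝ] V} (hA : A.IsInvertible) (v : V) : A.inverse (A v) = v := by
  obtain ⟨e, rfl⟩ := hA
  simp

lemma isInvertible_of_injective [FiniteDimensional ℝ V] {A : V →L[ℝ] V}
    (hA : ∀ v, A v = 0 → v = 0) : A.IsInvertible := by
  have hinj : Function.Injective (A : V →ₗ[ℝ] V) := by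
    rw [← LinearMap.ker_eq_bot, LinearMap.ker_eq_bot']
    exact hA
  refine ⟨(LinearEquiv.ofInjectiveEndo _ hinj).toContinuousLinearEquiv, ?_⟩
  ext u
  rfl

lemma coordVec_apply (i j : Fin n) : (coordVec i : Rn n) j = if j = i then 1 else 0 := by
  simp [coordVec]

lemma sum_smul_coordVec (v : Rn n) : ∑ i, v i • (coordVec i : Rn n) = v := by
  ext j
  simp [coordVec_apply]

lemma map_eq_sum {W : Type*} [NormedAddCommGroup W] [NormedSpace ℝ W] (A : Rn n →L[ℝ] W)
    (v : Rn n) : A v = ∑ i, v i • A (coordVec i) := by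
  conv_lhs => rw [← sum_smul_coordVec v]
  simp

/-- The matrix of an endomorphism of `ℝⁿ` in the standard frame. -/
def endMatrix (A : Rn n →L[ℝ] Rn n) : Matrix (Fin n) (Fin n) ℝ :=
  Matrix.of fun i j => A (coordVec j) i

/-- The trace of an endomorphism of `ℝⁿ`. -/
def endTrace (A : Rn n →L[ℝ] Rn n) : ℝ := ∑ i, A (coordVec i) i

lemma trace_endMatrix (A : Rn n →L[ℝ] Rn n) : (endMatrix A).trace = endTrace A := rfl

lemma endMatrix_comp (A B : Rn n →L[ℝ] Rn n) :
    endMatrix (A ∘L B) = endMatrix A * endMatrix B := by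
  ext i j
  simp only [endMatrix, Matrix.of_apply, Matrix.mul_apply, ContinuousLinearMap.comp_apply]
  rw [map_eq_sum A]
  simp [mul_comm]

lemma endMatrix_id : endMatrix (ContinuousLinearMap.id ℝ (Rn n)) = 1 := by
  ext i j
  simp [endMatrix, coordVec_apply, Matrix.one_apply]

lemma endMatrix_add (A B : Rn n →L[ℝ] Rn n) :
    endMatrix (A + B) = endMatrix A + endMatrix B := by
  ext i j
  simp [endMatrix]

lemma endMatrix_smul (c : ℝ) (A : Rn n →L[ℝ] Rn n) : endMatrix (c • A) = c • endMatrix A := by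
  ext i j
  simp [endMatrix]

lemma endTrace_comp_comm (A B : Rn n →L[ℝ] Rn n) : endTrace (A ∘L B) = endTrace (B ∘L A) := by
  rw [← trace_endMatrix, ← trace_endMatrix, endMatrix_comp, endMatrix_comp, Matrix.trace_mul_comm]

lemma endTrace_add (A B : Rn n →L[ℝ] Rn n) : endTrace (A + B) = endTrace A + endTrace B := by
  simp [endTrace, Finset.sum_add_distrib]

lemma endTrace_sub (A B : Rn n →L[ℝ] Rn n) : endTrace (A - B) = endTrace A - endTrace B := by
  simp [endTrace, Finset.sum_sub_distrib]

lemma endTrace_smul (c : ℝ) (A : Rn n →L[ℝ] Rn n) : endTrace (c • A) = c * endTrace A := by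
  simp [endTrace, Finset.mul_sum]

lemma det_endMatrix_ne_zero {A : Rn n →L[ℝ] Rn n} (hA : A.IsInvertible) :
    (endMatrix A).det ≠ 0 := by
  obtain ⟨e, rfl⟩ := hA
  have h : endMatrix (e : Rn n →L[ℝ] Rn n) * endMatrix (e.symm : Rn n →L[ℝ] Rn n) = 1 := by
    rw [← endMatrix_comp, ← endMatrix_id]
    simp
  intro h0
  have := congrArg Matrix.det h
  rw [Matrix.det_mul, h0] at this
  simp at this

lemma contDiff_det_endMatrix {k : ℕ∞ω} :
    ContDiff ℝ k fun A : Rn n →L[ℝ] Rn n => (endMatrix A).det := by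
  simp only [Matrix.det_apply]
  refine ContDiff.sum fun σ _ => ContDiff.const_smul _ (contDiff_prod fun i _ => ?_)
  have h : ContDiff ℝ k fun A : Rn n →L[ℝ] Rn n => EuclideanSpace.proj (𝕜 := ℝ) (σ i)
      (A (coordVec i)) := by fun_prop
  exact h

/-- Jacobi's formula for the determinant. -/
lemma fderiv_det_endMatrix {A : Rn n →L[ℝ] Rn n} (hA : A.IsInvertible)
    (H : Rn n →L[ℝ] Rn n) :
    fderiv ℝ (fun A : Rn n →L[ℝ] Rn n => (endMatrix A).det) A H
      = (endMatrix A).det * endTrace (A.inverse ∘L H) := by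
  have hd : HasFDerivAt (fun A : Rn n →L[ℝ] Rn n => (endMatrix A).det)
      (fderiv ℝ (fun A : Rn n →L[ℝ] Rn n => (endMatrix A).det) A) (A + (0 : ℝ) • H) := by
    have h0 : A + (0 : ℝ) • H = A := by
      ext1 v
      simp
    rw [h0]
    exact ((contDiff_det_endMatrix (k := 1)).differentiable one_ne_zero _).hasFDerivAt
  have hline : HasDerivAt (fun t : ℝ => A + t • H) H 0 := by
    simpa using ((hasDerivAt_id (0 : ℝ)).smul_const H).const_add A
  have h1 := hd.comp_hasDerivAt (0 : ℝ) hline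
  have hfac : (fun A : Rn n →L[ℝ] Rn n => (endMatrix A).det) ∘ (fun t : ℝ => A + t • H)
      = fun t : ℝ => (endMatrix A).det * (1 + t • endMatrix (A.inverse ∘L H)).det := by
    funext t
    have : A + t • H = A ∘L (ContinuousLinearMap.id ℝ _ + t • (A.inverse ∘L H)) := by
      ext1 v
      simp [comp_inverse_apply hA]
    simp only [Function.comp]
    rw [this, endMatrix_comp, Matrix.det_mul, endMatrix_add, endMatrix_smul, endMatrix_id]
  rw [hfac] at h1
  have h2 : HasDerivAt (fun t : ℝ => (1 + t • endMatrix (A.inverse ∘L H)).det)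
      (endTrace (A.inverse ∘L H)) 0 := by
    set p : Polynomial ℝ := (Matrix.det (1 + (Polynomial.X : Polynomial ℝ) •
      (endMatrix (A.inverse ∘L H)).map Polynomial.C)).divX.divX with hp
    have hfun : (fun t : ℝ => (1 + t • endMatrix (A.inverse ∘L H)).det)
        = fun t : ℝ => 1 + (endMatrix (A.inverse ∘L H)).trace * t + p.eval t * t ^ 2 := by
      funext t
      rw [Matrix.det_one_add_smul]
    rw [hfun]
    have := (((hasDerivAt_id (0 : ℝ)).const_mul (endMatrix (A.inverse ∘L H)).trace).const_add
      1).add ((p.hasDerivAt (0 : ℝ)).mul ((hasDerivAt_id (0 : ℝ)).pow 2))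
    refine (this.congr_deriv ?_)
    simp [trace_endMatrix]
  exact h1.unique (h2.const_mul _)

/-- The derivative of `log |r det A|` for a function `r` and a field `A` of endomorphisms. -/
lemma hasFDerivWithinAt_log_mul_det {X : Type*} [NormedAddCommGroup X] [NormedSpace ℝ X]
    {r : X → ℝ} {A : X → Rn n →L[ℝ] Rn n} {s : Set X} {x : X} {r' : X →L[ℝ] ℝ}
    {A' : X →L[ℝ] Rn n →L[ℝ] Rn n} (hr : HasFDerivWithinAt r r' s x)
    (hA : HasFDerivWithinAt A A' s x) (hr0 : r x ≠ 0) (hA0 : (A x).IsInvertible) :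
    ∃ D : X →L[ℝ] ℝ, (∀ v, D v = (r x)⁻¹ * r' v + endTrace ((A x).inverse ∘L A' v)) ∧
      HasFDerivWithinAt (fun y => Real.log (r y * (endMatrix (A y)).det)) D s x := by
  have hdet := (((contDiff_det_endMatrix (n := n) (k := 1)).differentiable one_ne_zero
    (A x)).hasFDerivAt).comp_hasFDerivWithinAt x hA
  have h0 := det_endMatrix_ne_zero hA0
  have h := (hr.mul hdet).log (mul_ne_zero hr0 h0)
  refine ⟨_, fun v => ?_, h⟩
  simp only [smul_apply, add_apply, ContinuousLinearMap.comp_apply,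
    fderiv_det_endMatrix hA0, smul_eq_mul, Function.comp, Pi.mul_apply]
  field_simp
  ring

/-! ### Metric traces -/

lemma metricTrace_eq_endTrace {g : Rn n →L[ℝ] Rn n →L[ℝ] ℝ} (hg : g.IsInvertible)
    (hs : ∀ u v, g u v = g v u) {b : Rn n → Rn n → ℝ} {S : Rn n →L[ℝ] Rn n}
    (hb : ∀ u v, b u v = g (S u) v) : metricTrace g b = endTrace S := by
  unfold metricTrace endTrace
  refine Finset.sum_congr rfl fun i _ => ?_
  rw [hb, hs, apply_sharp hg]
  rfl

/-- The matrix `gⁱʲ` is symmetric. -/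
lemma sharp_proj_comm {g : Rn n →L[ℝ] Rn n →L[ℝ] ℝ} (hg : g.IsInvertible)
    (hs : ∀ u v, g u v = g v u) (i j : Fin n) :
    sharp g (EuclideanSpace.proj i) j = sharp g (EuclideanSpace.proj j) i := by
  have h (i j : Fin n) : sharp g (EuclideanSpace.proj i) j
      = g (sharp g (EuclideanSpace.proj j)) (sharp g (EuclideanSpace.proj i)) := by
    rw [apply_sharp hg]
    rfl
  rw [h, h, hs]

lemma metricTrace_eq_sum {g : Rn n →L[ℝ] Rn n →L[ℝ] ℝ} (b : Rn n →L[ℝ] Rn n →L[ℝ] ℝ) :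
    metricTrace g (fun u v => b u v)
      = ∑ i, ∑ j, sharp g (EuclideanSpace.proj i) j * b (coordVec i) (coordVec j) := by
  unfold metricTrace
  refine Finset.sum_congr rfl fun i _ => ?_
  simp only
  rw [map_eq_sum (b (coordVec i))]
  simp

lemma metricTrace_eq_endTrace_right {g : Rn n →L[ℝ] Rn n →L[ℝ] ℝ} (hg : g.IsInvertible)
    (hs : ∀ u v, g u v = g v u) {b : Rn n → Rn n → ℝ} {S : Rn n →L[ℝ] Rn n}
    (hb : ∀ u v, b u v = g u (S v)) : metricTrace g b = endTrace S := by
  have hb' : b = fun u v => (g ∘L S).flip u v := by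
    funext u v
    simp [hb, hs u]
  rw [hb', metricTrace_eq_sum, Finset.sum_comm,
    ← metricTrace_eq_endTrace hg hs (b := fun u v => (g ∘L S) u v) (S := S) (fun _ _ => rfl),
    metricTrace_eq_sum]
  refine Finset.sum_congr rfl fun i _ => Finset.sum_congr rfl fun j _ => ?_
  rw [sharp_proj_comm hg hs]
  rfl

lemma metricTrace_add (g : Rn n →L[ℝ] Rn n →L[ℝ] ℝ) {W : Type*} [AddCommGroup W]
    (b c : Rn n → Rn n → W) :
    metricTrace g (fun u v => b u v + c u v) = metricTrace g b + metricTrace g c := by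
  simp [metricTrace, Finset.sum_add_distrib]

lemma metricTrace_sub (g : Rn n →L[ℝ] Rn n →L[ℝ] ℝ) {W : Type*} [AddCommGroup W]
    (b c : Rn n → Rn n → W) :
    metricTrace g (fun u v => b u v - c u v) = metricTrace g b - metricTrace g c := by
  simp [metricTrace, Finset.sum_sub_distrib]

lemma metricTrace_const_mul (g : Rn n →L[ℝ] Rn n →L[ℝ] ℝ) (c : ℝ) (b : Rn n → Rn n → ℝ) :
    metricTrace g (fun u v => c * b u v) = c * metricTrace g b := by
  simp [metricTrace, Finset.mul_sum]

/-- The trace of a negative semidefinite form with respect to a positive definite one is not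
positive: `gⁱʲ` is a sum of matrices `vⁱ vʲ`. -/
lemma metricTrace_nonpos {g : Rn n →L[ℝ] Rn n →L[ℝ] ℝ} (hg : g.IsInvertible)
    (hs : ∀ u v, g u v = g v u) (hpos : ∀ u, 0 ≤ g u u) (b : Rn n →L[ℝ] Rn n →L[ℝ] ℝ)
    (hb : ∀ u, b u u ≤ 0) : metricTrace g (fun u v => b u v) ≤ 0 := by
  set Q : Matrix (Fin n) (Fin n) ℝ := Matrix.of fun i j => sharp g (EuclideanSpace.proj i) j
  have hQ : Q.PosSemidef := by
    refine Matrix.posSemidef_iff_dotProduct_mulVec.2 ⟨?_, fun x => ?_⟩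
    · ext i j
      simp [Q, sharp_proj_comm hg hs i j]
    · have hx : star x ⬝ᵥ Q.mulVec x
          = g (∑ i, x i • sharp g (EuclideanSpace.proj i))
              (∑ i, x i • sharp g (EuclideanSpace.proj i)) := by
        simp only [map_sum, map_smul, apply_sharp hg, dotProduct, Matrix.mulVec,
          sum_apply, smul_apply, Q, Matrix.of_apply,
          star_trivial, smul_eq_mul, Finset.mul_sum, PiLp.proj_apply]
        refine Finset.sum_congr rfl fun i _ => Finset.sum_congr rfl fun j _ => ?_
        rw [sharp_proj_comm hg hs i j]
        ring
      rw [hx]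
      exact hpos _
  obtain ⟨m, v, hv⟩ := Matrix.posSemidef_iff_eq_sum_vecMulVec.1 hQ
  have hij (i j : Fin n) : sharp g (EuclideanSpace.proj i) j = ∑ k, v k i * v k j := by
    have := congrFun (congrFun hv i) j
    simpa [Q, Matrix.sum_apply, Matrix.vecMulVec_apply] using this
  have key : metricTrace g (fun u v => b u v)
      = ∑ k, b (∑ i, v k i • coordVec i) (∑ j, v k j • coordVec j) := by
    rw [metricTrace_eq_sum]
    simp only [hij, map_sum, map_smul, sum_apply,
      smul_apply, smul_eq_mul, Finset.sum_mul]
    rw [Finset.sum_congr rfl fun i _ => Finset.sum_comm (s := Finset.univ), Finset.sum_comm]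
    refine Finset.sum_congr rfl fun k _ => ?_
    simp only [Finset.mul_sum]
    rw [Finset.sum_comm]
    refine Finset.sum_congr rfl fun j _ => Finset.sum_congr rfl fun i _ => ?_
    ring
  rw [key]
  exact Finset.sum_nonpos fun k _ => hb _

end LinearAlgebra

/-! ### The mean curvature form of a Lagrangian immersion, at the level of jets -/

section Jets

variable {n : ℕ}

/-- The mixed block `P(a, b̄) = B((a, 0), (0, b̄))` of a bilinear form on `ℝⁿ × ℝⁿ`. -/
def mixedBlock (B : (Rn n × Rn n) →L[ℝ] (Rn n × Rn n) →L[ℝ] ℝ) : Rn n →L[ℝ] Rn n →L[ℝ] ℝ :=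
  B.bilinearComp (ContinuousLinearMap.inl ℝ (Rn n) (Rn n))
    (ContinuousLinearMap.inr ℝ (Rn n) (Rn n))

lemma mixedBlock_apply (B : (Rn n × Rn n) →L[ℝ] (Rn n × Rn n) →L[ℝ] ℝ) (a b : Rn n) :
    mixedBlock B a b = B (a, 0) (0, b) := rfl

/-- A Kim-McCann form: symmetric, nondegenerate, vanishing on pairs of vectors of one factor. -/
structure IsKMForm (h : (Rn n × Rn n) →L[ℝ] (Rn n × Rn n) →L[ℝ] ℝ) : Prop where
  symm : ∀ U V, h U V = h V U
  nondegenerate : ∀ U, (∀ V, h U V = 0) → U = 0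
  left : ∀ a b : Rn n, h (a, 0) (b, 0) = 0
  right : ∀ a b : Rn n, h (0, a) (0, b) = 0

/-- The linear relations satisfied by the derivative `D` of a field of Kim-McCann forms that is
locally the mixed Hessian of a cost function. -/
structure IsKMDeriv
    (D : (Rn n × Rn n) →L[ℝ] (Rn n × Rn n) →L[ℝ] (Rn n × Rn n) →L[ℝ] ℝ) : Prop where
  symm : ∀ U V W, D U V W = D U W V
  left : ∀ U, ∀ a b : Rn n, D U (a, 0) (b, 0) = 0
  right : ∀ U, ∀ a b : Rn n, D U (0, a) (0, b) = 0
  mixed_left : ∀ a b w : Rn n, D (a, 0) (b, 0) (0, w) = D (b, 0) (a, 0) (0, w)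
  mixed_right : ∀ a b w : Rn n, D (0, a) (w, 0) (0, b) = D (0, b) (w, 0) (0, a)

lemma pair_eq_add (U : Rn n × Rn n) : U = (U.1, 0) + (0, U.2) := by simp

namespace IsKMForm

variable {h : (Rn n × Rn n) →L[ℝ] (Rn n × Rn n) →L[ℝ] ℝ} (hh : IsKMForm h)

include hh

lemma apply_eq (U V : Rn n × Rn n) :
    h U V = mixedBlock h U.1 V.2 + mixedBlock h V.1 U.2 := by
  conv_lhs => rw [pair_eq_add U, pair_eq_add V]
  simp only [map_add, add_apply, hh.left, hh.right, mixedBlock_apply, hh.symm (0, U.2)]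
  ring

lemma isInvertible : h.IsInvertible := isInvertible_of_nondegenerate h hh.nondegenerate

lemma mixedBlock_isInvertible : (mixedBlock h).IsInvertible := by
  refine isInvertible_of_nondegenerate _ fun a ha => ?_
  have := hh.nondegenerate (a, 0) fun V => by
    rw [hh.apply_eq]
    simp [ha]
  simpa using this

end IsKMForm

lemma IsKMDeriv.apply_eq
    {D : (Rn n × Rn n) →L[ℝ] (Rn n × Rn n) →L[ℝ] (Rn n × Rn n) →L[ℝ] ℝ} (hD : IsKMDeriv D)
    (U V W : Rn n × Rn n) :
    D U V W = mixedBlock (D U) V.1 W.2 + mixedBlock (D U) W.1 V.2 := by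
  conv_lhs => rw [pair_eq_add V, pair_eq_add W]
  simp only [map_add, add_apply, hD.left, hD.right, mixedBlock_apply, hD.symm U (0, V.2)]
  ring

lemma mixedBlock_deriv_eq
    (D : (Rn n × Rn n) →L[ℝ] (Rn n × Rn n) →L[ℝ] (Rn n × Rn n) →L[ℝ] ℝ)
    (U : Rn n × Rn n) (a b : Rn n) :
    mixedBlock (D U) a b = mixedBlock (D (U.1, 0)) a b + mixedBlock (D (0, U.2)) a b := by
  conv_lhs => rw [pair_eq_add U]
  simp only [mixedBlock_apply, map_add, add_apply]

/-- `tr (P⁻¹ D_U P)`, the logarithmic derivative of the determinant of the mixed block `P` of `h`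
when `D` is the derivative of `h`. -/
def mixedLogDet (h : (Rn n × Rn n) →L[ℝ] (Rn n × Rn n) →L[ℝ] ℝ)
    (D : (Rn n × Rn n) →L[ℝ] (Rn n × Rn n) →L[ℝ] (Rn n × Rn n) →L[ℝ] ℝ)
    (U : Rn n × Rn n) : ℝ :=
  endTrace ((mixedBlock h).inverse ∘L mixedBlock (D U))

lemma mixedLogDet_add (h : (Rn n × Rn n) →L[ℝ] (Rn n × Rn n) →L[ℝ] ℝ)
    (D : (Rn n × Rn n) →L[ℝ] (Rn n × Rn n) →L[ℝ] (Rn n × Rn n) →L[ℝ] ℝ)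
    (U V : Rn n × Rn n) : mixedLogDet h D (U + V) = mixedLogDet h D U + mixedLogDet h D V := by
  rw [mixedLogDet, mixedLogDet, mixedLogDet, ← endTrace_add, ← ContinuousLinearMap.comp_add]
  congr 2
  ext a b
  simp [mixedBlock_apply]

lemma mixedLogDet_neg (h : (Rn n × Rn n) →L[ℝ] (Rn n × Rn n) →L[ℝ] ℝ)
    (D : (Rn n × Rn n) →L[ℝ] (Rn n × Rn n) →L[ℝ] (Rn n × Rn n) →L[ℝ] ℝ)
    (U : Rn n × Rn n) : mixedLogDet h D (-U) = -mixedLogDet h D U := by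
  have h0 : mixedLogDet h D 0 = 0 := by
    have := mixedLogDet_add h D 0 0
    rw [add_zero] at this
    linarith
  have := mixedLogDet_add h D U (-U)
  rw [add_neg_cancel, h0] at this
  linarith

/-- The 2-jet of a spacelike Lagrangian immersion into `ℝⁿ × ℝⁿ`: `Φ` is the differential and `Φ₂`
the second derivative. The last condition is the derivative of the Lagrangian condition. -/
structure IsLagrangianJet (h : (Rn n × Rn n) →L[ℝ] (Rn n × Rn n) →L[ℝ] ℝ)
    (D : (Rn n × Rn n) →L[ℝ] (Rn n × Rn n) →L[ℝ] (Rn n × Rn n) →L[ℝ] ℝ)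
    (Φ : Rn n →L[ℝ] Rn n × Rn n) (Φ₂ : Rn n →L[ℝ] Rn n →L[ℝ] Rn n × Rn n) : Prop where
  form : IsKMForm h
  deriv : IsKMDeriv D
  spacelike : ∀ u, u ≠ 0 → 0 < h (Φ u) (Φ u)
  lagrangian : ∀ u v, h (K (Φ u)) (Φ v) = 0
  symm : ∀ u v, Φ₂ u v = Φ₂ v u
  deriv_lagrangian : ∀ w u v,
    D (Φ w) (K (Φ u)) (Φ v) + h (K (Φ₂ w u)) (Φ v) + h (K (Φ u)) (Φ₂ w v) = 0

/-- The first component of the differential of a map into a product. -/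
def fstD (Φ : Rn n →L[ℝ] Rn n × Rn n) : Rn n →L[ℝ] Rn n :=
  (ContinuousLinearMap.fst ℝ (Rn n) (Rn n)) ∘L Φ

/-- The second component of the differential of a map into a product. -/
def sndD (Φ : Rn n →L[ℝ] Rn n × Rn n) : Rn n →L[ℝ] Rn n :=
  (ContinuousLinearMap.snd ℝ (Rn n) (Rn n)) ∘L Φ

@[simp] lemma fstD_apply (Φ : Rn n →L[ℝ] Rn n × Rn n) (u : Rn n) : fstD Φ u = (Φ u).1 := rfl

@[simp] lemma sndD_apply (Φ : Rn n →L[ℝ] Rn n × Rn n) (u : Rn n) : sndD Φ u = (Φ u).2 := rfl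

section PointwiseLagrangian

variable {h : (Rn n × Rn n) →L[ℝ] (Rn n × Rn n) →L[ℝ] ℝ} (hh : IsKMForm h)
  {Φ : Rn n →L[ℝ] Rn n × Rn n} (hpos : ∀ u, u ≠ 0 → 0 < h (Φ u) (Φ u))
  (hlag : ∀ u v, h (K (Φ u)) (Φ v) = 0)

include hh hlag in
/-- On a Lagrangian subspace the induced metric is `g(u, v) = 2 P(Φu, Φv)`. -/
lemma induced_eq_mixedBlock (u v : Rn n) :
    h (Φ u) (Φ v) = 2 * mixedBlock h (Φ u).1 (Φ v).2 := by
  have := hlag u v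
  rw [hh.apply_eq] at this ⊢
  simp [K] at this
  linarith

include hpos in
lemma isInvertible_bilinearComp : (h.bilinearComp Φ Φ).IsInvertible := by
  refine isInvertible_of_nondegenerate _ fun u hu => ?_
  by_contra hne
  exact (hpos u hne).ne' (hu u)

include hh hpos hlag

lemma isInvertible_fstD : (fstD Φ).IsInvertible := by
  refine isInvertible_of_injective fun u hu => ?_
  by_contra hne
  have := hpos u hne
  rw [induced_eq_mixedBlock hh hlag] at this
  simp only [fstD_apply] at hu
  simp [hu] at this

lemma isInvertible_sndD : (sndD Φ).IsInvertible := by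
  refine isInvertible_of_injective fun u hu => ?_
  by_contra hne
  have := hpos u hne
  rw [induced_eq_mixedBlock hh hlag] at this
  simp only [sndD_apply] at hu
  simp [hu] at this

end PointwiseLagrangian

namespace IsLagrangianJet

variable {h : (Rn n × Rn n) →L[ℝ] (Rn n × Rn n) →L[ℝ] ℝ}
  {D : (Rn n × Rn n) →L[ℝ] (Rn n × Rn n) →L[ℝ] (Rn n × Rn n) →L[ℝ] ℝ}
  {Φ : Rn n →L[ℝ] Rn n × Rn n} {Φ₂ : Rn n →L[ℝ] Rn n →L[ℝ] Rn n × Rn n}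
  (J : IsLagrangianJet h D Φ Φ₂)

include J

/-- The induced metric written through an endomorphism of the first factor. -/
lemma mixedBlock_fst (a v : Rn n) : mixedBlock h a (Φ v).2
    = 1 / 2 * h.bilinearComp Φ Φ ((fstD Φ).inverse a) v := by
  have h1 := comp_inverse_apply (isInvertible_fstD J.form J.spacelike J.lagrangian) a
  rw [fstD_apply] at h1
  rw [ContinuousLinearMap.bilinearComp_apply, induced_eq_mixedBlock J.form J.lagrangian, h1]
  ring

lemma mixedBlock_snd (v b : Rn n) : mixedBlock h (Φ v).1 b
    = 1 / 2 * h.bilinearComp Φ Φ v ((sndD Φ).inverse b) := by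
  have h1 := comp_inverse_apply (isInvertible_sndD J.form J.spacelike J.lagrangian) b
  rw [sndD_apply] at h1
  rw [ContinuousLinearMap.bilinearComp_apply, induced_eq_mixedBlock J.form J.lagrangian, h1]
  ring

lemma mixedBlock_deriv (U : Rn n × Rn n) (u v : Rn n) :
    mixedBlock (D U) (Φ u).1 (Φ v).2 = 1 / 2 * h.bilinearComp Φ Φ
      (((fstD Φ).inverse ∘L ((mixedBlock h).inverse ∘L mixedBlock (D U)) ∘L fstD Φ) u) v := by
  have h1 : mixedBlock h ((mixedBlock h).inverse (mixedBlock (D U) (Φ u).1))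
      = mixedBlock (D U) (Φ u).1 := apply_sharp J.form.mixedBlock_isInvertible _
  rw [← h1, J.mixedBlock_fst]
  simp

lemma induced_symm (u v : Rn n) :
    h.bilinearComp Φ Φ u v = h.bilinearComp Φ Φ v u := J.form.symm _ _

lemma endTrace_mixedBlock_deriv (U : Rn n × Rn n) :
    endTrace ((fstD Φ).inverse ∘L ((mixedBlock h).inverse ∘L mixedBlock (D U)) ∘L fstD Φ)
      = mixedLogDet h D U := by
  rw [endTrace_comp_comm, mixedLogDet]
  congr 1
  ext1 v
  simp only [ContinuousLinearMap.comp_apply]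
  rw [comp_inverse_apply (isInvertible_fstD J.form J.spacelike J.lagrangian)]

/-- The trilinear form `h(D²F(u, v) + Γ(dF u, dF v), K dF w)`, in terms of the mixed block. -/
lemma secondFF_form (u v w : Rn n) :
    h (Φ₂ u v + sharp h ((1 / 2 : ℝ) • (D (Φ u) (Φ v) + D (Φ v) (Φ u)
        - (D.flip (Φ u)).flip (Φ v)))) (K (Φ w))
      = mixedBlock h (Φ w).1 (Φ₂ u v).2 - mixedBlock h (Φ₂ u v).1 (Φ w).2
        + mixedBlock (D (0, (Φ u).2)) (Φ w).1 (Φ v).2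
        - mixedBlock (D ((Φ u).1, 0)) (Φ v).1 (Φ w).2 := by
  have hml (a b c : Rn n) : mixedBlock (D (a, 0)) b c = mixedBlock (D (b, 0)) a c :=
    J.deriv.mixed_left a b c
  have hmr (a b c : Rn n) : mixedBlock (D (0, a)) b c = mixedBlock (D (0, c)) b a :=
    J.deriv.mixed_right a c b
  rw [map_add, apply_sharp J.form.isInvertible, add_apply, smul_apply, sub_apply, add_apply,
    ContinuousLinearMap.flip_apply, ContinuousLinearMap.flip_apply, J.form.apply_eq,
    J.deriv.apply_eq, J.deriv.apply_eq, J.deriv.apply_eq]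
  rw [mixedBlock_deriv_eq D (Φ u), mixedBlock_deriv_eq D (Φ u), mixedBlock_deriv_eq D (Φ v),
    mixedBlock_deriv_eq D (Φ v), mixedBlock_deriv_eq D (K (Φ w)),
    mixedBlock_deriv_eq D (K (Φ w))]
  have e (U : Rn n × Rn n) (a b : Rn n) : mixedBlock (D U) a (-b) = -mixedBlock (D U) a b := by
    rw [map_neg]
  have e' (a b : Rn n) : mixedBlock (D (0, -a)) b = -mixedBlock (D (0, a)) b := by
    ext c
    have : ((0 : Rn n), -a) = -(0, a) := by simp
    rw [this]
    simp only [mixedBlock_apply, map_neg, neg_apply]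
  simp only [K, map_neg, e', neg_apply, smul_eq_mul]
  rw [hml (Φ v).1 (Φ u).1, hmr (Φ v).2 (Φ w).1, hml (Φ w).1 (Φ u).1 (Φ v).2,
    hml (Φ w).1 (Φ v).1 (Φ u).2, hmr (Φ w).2 (Φ u).1 (Φ v).2, hmr (Φ w).2 (Φ v).1 (Φ u).2]
  ring

/-- The trilinear form of `secondFF_form` is totally symmetric; its trace in the first two
arguments is therefore a trace of endomorphisms. -/
lemma metricTrace_secondFF_form (w : Rn n) :
    metricTrace (h.bilinearComp Φ Φ) (fun u v =>
      h (Φ₂ u v + sharp h ((1 / 2 : ℝ) • (D (Φ u) (Φ v) + D (Φ v) (Φ u)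
        - (D.flip (Φ u)).flip (Φ v)))) (K (Φ w)))
      = 1 / 2 * (endTrace ((sndD Φ).inverse ∘L sndD (Φ₂ w))
        - endTrace ((fstD Φ).inverse ∘L fstD (Φ₂ w))
        + mixedLogDet h D (0, (Φ w).2) - mixedLogDet h D ((Φ w).1, 0)) := by
  have hg := isInvertible_bilinearComp J.spacelike
  have hml (a b c : Rn n) : mixedBlock (D (a, 0)) b c = mixedBlock (D (b, 0)) a c :=
    J.deriv.mixed_left a b c
  have hmr (a b c : Rn n) : mixedBlock (D (0, a)) b c = mixedBlock (D (0, c)) b a :=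
    J.deriv.mixed_right a c b
  have hperm : (fun u v => h (Φ₂ u v + sharp h ((1 / 2 : ℝ) • (D (Φ u) (Φ v) + D (Φ v) (Φ u)
        - (D.flip (Φ u)).flip (Φ v)))) (K (Φ w)))
      = fun u v => mixedBlock h (Φ v).1 (Φ₂ w u).2 - mixedBlock h (Φ₂ w u).1 (Φ v).2
        + mixedBlock (D (0, (Φ w).2)) (Φ v).1 (Φ u).2
        - mixedBlock (D ((Φ w).1, 0)) (Φ u).1 (Φ v).2 := by
    funext u v
    rw [J.secondFF_form, J.symm w u]
    have := J.deriv_lagrangian u v w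
    rw [J.deriv.apply_eq, J.form.apply_eq, J.form.apply_eq (K (Φ v)),
      mixedBlock_deriv_eq D (Φ u), mixedBlock_deriv_eq D (Φ u)] at this
    simp only [K, map_neg] at this
    rw [hmr (Φ w).2, hml (Φ w).1]
    linarith
  rw [hperm, metricTrace_sub, metricTrace_add, metricTrace_sub]
  have t1 : metricTrace (h.bilinearComp Φ Φ) (fun u v => mixedBlock h (Φ v).1 (Φ₂ w u).2)
      = 1 / 2 * endTrace ((sndD Φ).inverse ∘L sndD (Φ₂ w)) := by
    simp only [J.mixedBlock_snd]
    rw [metricTrace_const_mul, metricTrace_eq_endTrace hg J.induced_symm fun u v => ?_]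
    rw [J.induced_symm]
    rfl
  have t2 : metricTrace (h.bilinearComp Φ Φ) (fun u v => mixedBlock h (Φ₂ w u).1 (Φ v).2)
      = 1 / 2 * endTrace ((fstD Φ).inverse ∘L fstD (Φ₂ w)) := by
    simp only [J.mixedBlock_fst]
    rw [metricTrace_const_mul, metricTrace_eq_endTrace hg J.induced_symm fun u v => ?_]
    rfl
  have t3 : metricTrace (h.bilinearComp Φ Φ)
      (fun u v => mixedBlock (D (0, (Φ w).2)) (Φ v).1 (Φ u).2)
      = 1 / 2 * mixedLogDet h D (0, (Φ w).2) := by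
    simp only [J.mixedBlock_deriv]
    rw [metricTrace_const_mul, metricTrace_eq_endTrace_right hg J.induced_symm fun u v =>
      J.induced_symm _ _, J.endTrace_mixedBlock_deriv]
  have t4 : metricTrace (h.bilinearComp Φ Φ)
      (fun u v => mixedBlock (D ((Φ w).1, 0)) (Φ u).1 (Φ v).2)
      = 1 / 2 * mixedLogDet h D ((Φ w).1, 0) := by
    simp only [J.mixedBlock_deriv]
    rw [metricTrace_const_mul, metricTrace_eq_endTrace hg J.induced_symm fun u v => rfl,
      J.endTrace_mixedBlock_deriv]
  rw [t1, t2, t3, t4]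
  ring

/-- The trace of the derivative of the induced metric. -/
lemma metricTrace_deriv_induced (w : Rn n) :
    metricTrace (h.bilinearComp Φ Φ) (fun u v =>
      D (Φ w) (Φ u) (Φ v) + h (Φ₂ w u) (Φ v) + h (Φ u) (Φ₂ w v))
      = endTrace ((fstD Φ).inverse ∘L fstD (Φ₂ w)) + endTrace ((sndD Φ).inverse ∘L sndD (Φ₂ w))
        + mixedLogDet h D (Φ w) := by
  have hg := isInvertible_bilinearComp J.spacelike
  have hexp : (fun u v => D (Φ w) (Φ u) (Φ v) + h (Φ₂ w u) (Φ v) + h (Φ u) (Φ₂ w v))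
      = fun u v => (mixedBlock (D (Φ w)) (Φ u).1 (Φ v).2 + mixedBlock (D (Φ w)) (Φ v).1 (Φ u).2)
        + (mixedBlock h (Φ₂ w u).1 (Φ v).2 + mixedBlock h (Φ v).1 (Φ₂ w u).2)
        + (mixedBlock h (Φ₂ w v).1 (Φ u).2 + mixedBlock h (Φ u).1 (Φ₂ w v).2) := by
    funext u v
    rw [J.deriv.apply_eq, J.form.apply_eq, J.form.apply_eq (Φ u)]
    ring
  have s1 : metricTrace (h.bilinearComp Φ Φ) (fun u v =>
      h.bilinearComp Φ Φ ((fstD Φ).inverse (Φ₂ w u).1) v)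
      = endTrace ((fstD Φ).inverse ∘L fstD (Φ₂ w)) :=
    metricTrace_eq_endTrace hg J.induced_symm fun u v => rfl
  have s2 : metricTrace (h.bilinearComp Φ Φ) (fun u v =>
      h.bilinearComp Φ Φ v ((sndD Φ).inverse (Φ₂ w u).2))
      = endTrace ((sndD Φ).inverse ∘L sndD (Φ₂ w)) :=
    metricTrace_eq_endTrace hg J.induced_symm fun u v => J.induced_symm _ _
  have s3 : metricTrace (h.bilinearComp Φ Φ) (fun u v =>
      h.bilinearComp Φ Φ ((fstD Φ).inverse (Φ₂ w v).1) u)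
      = endTrace ((fstD Φ).inverse ∘L fstD (Φ₂ w)) :=
    metricTrace_eq_endTrace_right hg J.induced_symm fun u v => J.induced_symm _ _
  have s4 : metricTrace (h.bilinearComp Φ Φ) (fun u v =>
      h.bilinearComp Φ Φ u ((sndD Φ).inverse (Φ₂ w v).2))
      = endTrace ((sndD Φ).inverse ∘L sndD (Φ₂ w)) :=
    metricTrace_eq_endTrace_right hg J.induced_symm fun u v => rfl
  rw [hexp]
  simp only [J.mixedBlock_deriv, J.mixedBlock_fst, J.mixedBlock_snd]
  simp only [metricTrace_add, metricTrace_const_mul]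
  rw [s1, s2, s3, s4, metricTrace_eq_endTrace hg J.induced_symm (fun u v => rfl),
    metricTrace_eq_endTrace_right hg J.induced_symm (fun u v => J.induced_symm _ _),
    J.endTrace_mixedBlock_deriv]
  ring

end IsLagrangianJet

end Jets

/-! ### Tangent vectors in a fixed chart -/

section Charts

variable {V : Type*} [NormedAddCommGroup V] [NormedSpace ℝ V]
  {H : Type*} [TopologicalSpace H] (J : ModelWithCorners ℝ V H)
  {N : Type*} [TopologicalSpace N] [ChartedSpace H N]

/-- The differential at `w` of the inverse of the preferred chart at `z₀`, which turns the
coordinates of a tangent vector in this chart into the element of the model space that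
represents it. -/
def chartD (z₀ : N) (w : V) : V →L[ℝ] V := mfderiv 𝓘(ℝ, V) J (extChartAt J z₀).symm w

lemma inChart_apply (B : N → V →L[ℝ] V →L[ℝ] ℝ) (z₀ : N) (w u v : V) :
    inChart J B z₀ w u v = B ((extChartAt J z₀).symm w) (chartD J z₀ w u) (chartD J z₀ w v) := rfl

variable [J.Boundaryless] [IsManifold J ∞ N]

lemma chartD_isInvertible {z₀ : N} {w : V} (hw : w ∈ (extChartAt J z₀).target) :
    (chartD J z₀ w).IsInvertible := by
  have : IsManifold J 1 N := IsManifold.of_le (n := ∞) (by simp)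
  have := isInvertible_mfderivWithin_extChartAt_symm (I := J) hw
  rwa [J.range_eq_univ, mfderivWithin_univ] at this

lemma chartD_self (z₀ : N) : chartD J z₀ (extChartAt J z₀ z₀) = ContinuousLinearMap.id ℝ V := by
  have : IsManifold J 1 N := IsManifold.of_le (n := ∞) (by simp)
  have := mfderivWithin_range_extChartAt_symm (I := J) (x := z₀)
  rwa [J.range_eq_univ, mfderivWithin_univ] at this

lemma inChart_self (B : N → V →L[ℝ] V →L[ℝ] ℝ) (z₀ : N) :
    inChart J B z₀ (extChartAt J z₀ z₀) = B z₀ := by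
  ext u v
  rw [inChart_apply, chartD_self, extChartAt_to_inv]
  rfl

lemma hasMFDerivAt_chart_symm {z₀ : N} {w : V} (hw : w ∈ (extChartAt J z₀).target) :
    HasMFDerivAt 𝓘(ℝ, V) J (extChartAt J z₀).symm w
      (mfderiv 𝓘(ℝ, V) J (extChartAt J z₀).symm w) := by
  have : IsManifold J 1 N := IsManifold.of_le (n := ∞) (by simp)
  have := mdifferentiableWithinAt_extChartAt_symm (I := J) hw
  rw [J.range_eq_univ, mdifferentiableWithinAt_univ] at this
  exact this.hasMFDerivAt

/-- The chain rule for a function read in a fixed chart. -/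
lemma hasFDerivAt_comp_chart_symm {z₀ : N} {w : V} (hw : w ∈ (extChartAt J z₀).target)
    {f : N → ℝ} (hf : MDifferentiableAt J 𝓘(ℝ, ℝ) f ((extChartAt J z₀).symm w)) :
    HasFDerivAt (f ∘ (extChartAt J z₀).symm)
      ((differential J f ((extChartAt J z₀).symm w)).comp (chartD J z₀ w)) w := by
  have h := HasMFDerivAt.comp w hf.hasMFDerivAt (hasMFDerivAt_chart_symm J hw)
  exact hasMFDerivAt_iff_hasFDerivAt.1 h

lemma fderiv_comp_chart_symm_self {z₀ : N} {f : N → ℝ} (hf : MDifferentiableAt J 𝓘(ℝ, ℝ) f z₀) :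
    fderiv ℝ (f ∘ (extChartAt J z₀).symm) (extChartAt J z₀ z₀) = differential J f z₀ := by
  have h := (hasFDerivAt_comp_chart_symm J (mem_extChartAt_target z₀) (f := f)
    (by rwa [extChartAt_to_inv])).fderiv
  rw [h, chartD_self, extChartAt_to_inv]
  rfl

variable {V₂ : Type*} [NormedAddCommGroup V₂] [NormedSpace ℝ V₂]
  {H₂ : Type*} [TopologicalSpace H₂] (J₂ : ModelWithCorners ℝ V₂ H₂) [J₂.Boundaryless]
  {N₂ : Type*} [TopologicalSpace N₂] [ChartedSpace H₂ N₂] [IsManifold J₂ ∞ N₂]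

/-- The chain rule for a map from a vector space to a manifold, read in a fixed chart of the
target. -/
lemma chartD_fderivWithin {s : Set V} {w : V} (hs : UniqueDiffWithinAt ℝ s w) {z₂ : N₂}
    {F : V → N₂} (hF : MDifferentiableWithinAt 𝓘(ℝ, V) J₂ F s w)
    (hz : F w ∈ (extChartAt J₂ z₂).source) (v : V) :
    DifferentiableWithinAt ℝ (fun y => extChartAt J₂ z₂ (F y)) s w ∧
    chartD J₂ z₂ (extChartAt J₂ z₂ (F w))
      (fderivWithin ℝ (fun y => extChartAt J₂ z₂ (F y)) s w v)
      = (mfderivWithin 𝓘(ℝ, V) J₂ F s w : V →L[ℝ] V₂) v := by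
  have : IsManifold J₂ 1 N₂ := IsManifold.of_le (n := ∞) (by simp)
  have hz' : F w ∈ (chartAt H₂ z₂).source := by rwa [← extChartAt_source J₂]
  have h1 : MDifferentiableWithinAt 𝓘(ℝ, V) 𝓘(ℝ, V₂) (fun y => extChartAt J₂ z₂ (F y)) s w :=
    (mdifferentiableAt_extChartAt (I := J₂) hz').comp_mdifferentiableWithinAt w hF
  have h1' := h1.differentiableWithinAt
  refine ⟨h1', ?_⟩
  have h2 : HasMFDerivWithinAt 𝓘(ℝ, V) 𝓘(ℝ, V₂) (fun y => extChartAt J₂ z₂ (F y)) s w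
      (fderivWithin ℝ (fun y => extChartAt J₂ z₂ (F y)) s w) :=
    h1'.hasFDerivWithinAt.hasMFDerivWithinAt
  have h3 := HasMFDerivAt.comp_hasMFDerivWithinAt w
    (hasMFDerivAt_chart_symm J₂ ((extChartAt J₂ z₂).map_source hz)) h2
  have h4 : HasMFDerivWithinAt 𝓘(ℝ, V) J₂ F s w
      ((mfderiv 𝓘(ℝ, V₂) J₂ (extChartAt J₂ z₂).symm (extChartAt J₂ z₂ (F w))).comp
        (fderivWithin ℝ (fun y => extChartAt J₂ z₂ (F y)) s w)) := by
    refine h3.congr_of_eventuallyEq ?_ ?_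
    · filter_upwards [hF.continuousWithinAt.preimage_mem_nhdsWithin
        ((isOpen_extChartAt_source (I := J₂) z₂).mem_nhds hz)] with y hy
      exact ((extChartAt J₂ z₂).left_inv hy).symm
    · exact ((extChartAt J₂ z₂).left_inv hz).symm
  have h5 := h4.mfderivWithin hs.uniqueMDiffWithinAt
  rw [h5]
  rfl

/-- The chain rule for a map between manifolds, read in fixed charts. -/
lemma chartD_fderiv {z₁ : N} {w : V} (hw : w ∈ (extChartAt J z₁).target) {z₂ : N₂}
    {F : N → N₂} (hF : MDifferentiableAt J J₂ F ((extChartAt J z₁).symm w))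
    (hz : F ((extChartAt J z₁).symm w) ∈ (extChartAt J₂ z₂).source) (v : V) :
    chartD J₂ z₂ (extChartAt J₂ z₂ (F ((extChartAt J z₁).symm w)))
      (fderiv ℝ (fun y => extChartAt J₂ z₂ (F ((extChartAt J z₁).symm y))) w v)
      = (mfderiv J J₂ F ((extChartAt J z₁).symm w) : V →L[ℝ] V₂) (chartD J z₁ w v) := by
  have h0 := HasMFDerivAt.comp w hF.hasMFDerivAt (hasMFDerivAt_chart_symm J hw)
  have h1 := (chartD_fderivWithin J₂ (s := Set.univ) (w := w) uniqueDiffWithinAt_univ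
    (F := F ∘ (extChartAt J z₁).symm) h0.mdifferentiableAt.mdifferentiableWithinAt hz v).2
  rw [fderivWithin_univ, mfderivWithin_univ, h0.mfderiv] at h1
  exact h1

end Charts

section Product

variable {n : ℕ} {M : Type*} [TopologicalSpace M] [ChartedSpace (Rn n) M]
  {M' : Type*} [TopologicalSpace M'] [ChartedSpace (Rn n) M']

lemma extChartAt_prodModel_symm (z₀ : M × M') (w : Rn n × Rn n) :
    (extChartAt (prodModel n) z₀).symm w
      = ((extChartAt 𝓘(ℝ, Rn n) z₀.1).symm w.1, (extChartAt 𝓘(ℝ, Rn n) z₀.2).symm w.2) := by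
  rw [extChartAt_prod]
  rfl

lemma extChartAt_prodModel (z₀ z : M × M') : extChartAt (prodModel n) z₀ z
    = (extChartAt 𝓘(ℝ, Rn n) z₀.1 z.1, extChartAt 𝓘(ℝ, Rn n) z₀.2 z.2) := by
  rw [extChartAt_prod]
  rfl

lemma mem_extChartAt_prodModel_target {z₀ : M × M'} {w : Rn n × Rn n} :
    w ∈ (extChartAt (prodModel n) z₀).target ↔
      w.1 ∈ (extChartAt 𝓘(ℝ, Rn n) z₀.1).target ∧ w.2 ∈ (extChartAt 𝓘(ℝ, Rn n) z₀.2).target := by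
  rw [extChartAt_prod]
  exact Iff.rfl

variable [IsManifold 𝓘(ℝ, Rn n) ∞ M] [IsManifold 𝓘(ℝ, Rn n) ∞ M']

lemma chartD_prod {z₀ : M × M'} {w : Rn n × Rn n}
    (hw : w ∈ (extChartAt (prodModel n) z₀).target) (v : Rn n × Rn n) :
    chartD (prodModel n) z₀ w v
      = (chartD 𝓘(ℝ, Rn n) z₀.1 w.1 v.1, chartD 𝓘(ℝ, Rn n) z₀.2 w.2 v.2) := by
  obtain ⟨h1, h2⟩ := mem_extChartAt_prodModel_target.1 hw
  have e1 := hasMFDerivAt_chart_symm 𝓘(ℝ, Rn n) h1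
  have e2 := hasMFDerivAt_chart_symm 𝓘(ℝ, Rn n) h2
  have e := HasMFDerivAt.prodMap (p := w) e1 e2
  have e' := e.mfderiv
  rw [← modelWithCornersSelf_prod, chartedSpaceSelf_prod] at e'
  have hfun : (extChartAt (prodModel n) z₀).symm
      = Prod.map (extChartAt 𝓘(ℝ, Rn n) z₀.1).symm (extChartAt 𝓘(ℝ, Rn n) z₀.2).symm :=
    funext fun v => extChartAt_prodModel_symm z₀ v
  rw [chartD, hfun]
  exact congrArg (fun A : Rn n × Rn n →L[ℝ] Rn n × Rn n => A v) e'

end Product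

/-! ### Smoothness of fields of linear maps -/

section Smoothness

variable {X E F : Type*} [NormedAddCommGroup X] [NormedSpace ℝ X] [NormedAddCommGroup E]
  [NormedSpace ℝ E] [NormedAddCommGroup F] [NormedSpace ℝ F]

lemma fderiv_apply_eq {f : X → E →L[ℝ] F} {x : X} (hf : DifferentiableAt ℝ f x) (v : X) (y : E) :
    fderiv ℝ f x v y = fderiv ℝ (fun x => f x y) x v := by
  rw [fderiv_clm_apply hf (differentiableAt_const y)]
  simp

variable [FiniteDimensional ℝ E]

lemma contDiffWithinAt_of_apply {k : ℕ∞ω} {f : X → E →L[ℝ] F} {s : Set X} {x : X}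
    (h : ∀ y, ContDiffWithinAt ℝ k (fun x => f x y) s x) : ContDiffWithinAt ℝ k f s x := by
  let d := Module.finrank ℝ E
  have hd : d = Module.finrank ℝ (Fin d → ℝ) := (Module.finrank_fin_fun ℝ).symm
  let e₁ := ContinuousLinearEquiv.ofFinrankEq hd
  let e₂ := (e₁.arrowCongr (1 : F ≃L[ℝ] F)).trans (ContinuousLinearEquiv.piRing (Fin d))
  rw [← Function.id_comp f, ← e₂.symm_comp_self]
  exact e₂.symm.contDiff.contDiffAt.comp_contDiffWithinAt x
    (contDiffWithinAt_pi.mpr fun i => h _)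

lemma contDiffAt_of_apply {k : ℕ∞ω} {f : X → E →L[ℝ] F} {x : X}
    (h : ∀ y, ContDiffAt ℝ k (fun x => f x y) x) : ContDiffAt ℝ k f x := by
  rw [← contDiffWithinAt_univ]
  exact contDiffWithinAt_of_apply fun y => (h y).contDiffWithinAt

end Smoothness

/-! ### Densities and the metric in coordinates -/

section Density

variable {n : ℕ}

lemma alternating_apply_eq (α : Rn n [⋀^Fin n]→ₗ[ℝ] ℝ) (A : Rn n →L[ℝ] Rn n) :
    α (fun i => A (coordVec i)) = (endMatrix A).det * α coordVec := by
  have hb : ⇑(EuclideanSpace.basisFun (Fin n) ℝ).toBasis = (coordVec : Fin n → Rn n) := by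
    funext i
    simp [coordVec]
  have h := AlternatingMap.congr_fun
    (α.eq_smul_basis_det (EuclideanSpace.basisFun (Fin n) ℝ).toBasis) (fun i => A (coordVec i))
  rw [h, hb, AlternatingMap.smul_apply, Module.Basis.det_apply, smul_eq_mul, mul_comm]
  rfl

lemma alternating_coordVec_ne_zero {α : Rn n [⋀^Fin n]→ₗ[ℝ] ℝ} (hα : α ≠ 0) :
    α coordVec ≠ 0 := by
  intro h0
  apply hα
  have hb : ⇑(EuclideanSpace.basisFun (Fin n) ℝ).toBasis = (coordVec : Fin n → Rn n) := by
    funext i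
    simp [coordVec]
  rw [α.eq_smul_basis_det (EuclideanSpace.basisFun (Fin n) ℝ).toBasis, hb, h0, zero_smul]

variable {M : Type*} [TopologicalSpace M] [ChartedSpace (Rn n) M]

lemma coordDensity_eq (ρ : M → Rn n [⋀^Fin n]→ₗ[ℝ] ℝ) (x₀ : M) (w : Rn n) :
    coordDensity ρ x₀ w = (endMatrix (chartD 𝓘(ℝ, Rn n) x₀ w)).det
      * ρ ((extChartAt 𝓘(ℝ, Rn n) x₀).symm w) coordVec :=
  alternating_apply_eq _ (chartD 𝓘(ℝ, Rn n) x₀ w)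

/-- The value of `ρ` on the frame with coordinates `A eᵢ`. -/
lemma density_comp (ρ : M → Rn n [⋀^Fin n]→ₗ[ℝ] ℝ) (x₀ : M) (w : Rn n) (A : Rn n →L[ℝ] Rn n) :
    ρ ((extChartAt 𝓘(ℝ, Rn n) x₀).symm w) (fun i => chartD 𝓘(ℝ, Rn n) x₀ w (A (coordVec i)))
      = coordDensity ρ x₀ w * (endMatrix A).det := by
  have h := alternating_apply_eq (ρ ((extChartAt 𝓘(ℝ, Rn n) x₀).symm w))
    (chartD 𝓘(ℝ, Rn n) x₀ w ∘L A)
  rw [endMatrix_comp, Matrix.det_mul] at h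
  rw [coordDensity_eq]
  refine h.trans (by ring)

lemma contDiffAt_coordDensity {ρ : M → Rn n [⋀^Fin n]→ₗ[ℝ] ℝ} (hρ : IsC2Form ρ) {x₀ : M}
    {w : Rn n} (hw : w ∈ (extChartAt 𝓘(ℝ, Rn n) x₀).target) :
    ContDiffAt ℝ 2 (coordDensity ρ x₀) w :=
  (hρ x₀).contDiffAt ((isOpen_extChartAt_target x₀).mem_nhds hw)

/-- The logarithmic differential at `x₀` of the density of `ρ` in the preferred chart at `x₀`. -/
def dlogDensity (ρ : M → Rn n [⋀^Fin n]→ₗ[ℝ] ℝ) (x₀ : M) : Rn n →L[ℝ] ℝ :=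
  (coordDensity ρ x₀ (extChartAt 𝓘(ℝ, Rn n) x₀ x₀))⁻¹ •
    fderiv ℝ (coordDensity ρ x₀) (extChartAt 𝓘(ℝ, Rn n) x₀ x₀)

variable [IsManifold 𝓘(ℝ, Rn n) ∞ M]

lemma coordDensity_ne_zero {ρ : M → Rn n [⋀^Fin n]→ₗ[ℝ] ℝ} (hρ : ∀ x, ρ x ≠ 0) {x₀ : M} {w : Rn n}
    (hw : w ∈ (extChartAt 𝓘(ℝ, Rn n) x₀).target) : coordDensity ρ x₀ w ≠ 0 := by
  rw [coordDensity_eq]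
  exact mul_ne_zero (det_endMatrix_ne_zero (chartD_isInvertible _ hw))
    (alternating_coordVec_ne_zero (hρ _))

end Density

section MixedMatrix

variable {n : ℕ}

/-- Half the standard inner product. Its inverse turns the mixed block of a Kim-McCann form into
an endomorphism whose matrix is (the transpose of) the matrix `-c_{i s̄}`. -/
def halfInner (n : ℕ) : Rn n →L[ℝ] Rn n →L[ℝ] ℝ :=
  (1 / 2 : ℝ) • ∑ i : Fin n, (EuclideanSpace.proj (𝕜 := ℝ) i : Rn n →L[ℝ] ℝ).smulRight
    (EuclideanSpace.proj (𝕜 := ℝ) i : Rn n →L[ℝ] ℝ)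

lemma halfInner_apply (u v : Rn n) : halfInner n u v = 1 / 2 * ∑ i, u i * v i := by
  simp [halfInner]

lemma halfInner_isInvertible : (halfInner n).IsInvertible := by
  refine isInvertible_of_nondegenerate _ fun u hu => ?_
  ext i
  have := hu (coordVec i)
  rw [halfInner_apply] at this
  simpa [coordVec_apply] using this

/-- The mixed block of a bilinear form as an endomorphism of `ℝⁿ`. -/
def mixedEnd (n : ℕ) : ((Rn n × Rn n) →L[ℝ] (Rn n × Rn n) →L[ℝ] ℝ) →L[ℝ] (Rn n →L[ℝ] Rn n) :=
  LinearMap.toContinuousLinearMap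
    { toFun := fun B => (halfInner n).inverse ∘L mixedBlock B
      map_add' := fun B C => by
        ext1 v
        simp only [ContinuousLinearMap.comp_apply, add_apply]
        rw [← map_add]
        rfl
      map_smul' := fun c B => by
        ext1 v
        simp only [ContinuousLinearMap.comp_apply, smul_apply, RingHom.id_apply]
        rw [← map_smul]
        rfl }

lemma mixedEnd_apply (B : (Rn n × Rn n) →L[ℝ] (Rn n × Rn n) →L[ℝ] ℝ) :
    mixedEnd n B = (halfInner n).inverse ∘L mixedBlock B := rfl

lemma endMatrix_mixedEnd (B : (Rn n × Rn n) →L[ℝ] (Rn n × Rn n) →L[ℝ] ℝ) :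
    (endMatrix (mixedEnd n B)).transpose
      = Matrix.of fun i s : Fin n => 2 * B (coordVec i, 0) (0, coordVec s) := by
  ext i s
  have h := halfInner_apply (sharp (halfInner n) (mixedBlock B (coordVec i))) (coordVec s)
  rw [apply_sharp halfInner_isInvertible, mixedBlock_apply] at h
  simp only [Matrix.transpose_apply, endMatrix, Matrix.of_apply, h]
  simp [coordVec_apply, mixedEnd_apply, sharp]

lemma isInvertible_inverse {E F : Type*} [NormedAddCommGroup E] [NormedSpace ℝ E]
    [NormedAddCommGroup F] [NormedSpace ℝ F] {A : E →L[ℝ] F} (hA : A.IsInvertible) :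
    A.inverse.IsInvertible := by
  obtain ⟨e, rfl⟩ := hA
  exact ⟨e.symm, by simp⟩

lemma mixedEnd_isInvertible {h : (Rn n × Rn n) →L[ℝ] (Rn n × Rn n) →L[ℝ] ℝ} (hh : IsKMForm h) :
    (mixedEnd n h).IsInvertible :=
  (isInvertible_inverse halfInner_isInvertible).comp hh.mixedBlock_isInvertible

lemma endTrace_mixedEnd (h : (Rn n × Rn n) →L[ℝ] (Rn n × Rn n) →L[ℝ] ℝ)
    (D : (Rn n × Rn n) →L[ℝ] (Rn n × Rn n) →L[ℝ] (Rn n × Rn n) →L[ℝ] ℝ) (U : Rn n × Rn n) :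
    endTrace ((mixedEnd n h).inverse ∘L mixedEnd n (D U)) = mixedLogDet h D U := by
  rw [mixedEnd_apply, mixedEnd_apply,
    (isInvertible_inverse halfInner_isInvertible).inverse_comp_of_left, mixedLogDet]
  congr 1
  ext1 v
  simp only [ContinuousLinearMap.comp_apply]
  congr 1
  obtain ⟨e, he⟩ := halfInner_isInvertible (n := n)
  rw [← he]
  simp

end MixedMatrix

section Metric

variable {n : ℕ} {M : Type*} [TopologicalSpace M] [ChartedSpace (Rn n) M]
  {M' : Type*} [TopologicalSpace M'] [ChartedSpace (Rn n) M']
  (G : GKM n M M')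

lemma GKM.isKMForm {z : M × M'} (hz : z ∉ G.cut) : IsKMForm (G.h z) :=
  ⟨G.h_symm z hz, G.h_nondegenerate z hz, G.h_left z hz, G.h_right z hz⟩

lemma eventually_chart {z₀ : M × M'} {U : Set (M × M')} (hU : IsOpen U) (hz : z₀ ∈ U) :
    ∀ᶠ w in 𝓝 (extChartAt (prodModel n) z₀ z₀),
      w ∈ (extChartAt (prodModel n) z₀).target ∧ (extChartAt (prodModel n) z₀).symm w ∈ U := by
  have h1 := extChartAt_target_mem_nhds (I := prodModel n) z₀
  have h2 := continuousAt_extChartAt_symm (I := prodModel n) z₀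
  filter_upwards [h1, h2.preimage_mem_nhds (by
    rw [extChartAt_to_inv]; exact hU.mem_nhds hz)] with w hw hw'
  exact ⟨hw, hw'⟩

variable [IsManifold 𝓘(ℝ, Rn n) ∞ M] [IsManifold 𝓘(ℝ, Rn n) ∞ M']

lemma exists_chartD_eq {z₀ : M × M'} {w : Rn n × Rn n}
    (hw : w ∈ (extChartAt (prodModel n) z₀).target) (V : Rn n × Rn n) :
    ∃ U, chartD (prodModel n) z₀ w U = V :=
  ⟨(chartD (prodModel n) z₀ w).inverse V, comp_inverse_apply (chartD_isInvertible _ hw) V⟩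

lemma GKM.isKMForm_inChart {z₀ : M × M'} {w : Rn n × Rn n}
    (hw : w ∈ (extChartAt (prodModel n) z₀).target)
    (hc : (extChartAt (prodModel n) z₀).symm w ∉ G.cut) :
    IsKMForm (inChart (prodModel n) G.h z₀ w) where
  symm U V := G.h_symm _ hc _ _
  nondegenerate U hU := by
    have h := G.h_nondegenerate _ hc (chartD (prodModel n) z₀ w U) fun V => by
      obtain ⟨V, rfl⟩ := exists_chartD_eq hw V
      exact hU V
    rw [← inverse_comp_apply (chartD_isInvertible _ hw) U, h, map_zero]
  left a b := by
    rw [inChart_apply, chartD_prod hw, chartD_prod hw]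
    simp only [map_zero]
    exact G.h_left _ hc _ _
  right a b := by
    rw [inChart_apply, chartD_prod hw, chartD_prod hw]
    simp only [map_zero]
    exact G.h_right _ hc _ _

/-- In coordinates the mixed derivative, which is defined through two nested manifold derivatives,
is a second partial derivative. -/
lemma mixedDeriv_chart {c : M × M' → ℝ} {U : Set (M × M')} (hU : IsOpen U)
    (hc : ContMDiffOn (prodModel n) 𝓘(ℝ, ℝ) 4 c U) {z₀ : M × M'} {w : Rn n × Rn n}
    (hw : w ∈ (extChartAt (prodModel n) z₀).target)
    (hwU : (extChartAt (prodModel n) z₀).symm w ∈ U)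
    (hC : ContDiffAt ℝ 2 (c ∘ (extChartAt (prodModel n) z₀).symm) w) (a b : Rn n) :
    mixedDeriv c ((extChartAt (prodModel n) z₀).symm w) (chartD 𝓘(ℝ, Rn n) z₀.1 w.1 a)
        (chartD 𝓘(ℝ, Rn n) z₀.2 w.2 b)
      = fderiv ℝ (fderiv ℝ (c ∘ (extChartAt (prodModel n) z₀).symm)) w (a, 0) (0, b) := by
  set C := c ∘ (extChartAt (prodModel n) z₀).symm with hCdef
  obtain ⟨hw1, hw2⟩ := mem_extChartAt_prodModel_target.1 hw
  rw [extChartAt_prodModel_symm] at hwU ⊢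
  set φ := extChartAt 𝓘(ℝ, Rn n) z₀.1
  set φ' := extChartAt 𝓘(ℝ, Rn n) z₀.2
  have hd : ∀ᶠ y in 𝓝 w, DifferentiableAt ℝ C y := by
    filter_upwards [hC.eventually (by simp)] with y hy
    exact hy.differentiableAt two_ne_zero
  have hfd : DifferentiableAt ℝ (fderiv ℝ C) w :=
    (hC.fderiv_right (m := 1) (by norm_num)).differentiableAt one_ne_zero
  -- the inner derivative, as a function of the first point
  set u : M → ℝ := fun x => differential 𝓘(ℝ, Rn n) (fun y : M' => c (x, y)) (φ'.symm w.2)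
    (chartD 𝓘(ℝ, Rn n) z₀.2 w.2 b) with hu
  set v : Rn n → ℝ := fun x => fderiv ℝ C (x, w.2) (0, b) with hv
  have hvd : HasFDerivAt v (((fderiv ℝ (fderiv ℝ C) w).flip (0, b)).comp
      (ContinuousLinearMap.inl ℝ (Rn n) (Rn n))) w.1 := by
    have h1 : HasFDerivAt (fun x : Rn n => (x, w.2)) (ContinuousLinearMap.inl ℝ (Rn n) (Rn n))
        w.1 := (hasFDerivAt_id w.1).prodMk (hasFDerivAt_const w.2 w.1)
    have h2 : HasFDerivAt (fderiv ℝ C) (fderiv ℝ (fderiv ℝ C) w) (w.1, w.2) := hfd.hasFDerivAt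
    have h3 := (h2.comp w.1 h1).clm_apply (hasFDerivAt_const ((0 : Rn n), b) w.1)
    refine h3.congr_fderiv ?_
    ext x
    simp
  have huv : ∀ᶠ x in 𝓝 (φ.symm w.1), u x = v (φ x) := by
    have hs : φ.source ∈ 𝓝 (φ.symm w.1) :=
      (isOpen_extChartAt_source z₀.1).mem_nhds (φ.map_target hw1)
    have hopen : ∀ᶠ x in 𝓝 (φ.symm w.1), (x, φ'.symm w.2) ∈ U :=
      (Continuous.prodMk_left (φ'.symm w.2)).continuousAt.preimage_mem_nhds (hU.mem_nhds hwU)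
    have hcont : ∀ᶠ x in 𝓝 (φ.symm w.1), DifferentiableAt ℝ C (φ x, w.2) := by
      have h1 : ContinuousAt (fun x => (φ x, w.2)) (φ.symm w.1) := by
        have : ContinuousAt φ (φ.symm w.1) :=
          continuousAt_extChartAt' (I := 𝓘(ℝ, Rn n)) (φ.map_target hw1)
        exact this.prodMk continuousAt_const
      refine h1.eventually ?_
      simp only [φ.right_inv hw1]
      exact hd
    filter_upwards [hs, hopen, hcont] with x hx hxU hxd
    have hmd : MDifferentiableAt 𝓘(ℝ, Rn n) 𝓘(ℝ, ℝ) (fun y : M' => c (x, y)) (φ'.symm w.2) := by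
      have h1 : ContMDiffAt (prodModel n) 𝓘(ℝ, ℝ) 4 c (x, φ'.symm w.2) :=
        hc.contMDiffAt (hU.mem_nhds hxU)
      have h2 : ContMDiffAt 𝓘(ℝ, Rn n) (prodModel n) 4 (fun y : M' => (x, y)) (φ'.symm w.2) :=
        contMDiffAt_const.prodMk contMDiffAt_id
      exact (ContMDiffAt.comp (φ'.symm w.2) h1 h2).mdifferentiableAt (by simp)
    have h1 := hasFDerivAt_comp_chart_symm 𝓘(ℝ, Rn n) hw2 hmd
    have h2 : ((fun y : M' => c (x, y)) ∘ φ'.symm) = fun y => C (φ x, y) := by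
      funext y
      simp only [hCdef, Function.comp, extChartAt_prodModel_symm]
      rw [φ.left_inv hx]
    rw [h2] at h1
    have h3 : HasFDerivAt (fun y => C (φ x, y))
        ((fderiv ℝ C (φ x, w.2)).comp (ContinuousLinearMap.inr ℝ (Rn n) (Rn n))) w.2 :=
      hxd.hasFDerivAt.comp w.2 ((hasFDerivAt_const (φ x) w.2).prodMk (hasFDerivAt_id w.2))
    have h4 := congrArg (fun A : Rn n →L[ℝ] ℝ => A b) (h1.unique h3)
    exact h4
  have hvmd : MDifferentiableAt 𝓘(ℝ, Rn n) 𝓘(ℝ, ℝ) u (φ.symm w.1) := by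
    have : IsManifold 𝓘(ℝ, Rn n) 1 M := IsManifold.of_le (n := ∞) (by simp)
    have h1 : MDifferentiableAt 𝓘(ℝ, Rn n) 𝓘(ℝ, Rn n) φ (φ.symm w.1) :=
      mdifferentiableAt_extChartAt (by
        rw [← extChartAt_source 𝓘(ℝ, Rn n)]; exact φ.map_target hw1)
    have h2 : MDifferentiableAt 𝓘(ℝ, Rn n) 𝓘(ℝ, ℝ) v (φ (φ.symm w.1)) := by
      rw [φ.right_inv hw1]
      exact hvd.differentiableAt.mdifferentiableAt
    exact (h2.comp _ h1).congr_of_eventuallyEq huv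
  have h5 := hasFDerivAt_comp_chart_symm 𝓘(ℝ, Rn n) hw1 hvmd
  have h6 : HasFDerivAt (u ∘ φ.symm) (((fderiv ℝ (fderiv ℝ C) w).flip (0, b)).comp
      (ContinuousLinearMap.inl ℝ (Rn n) (Rn n))) w.1 := by
    refine hvd.congr_of_eventuallyEq ?_
    have h7 : ContinuousAt φ.symm w.1 := continuousAt_extChartAt_symm'' hw1
    filter_upwards [h7.eventually huv, (isOpen_extChartAt_target z₀.1).mem_nhds hw1] with x hx hxt
    simp only [Function.comp, hx]
    rw [φ.right_inv hxt]
  have h8 := congrArg (fun A : Rn n →L[ℝ] ℝ => A a) (h5.unique h6)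
  exact h8

end Metric

/-! ### The metric and `ψ` as mixed derivatives of a cost -/

section MetricJet

lemma mdifferentiableAt_of_chart {V : Type*} [NormedAddCommGroup V] [NormedSpace ℝ V]
    {H : Type*} [TopologicalSpace H] (J : ModelWithCorners ℝ V H) {N : Type*}
    [TopologicalSpace N] [ChartedSpace H N] [IsManifold J ∞ N] {f : N → ℝ} {z₀ : N}
    (hf : DifferentiableAt ℝ (f ∘ (extChartAt J z₀).symm) (extChartAt J z₀ z₀)) :
    MDifferentiableAt J 𝓘(ℝ, ℝ) f z₀ := by
  have : IsManifold J 1 N := IsManifold.of_le (n := ∞) (by simp)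
  have h1 : MDifferentiableAt J 𝓘(ℝ, V) (extChartAt J z₀) z₀ :=
    mdifferentiableAt_extChartAt (mem_chart_source H z₀)
  have h2 := MDifferentiableAt.comp z₀ hf.mdifferentiableAt h1
  refine h2.congr_of_eventuallyEq ?_
  filter_upwards [extChartAt_source_mem_nhds (I := J) z₀] with z hz
  simp only [Function.comp]
  rw [(extChartAt J z₀).left_inv hz]

lemma hasFDerivAt_clm_comp {X E F : Type*} [NormedAddCommGroup X] [NormedSpace ℝ X]
    [NormedAddCommGroup E] [NormedSpace ℝ E] [NormedAddCommGroup F] [NormedSpace ℝ F]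
    (A : E →L[ℝ] F) {f : X → E} {f' : X →L[ℝ] E} {x : X} (hf : HasFDerivAt f f' x) :
    HasFDerivAt (fun y => A (f y)) (A.comp f') x :=
  A.hasFDerivAt.comp x hf

variable {n : ℕ}

lemma matrix_bilin_comp (P : Rn n →L[ℝ] Rn n →L[ℝ] ℝ) (A B : Rn n →L[ℝ] Rn n) :
    (Matrix.of fun i j : Fin n => P (A (coordVec i)) (B (coordVec j)))
      = (endMatrix A).transpose * (Matrix.of fun i j : Fin n => P (coordVec i) (coordVec j))
        * endMatrix B := by
  ext i j
  simp only [Matrix.of_apply, Matrix.mul_apply, Matrix.transpose_apply, endMatrix]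
  rw [map_eq_sum (P (A (coordVec i))) (B (coordVec j))]
  refine Finset.sum_congr rfl fun k _ => ?_
  conv_lhs => rw [← sum_smul_coordVec (A (coordVec i))]
  simp only [map_sum, map_smul, sum_apply, smul_apply, smul_eq_mul]
  ring

variable {M : Type*} [TopologicalSpace M] [ChartedSpace (Rn n) M]
  {M' : Type*} [TopologicalSpace M'] [ChartedSpace (Rn n) M']
  [IsManifold 𝓘(ℝ, Rn n) ∞ M] [IsManifold 𝓘(ℝ, Rn n) ∞ M'] (G : GKM n M M')

namespace GKM

/-- In coordinates `h` is the mixed Hessian of a cost function of class `C⁴`. -/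
lemma exists_potential {z₀ : M × M'} (hz : z₀ ∉ G.cut) :
    ∃ C : Rn n × Rn n → ℝ, ContDiffAt ℝ 4 C (extChartAt (prodModel n) z₀ z₀) ∧
      ∀ᶠ w in 𝓝 (extChartAt (prodModel n) z₀ z₀), ∀ U V, inChart (prodModel n) G.h z₀ w U V
        = -(1 / 2) * (fderiv ℝ (fderiv ℝ C) w (U.1, 0) (0, V.2)
            + fderiv ℝ (fderiv ℝ C) w (V.1, 0) (0, U.2)) := by
  obtain ⟨U, c, hU, hzU, hc, hh⟩ := G.exists_cost z₀ hz
  have hC : ContDiffAt ℝ 4 (c ∘ (extChartAt (prodModel n) z₀).symm)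
      (extChartAt (prodModel n) z₀ z₀) := by
    have h1 := (contMDiffAt_iff.1 (hc.contMDiffAt (hU.mem_nhds hzU))).2
    rw [(prodModel n).range_eq_univ, contDiffWithinAt_univ] at h1
    exact h1
  refine ⟨c ∘ (extChartAt (prodModel n) z₀).symm, hC, ?_⟩
  filter_upwards [eventually_chart hU hzU,
    eventually_chart G.isClosed_cut.isOpen_compl hz, hC.eventually (by simp)]
    with w hw hwc hwC V W
  rw [(G.isKMForm_inChart hw.1 hwc.2).apply_eq, mixedBlock_apply, mixedBlock_apply]
  have key (a b : Rn n) : inChart (prodModel n) G.h z₀ w (a, 0) (0, b)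
      = -(1 / 2)
        * fderiv ℝ (fderiv ℝ (c ∘ (extChartAt (prodModel n) z₀).symm)) w (a, 0) (0, b) := by
    rw [inChart_apply, chartD_prod hw.1, chartD_prod hw.1,
      ← mixedDeriv_chart hU hc hw.1 hw.2 (hwC.of_le (by norm_num)), ← hh _ hw.2]
    simp only [map_zero]
  rw [key, key]
  ring

/-- The metric involves two derivatives of a cost of class `C⁴`. -/
lemma contDiffAt_inChart {z₀ : M × M'} (hz : z₀ ∉ G.cut) :
    ContDiffAt ℝ 2 (inChart (prodModel n) G.h z₀) (extChartAt (prodModel n) z₀ z₀) := by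
  obtain ⟨C, hC, hev⟩ := G.exists_potential hz
  have hC2 : ContDiffAt ℝ 2 (fderiv ℝ (fderiv ℝ C)) (extChartAt (prodModel n) z₀ z₀) :=
    (hC.fderiv_right (m := 3) (by norm_num)).fderiv_right (m := 2) (by norm_num)
  refine contDiffAt_of_apply fun U => contDiffAt_of_apply fun V => ?_
  refine ContDiffAt.congr_of_eventuallyEq ?_ (hev.mono fun w hw => hw U V)
  exact contDiffAt_const.mul (((hC2.clm_apply contDiffAt_const).clm_apply contDiffAt_const).add
    ((hC2.clm_apply contDiffAt_const).clm_apply contDiffAt_const))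

/-- The derivative at `z₀` of the metric in the preferred chart at `z₀`. -/
def metricDeriv (z₀ : M × M') :
    (Rn n × Rn n) →L[ℝ] (Rn n × Rn n) →L[ℝ] (Rn n × Rn n) →L[ℝ] ℝ :=
  fderiv ℝ (inChart (prodModel n) G.h z₀) (extChartAt (prodModel n) z₀ z₀)

lemma hasFDerivAt_inChart {z₀ : M × M'} (hz : z₀ ∉ G.cut) :
    HasFDerivAt (inChart (prodModel n) G.h z₀) (G.metricDeriv z₀)
      (extChartAt (prodModel n) z₀ z₀) :=
  ((G.contDiffAt_inChart hz).differentiableAt two_ne_zero).hasFDerivAt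

lemma hasFDerivAt_mixedEnd_inChart {z₀ : M × M'} (hz : z₀ ∉ G.cut) :
    HasFDerivAt (fun w => mixedEnd n (inChart (prodModel n) G.h z₀ w))
      ((mixedEnd n).comp (G.metricDeriv z₀)) (extChartAt (prodModel n) z₀ z₀) :=
  hasFDerivAt_clm_comp (E := (Rn n × Rn n) →L[ℝ] (Rn n × Rn n) →L[ℝ] ℝ) (F := Rn n →L[ℝ] Rn n)
    (mixedEnd n) (G.hasFDerivAt_inChart hz)

/-- The symmetries of the third derivatives of the cost. -/
lemma isKMDeriv {z₀ : M × M'} (hz : z₀ ∉ G.cut) : IsKMDeriv (G.metricDeriv z₀) := by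
  obtain ⟨C, hC, hev⟩ := G.exists_potential hz
  set w₀ := extChartAt (prodModel n) z₀ z₀ with hw₀
  have hC1 : ContDiffAt ℝ 3 (fderiv ℝ C) w₀ := hC.fderiv_right (m := 3) (by norm_num)
  have hC2 : ContDiffAt ℝ 2 (fderiv ℝ (fderiv ℝ C)) w₀ := hC1.fderiv_right (m := 2) (by norm_num)
  have hd2 := hC2.differentiableAt two_ne_zero
  have hh := (G.contDiffAt_inChart hz).differentiableAt two_ne_zero
  have h1 (a b : Rn n × Rn n) : HasFDerivAt (fun w => fderiv ℝ (fderiv ℝ C) w a b)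
      (((fderiv ℝ (fderiv ℝ (fderiv ℝ C)) w₀).flip a).flip b) w₀ := by
    have := (hd2.hasFDerivAt.clm_apply (hasFDerivAt_const a w₀)).clm_apply
      (hasFDerivAt_const b w₀)
    refine this.congr_fderiv ?_
    ext x <;> simp
  have happ (X U V : Rn n × Rn n) : G.metricDeriv z₀ X U V
      = -(1 / 2) * (fderiv ℝ (fderiv ℝ (fderiv ℝ C)) w₀ X (U.1, 0) (0, V.2)
        + fderiv ℝ (fderiv ℝ (fderiv ℝ C)) w₀ X (V.1, 0) (0, U.2)) := by
    have h2 : HasFDerivAt (fun w => inChart (prodModel n) G.h z₀ w U V)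
        (((G.metricDeriv z₀).flip U).flip V) w₀ := by
      have := ((G.hasFDerivAt_inChart hz).clm_apply (hasFDerivAt_const U w₀)).clm_apply
        (hasFDerivAt_const V w₀)
      refine this.congr_fderiv ?_
      ext x <;> simp
    have h3 := ((h1 (U.1, 0) (0, V.2)).add (h1 (V.1, 0) (0, U.2))).const_mul (-(1 / 2) : ℝ)
    have h4 := h2.unique (h3.congr_of_eventuallyEq (hev.mono fun w hw => hw U V))
    have h5 := congrArg (fun A : Rn n × Rn n →L[ℝ] ℝ => A X) h4
    simp only [ContinuousLinearMap.flip_apply, smul_apply, add_apply, smul_eq_mul] at h5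
    exact h5
  have hs1 (X U V : Rn n × Rn n) : fderiv ℝ (fderiv ℝ (fderiv ℝ C)) w₀ X U V
      = fderiv ℝ (fderiv ℝ (fderiv ℝ C)) w₀ U X V := by
    rw [(hC1.isSymmSndFDerivAt (by simp; norm_num)).eq X U]
  have hs2 (X U V : Rn n × Rn n) : fderiv ℝ (fderiv ℝ (fderiv ℝ C)) w₀ X U V
      = fderiv ℝ (fderiv ℝ (fderiv ℝ C)) w₀ X V U := by
    have hev2 : (fun w => fderiv ℝ (fderiv ℝ C) w U V)
        =ᶠ[𝓝 w₀] fun w => fderiv ℝ (fderiv ℝ C) w V U := by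
      filter_upwards [hC.eventually (by simp)] with w hw
      exact (hw.isSymmSndFDerivAt (by simp; norm_num)).eq U V
    have h2 := (h1 U V).unique ((h1 V U).congr_of_eventuallyEq hev2)
    exact congrArg (fun A : Rn n × Rn n →L[ℝ] ℝ => A X) h2
  have hz00 : ((0 : Rn n), (0 : Rn n)) = 0 := rfl
  refine ⟨fun U V W => ?_, fun U a b => ?_, fun U a b => ?_, fun a b w => ?_, fun a b w => ?_⟩
  · rw [happ, happ]
    ring
  · rw [happ]
    simp [hz00]
  · rw [happ]
    simp [hz00]
  · rw [happ, happ]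
    simp only [hz00, map_zero, add_zero]
    rw [hs1 (a, 0)]
  · rw [happ, happ]
    simp only [hz00, map_zero, add_zero]
    rw [hs2 (0, a), hs1 (0, a), hs2 (0, b)]

/-- The quantity `ρ ρ̄ / det (-c_{i s̄})` does not depend on the coordinates. -/
lemma densityRatio_chart {z₀ : M × M'} {w : Rn n × Rn n}
    (hw : w ∈ (extChartAt (prodModel n) z₀).target) :
    densityRatio G.h G.ρ G.ρ' ((extChartAt (prodModel n) z₀).symm w)
      = coordDensity G.ρ z₀.1 w.1 * coordDensity G.ρ' z₀.2 w.2
        / (endMatrix (mixedEnd n (inChart (prodModel n) G.h z₀ w))).det := by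
  obtain ⟨hw1, hw2⟩ := mem_extChartAt_prodModel_target.1 hw
  have h1 := det_endMatrix_ne_zero (chartD_isInvertible 𝓘(ℝ, Rn n) hw1)
  have h2 := det_endMatrix_ne_zero (chartD_isInvertible 𝓘(ℝ, Rn n) hw2)
  have hmat : (endMatrix (mixedEnd n (inChart (prodModel n) G.h z₀ w))).det
      = (endMatrix (chartD 𝓘(ℝ, Rn n) z₀.1 w.1)).det
        * (Matrix.of fun i s : Fin n => 2 * G.h ((extChartAt (prodModel n) z₀).symm w)
          (coordVec i, 0) (0, coordVec s)).det * (endMatrix (chartD 𝓘(ℝ, Rn n) z₀.2 w.2)).det := by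
    rw [← Matrix.det_transpose, endMatrix_mixedEnd]
    have := matrix_bilin_comp ((2 : ℝ) • mixedBlock (G.h ((extChartAt (prodModel n) z₀).symm w)))
      (chartD 𝓘(ℝ, Rn n) z₀.1 w.1) (chartD 𝓘(ℝ, Rn n) z₀.2 w.2)
    have h3 : (Matrix.of fun i s : Fin n =>
        2 * inChart (prodModel n) G.h z₀ w (coordVec i, 0) (0, coordVec s))
        = (Matrix.of fun i j : Fin n =>
          ((2 : ℝ) • mixedBlock (G.h ((extChartAt (prodModel n) z₀).symm w)))
          (chartD 𝓘(ℝ, Rn n) z₀.1 w.1 (coordVec i)) (chartD 𝓘(ℝ, Rn n) z₀.2 w.2 (coordVec j))) := by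
      ext i s
      rw [Matrix.of_apply, Matrix.of_apply, inChart_apply, chartD_prod hw, chartD_prod hw]
      simp only [map_zero, smul_apply, smul_eq_mul]
      rfl
    rw [h3, this, Matrix.det_mul, Matrix.det_mul, Matrix.det_transpose]
    rfl
  rw [hmat, coordDensity_eq, coordDensity_eq, densityRatio, extChartAt_prodModel_symm]
  field_simp

/-- The differential of `2nψ`. -/
lemma differential_psi (hn : 1 ≤ n) {z₀ : M × M'} (hz : z₀ ∉ G.cut) :
    MDifferentiableAt (prodModel n) 𝓘(ℝ, ℝ) G.ψ z₀ ∧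
    ∀ v, 2 * n * differential (prodModel n) G.ψ z₀ v
      = dlogDensity G.ρ z₀.1 v.1 + dlogDensity G.ρ' z₀.2 v.2
        - mixedLogDet (G.h z₀) (G.metricDeriv z₀) v := by
  set w₀ := extChartAt (prodModel n) z₀ z₀ with hw₀
  have hw₀t : w₀ ∈ (extChartAt (prodModel n) z₀).target := mem_extChartAt_target z₀
  obtain ⟨hw1, hw2⟩ := mem_extChartAt_prodModel_target.1 hw₀t
  have hfst : w₀.1 = extChartAt 𝓘(ℝ, Rn n) z₀.1 z₀.1 := by rw [hw₀, extChartAt_prodModel]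
  have hsnd : w₀.2 = extChartAt 𝓘(ℝ, Rn n) z₀.2 z₀.2 := by rw [hw₀, extChartAt_prodModel]
  have hn0 : (n : ℝ) ≠ 0 := by
    have : n ≠ 0 := by omega
    exact_mod_cast this
  have hev : G.ψ ∘ (extChartAt (prodModel n) z₀).symm =ᶠ[𝓝 w₀] fun w => 1 / (2 * n) *
      ((Real.log (coordDensity G.ρ z₀.1 w.1) + Real.log (coordDensity G.ρ' z₀.2 w.2))
        - Real.log (1 * (endMatrix (mixedEnd n (inChart (prodModel n) G.h z₀ w))).det)) := by
    filter_upwards [eventually_chart G.isClosed_cut.isOpen_compl hz] with w hw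
    obtain ⟨h1, h2⟩ := mem_extChartAt_prodModel_target.1 hw.1
    have e1 := coordDensity_ne_zero G.ρ_ne_zero h1
    have e2 := coordDensity_ne_zero G.ρ'_ne_zero h2
    have e3 := det_endMatrix_ne_zero (mixedEnd_isInvertible (G.isKMForm_inChart hw.1 hw.2))
    simp only [Function.comp, ψ]
    rw [G.densityRatio_chart hw.1, Real.log_div (mul_ne_zero e1 e2) e3, Real.log_mul e1 e2, one_mul]
  have d1 : HasFDerivAt (fun w : Rn n × Rn n => Real.log (coordDensity G.ρ z₀.1 w.1))
      ((dlogDensity G.ρ z₀.1).comp (ContinuousLinearMap.fst ℝ (Rn n) (Rn n))) w₀ := by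
    have h1 := ((contDiffAt_coordDensity G.ρ_contDiff hw1).differentiableAt
      two_ne_zero).hasFDerivAt.comp w₀ hasFDerivAt_fst
    have h2 := h1.log (coordDensity_ne_zero G.ρ_ne_zero hw1)
    refine h2.congr_fderiv ?_
    rw [hfst]
    ext v <;> simp [dlogDensity, hfst]
  have d2 : HasFDerivAt (fun w : Rn n × Rn n => Real.log (coordDensity G.ρ' z₀.2 w.2))
      ((dlogDensity G.ρ' z₀.2).comp (ContinuousLinearMap.snd ℝ (Rn n) (Rn n))) w₀ := by
    have h1 := ((contDiffAt_coordDensity G.ρ'_contDiff hw2).differentiableAt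
      two_ne_zero).hasFDerivAt.comp w₀ hasFDerivAt_snd
    have h2 := h1.log (coordDensity_ne_zero G.ρ'_ne_zero hw2)
    refine h2.congr_fderiv ?_
    rw [hsnd]
    ext v <;> simp [dlogDensity, hsnd]
  have hKM : IsKMForm (inChart (prodModel n) G.h z₀ w₀) := by
    rw [inChart_self]
    exact G.isKMForm hz
  obtain ⟨D, hD, d3⟩ := hasFDerivWithinAt_log_mul_det (s := Set.univ)
    (r := fun _ => (1 : ℝ)) (A := fun w => mixedEnd n (inChart (prodModel n) G.h z₀ w))
    (hasFDerivWithinAt_const (1 : ℝ) w₀ Set.univ)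
    (G.hasFDerivAt_mixedEnd_inChart hz).hasFDerivWithinAt one_ne_zero
    (mixedEnd_isInvertible hKM)
  rw [hasFDerivWithinAt_univ] at d3
  have d4 := (((d1.add d2).sub d3).const_mul (1 / (2 * n) : ℝ)).congr_of_eventuallyEq hev
  have hmd := mdifferentiableAt_of_chart (prodModel n) d4.differentiableAt
  refine ⟨hmd, fun v => ?_⟩
  rw [← fderiv_comp_chart_symm_self (prodModel n) hmd, d4.fderiv]
  have hDv : D v = mixedLogDet (G.h z₀) (G.metricDeriv z₀) v := by
    rw [hD, ContinuousLinearMap.comp_apply, endTrace_mixedEnd, inChart_self]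
    simp
  simp only [smul_apply, sub_apply, add_apply, ContinuousLinearMap.comp_apply, smul_eq_mul, hDv,
    ContinuousLinearMap.coe_fst', ContinuousLinearMap.coe_snd']
  field_simp

end GKM

end MetricJet

/-! ### The Lagrangian angle at a point -/

section Angle

variable {n : ℕ} {M : Type*} [TopologicalSpace M] [ChartedSpace (Rn n) M]
  {M' : Type*} [TopologicalSpace M'] [ChartedSpace (Rn n) M']
  {L : Type*} [TopologicalSpace L] [ChartedSpace (Rn n) L] (G : GKM n M M')

/-- A spacelike Lagrangian immersion of class `C³` into the complement of the cut locus. -/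
structure IsSpacelikeLagrangian (F : L → M × M') : Prop where
  contMDiff : ContMDiff 𝓘(ℝ, Rn n) (prodModel n) 3 F
  notMem_cut : ∀ p, F p ∉ G.cut
  isSpacelike : G.IsSpacelike F
  isLagrangian : G.IsLagrangian F

namespace GKM

/-- Half the logarithm of the quotient of `ρ(dx)` and `ρ̄(dx̄)` on a frame of `T_p L`. The real
logarithm of Mathlib is that of the absolute value, so that neither the choice of the frame nor
its orientation matters. -/
def angle (F : L → M × M') (p : L) : ℝ :=
  1 / 2 * (Real.log (G.ρ (F p).1 fun i => (dF F p (coordVec i)).1)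
    - Real.log (G.ρ' (F p).2 fun i => (dF F p (coordVec i)).2))

end GKM

/-- The endomorphism of `ℝⁿ` that takes the standard frame to a given family of vectors. -/
def frameMap (v : Fin n → Rn n) : Rn n →L[ℝ] Rn n :=
  ∑ i, (EuclideanSpace.proj (𝕜 := ℝ) i : Rn n →L[ℝ] ℝ).smulRight (v i)

lemma frameMap_coordVec (v : Fin n → Rn n) (i : Fin n) : frameMap v (coordVec i) = v i := by
  simp [frameMap, coordVec_apply]

/-- The value of an `n`-form changes by the determinant under a change of frame. -/
lemma density_frame (α : Rn n [⋀^Fin n]→ₗ[ℝ] ℝ) (A T : Rn n →L[ℝ] Rn n) :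
    α (fun i => A (T (coordVec i))) = (endMatrix T).det * α (fun i => A (coordVec i)) := by
  have h := alternating_apply_eq α (A ∘L T)
  rw [endMatrix_comp, Matrix.det_mul] at h
  rw [alternating_apply_eq α A]
  exact h.trans (by ring)

lemma posDef_gram {g : Rn n →L[ℝ] Rn n →L[ℝ] ℝ} (hs : ∀ u v, g u v = g v u)
    (hpos : ∀ u, u ≠ 0 → 0 < g u u) :
    (Matrix.of fun i j : Fin n => g (coordVec i) (coordVec j)).PosDef := by
  refine Matrix.posDef_iff_dotProduct_mulVec.2 ⟨?_, fun x hx => ?_⟩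
  · ext i j
    simp [hs (coordVec i)]
  · have hu : (∑ i, x i • (coordVec i : Rn n)) ≠ 0 := by
      intro h0
      apply hx
      funext i
      simpa [coordVec_apply] using congrArg (fun u : Rn n => u i) h0
    have h := hpos _ hu
    have e : star x ⬝ᵥ (Matrix.of fun i j : Fin n => g (coordVec i) (coordVec j)).mulVec x
        = g (∑ i, x i • (coordVec i : Rn n)) (∑ i, x i • (coordVec i : Rn n)) := by
      simp only [dotProduct, Matrix.mulVec, Matrix.of_apply, map_sum, map_smul, sum_apply,
        smul_apply, smul_eq_mul, star_trivial, Finset.mul_sum]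
      refine Finset.sum_comm.trans ?_
      refine Finset.sum_congr rfl fun i _ => Finset.sum_congr rfl fun j _ => ?_
      ring
    rw [e]
    exact h

/-- On a spacelike Lagrangian subspace `ρ(dx) ρ̄(dx̄) = exp (2nψ) det g`. -/
lemma GKM.density_mul_density {F : L → M × M'} (hF : IsSpacelikeLagrangian G F) (p : L)
    (v : Fin n → Rn n) :
    G.ρ (F p).1 (fun i => (dF F p (v i)).1) * G.ρ' (F p).2 (fun i => (dF F p (v i)).2)
      = densityRatio G.h G.ρ G.ρ' (F p)
        * (Matrix.of fun i j : Fin n => G.induced F p (v i) (v j)).det := by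
  have hh := G.isKMForm (hF.notMem_cut p)
  have hr := (G.densityRatio_pos _ (hF.notMem_cut p)).ne'
  have h1 : G.ρ (F p).1 (fun i => (dF F p (v i)).1)
      = (endMatrix (fstD (dF F p) ∘L frameMap v)).det * G.ρ (F p).1 coordVec := by
    rw [← alternating_apply_eq]
    simp [frameMap_coordVec]
  have h2 : G.ρ' (F p).2 (fun i => (dF F p (v i)).2)
      = (endMatrix (sndD (dF F p) ∘L frameMap v)).det * G.ρ' (F p).2 coordVec := by
    rw [← alternating_apply_eq]
    simp [frameMap_coordVec]
  have h3 : (Matrix.of fun i j : Fin n => G.induced F p (v i) (v j))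
      = Matrix.of fun i j : Fin n => ((2 : ℝ) • mixedBlock (G.h (F p)))
        ((fstD (dF F p) ∘L frameMap v) (coordVec i))
        ((sndD (dF F p) ∘L frameMap v) (coordVec j)) := by
    ext i j
    simp only [Matrix.of_apply, smul_apply, ContinuousLinearMap.comp_apply, frameMap_coordVec]
    exact induced_eq_mixedBlock hh (hF.isLagrangian p) (v i) (v j)
  rw [h3, matrix_bilin_comp, Matrix.det_mul, Matrix.det_mul, Matrix.det_transpose, h1, h2]
  have h4 : (Matrix.of fun i s : Fin n => ((2 : ℝ) • mixedBlock (G.h (F p)))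
      (coordVec i) (coordVec s))
      = Matrix.of fun i s : Fin n => 2 * G.h (F p) (coordVec i, 0) (0, coordVec s) := rfl
  rw [h4]
  have h5 : (Matrix.of fun i s : Fin n =>
      2 * G.h (F p) (coordVec i, 0) (0, coordVec s)).det ≠ 0 := by
    intro h0
    rw [densityRatio, h0, div_zero] at hr
    exact hr rfl
  rw [densityRatio]
  field_simp

open GKM (dF velocity)

variable {G} {F : L → M × M'} (hF : IsSpacelikeLagrangian G F)

include hF

namespace IsSpacelikeLagrangian

lemma isInvertible_fst (p : L) : (fstD (n := n) (dF F p)).IsInvertible :=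
  isInvertible_fstD (G.isKMForm (hF.notMem_cut p)) (hF.isSpacelike p) (hF.isLagrangian p)

lemma isInvertible_snd (p : L) : (sndD (n := n) (dF F p)).IsInvertible :=
  isInvertible_sndD (G.isKMForm (hF.notMem_cut p)) (hF.isSpacelike p) (hF.isLagrangian p)

lemma induced_comm (p : L) (u v : Rn n) : G.induced F p u v = G.induced F p v u :=
  G.h_symm _ (hF.notMem_cut p) _ _

lemma induced_isInvertible (p : L) : (G.induced F p).IsInvertible :=
  isInvertible_bilinearComp (hF.isSpacelike p)

lemma density_ne_zero (p : L) : G.ρ (F p).1 (fun i => (dF F p (coordVec i)).1) ≠ 0 := by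
  have h := alternating_apply_eq (G.ρ (F p).1) (fstD (n := n) (dF F p))
  simp only [fstD_apply] at h
  rw [h]
  exact mul_ne_zero (det_endMatrix_ne_zero (hF.isInvertible_fst p))
    (alternating_coordVec_ne_zero (G.ρ_ne_zero _))

lemma density'_ne_zero (p : L) : G.ρ' (F p).2 (fun i => (dF F p (coordVec i)).2) ≠ 0 := by
  have h := alternating_apply_eq (G.ρ' (F p).2) (sndD (n := n) (dF F p))
  simp only [sndD_apply] at h
  rw [h]
  exact mul_ne_zero (det_endMatrix_ne_zero (hF.isInvertible_snd p))
    (alternating_coordVec_ne_zero (G.ρ'_ne_zero _))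

/-- The condition on the Lagrangian angle on one positively oriented frame. -/
lemma angle_iff_of_frame (hn : 1 ≤ n) (p : L) (v : Fin n → Rn n)
    (hv : 0 < G.ρ (F p).1 (fun i => (dF F p (v i)).1)) (θ : ℝ) :
    G.Ω (F p) (fun i => dF F p (v i)) =
      (Real.exp (n * G.ψ (F p)) *
        √(Matrix.of fun i j : Fin n => G.induced F p (v i) (v j)).det) • expK θ
      ↔ θ = G.angle F p := by
  set a := G.ρ (F p).1 (fun i => (dF F p (v i)).1) with ha
  set b := G.ρ' (F p).2 (fun i => (dF F p (v i)).2) with hb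
  set d := (Matrix.of fun i j : Fin n => G.induced F p (v i) (v j)).det with hd
  set R := densityRatio G.h G.ρ G.ρ' (F p) with hR
  have hRpos : 0 < R := G.densityRatio_pos _ (hF.notMem_cut p)
  have hab : a * b = R * d := G.density_mul_density hF p v
  have hfa := density_frame (G.ρ (F p).1) (fstD (n := n) (dF F p)) (frameMap v)
  have hfb := density_frame (G.ρ' (F p).2) (sndD (n := n) (dF F p)) (frameMap v)
  simp only [frameMap_coordVec, fstD_apply, sndD_apply] at hfa hfb
  rw [← ha] at hfa
  rw [← hb] at hfb
  have hT : (endMatrix (frameMap v)).det ≠ 0 := by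
    intro h0
    rw [h0, zero_mul] at hfa
    exact hv.ne' hfa
  have hdpos : 0 < d := by
    have h1 : (Matrix.of fun i j : Fin n => G.induced F p (v i) (v j))
        = (Matrix.of fun i j : Fin n => G.induced F p
          (frameMap v (coordVec i)) (frameMap v (coordVec j))) := by
      simp only [frameMap_coordVec]
    have h2 := (posDef_gram (hF.induced_comm p) (hF.isSpacelike p)).det_pos
    rw [hd, h1, matrix_bilin_comp, Matrix.det_mul, Matrix.det_mul, Matrix.det_transpose]
    have h3 : 0 < (endMatrix (frameMap v)).det * (endMatrix (frameMap v)).det :=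
      mul_self_pos.2 hT
    nlinarith
  have hbpos : 0 < b := by
    have h1 : 0 < a * b := hab ▸ mul_pos hRpos hdpos
    exact (pos_iff_pos_of_mul_pos h1).1 hv
  have hn0 : (n : ℝ) ≠ 0 := by
    have : n ≠ 0 := by omega
    exact_mod_cast this
  have hc : Real.exp (n * G.ψ (F p)) * √d = √a * √b := by
    have h1 : (n : ℝ) * G.ψ (F p) = Real.log R / 2 := by
      rw [GKM.ψ, ← hR]
      field_simp
    rw [h1, Real.exp_half, Real.exp_log hRpos, ← Real.sqrt_mul hRpos.le, ← hab,
      Real.sqrt_mul hv.le]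
  have hangle : G.angle F p = 1 / 2 * (Real.log a - Real.log b) := by
    rw [hfa, hfb, Real.log_mul hT (hF.density_ne_zero p), Real.log_mul hT (hF.density'_ne_zero p),
      GKM.angle]
    ring
  set x := Real.log a with hx
  set y := Real.log b with hy
  have hax : √a = Real.exp (x / 2) := by rw [Real.exp_half, Real.exp_log hv]
  have hby : √b = Real.exp (y / 2) := by rw [Real.exp_half, Real.exp_log hbpos]
  have hcexp : √a * √b = Real.exp ((x + y) / 2) := by
    rw [hax, hby, ← Real.exp_add]
    ring_nf
  rw [hc, hangle, hcexp]
  have hax' : a = Real.exp x := (Real.exp_log hv).symm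
  have hby' : b = Real.exp y := (Real.exp_log hbpos).symm
  have hΩ : G.Ω (F p) (fun i => dF F p (v i)) = ⟨(a + b) / 2, (a - b) / 2⟩ := by
    rw [GKM.Ω]
    ext <;> simp [tau, tauBar, ← ha, ← hb] <;> ring
  rw [hΩ]
  have hrhs : Real.exp ((x + y) / 2) • expK θ
      = ⟨Real.exp ((x + y) / 2) * Real.cosh θ, Real.exp ((x + y) / 2) * Real.sinh θ⟩ := by
    ext <;> simp [expK]
  rw [hrhs, QuadraticAlgebra.mk.injEq]
  have e1 : Real.exp ((x + y) / 2) * Real.cosh θ + Real.exp ((x + y) / 2) * Real.sinh θ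
      = Real.exp ((x + y) / 2 + θ) := by
    rw [← mul_add, Real.cosh_add_sinh, ← Real.exp_add]
  have e2 : Real.exp ((x + y) / 2) * Real.cosh θ - Real.exp ((x + y) / 2) * Real.sinh θ
      = Real.exp ((x + y) / 2 - θ) := by
    rw [← mul_sub, Real.cosh_sub_sinh, ← Real.exp_add, sub_eq_add_neg]
  constructor
  · rintro ⟨h1, h2⟩
    have h3 : Real.exp x = Real.exp ((x + y) / 2 + θ) := by rw [← e1, ← h1, ← h2, ← hax']; ring
    have h4 := Real.exp_injective h3
    linarith
  · intro hθ
    have h3 : Real.exp ((x + y) / 2 + θ) = a := by rw [hax', hθ]; ring_nf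
    have h4 : Real.exp ((x + y) / 2 - θ) = b := by rw [hby', hθ]; ring_nf
    rw [h3] at e1
    rw [h4] at e2
    constructor <;> linarith

/-- A spacelike Lagrangian immersion has exactly one Lagrangian angle at every point. -/
lemma isLagrangianAngle_iff (hn : 1 ≤ n) (p : L) (θ : ℝ) :
    G.IsLagrangianAngle F p θ ↔ θ = G.angle F p := by
  refine ⟨fun h => ?_, fun h v hv => (hF.angle_iff_of_frame hn p v hv θ).2 h⟩
  -- rescaling one vector of the standard frame makes the frame positively oriented
  set s := G.ρ (F p).1 (fun i => (dF F p (coordVec i)).1) with hs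
  let i₀ : Fin n := ⟨0, hn⟩
  set v : Fin n → Rn n := Function.update coordVec i₀ (s • coordVec i₀) with hv
  have hpos : 0 < G.ρ (F p).1 (fun i => (dF F p (v i)).1) := by
    have h1 := ((G.ρ (F p).1).compLinearMap
      (fstD (n := n) (dF F p) : Rn n →ₗ[ℝ] Rn n)).map_update_smul
      (coordVec : Fin n → Rn n) i₀ s (coordVec i₀)
    rw [Function.update_eq_self, ← hv] at h1
    have h2 : G.ρ (F p).1 (fun i => (dF F p (v i)).1) = s • s := h1
    rw [h2]
    exact mul_self_pos.2 (hF.density_ne_zero p)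
  exact (hF.angle_iff_of_frame hn p v hpos θ).1 (h v hpos)

end IsSpacelikeLagrangian

end Angle

/-! ### The Lagrangian angle in coordinates -/

section AngleInChart

variable {n : ℕ} {M : Type*} [TopologicalSpace M] [ChartedSpace (Rn n) M]
  {M' : Type*} [TopologicalSpace M'] [ChartedSpace (Rn n) M']
  {L : Type*} [TopologicalSpace L] [ChartedSpace (Rn n) L]

open GKM (dF velocity)

/-- The angle of a map with value `z` and differential `φ` in the preferred chart at `z₀`. -/
def GKM.angleInChart (G : GKM n M M') (z₀ : M × M') (z : Rn n × Rn n)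
    (φ : Rn n →L[ℝ] Rn n × Rn n) : ℝ :=
  1 / 2 * (Real.log (coordDensity G.ρ z₀.1 z.1 * (endMatrix (fstD φ)).det)
    - Real.log (coordDensity G.ρ' z₀.2 z.2 * (endMatrix (sndD φ)).det))

/-- A map into `M × M'` in the preferred charts at `p₀` and `z₀`. -/
def inCharts (F : L → M × M') (p₀ : L) (z₀ : M × M') (w : Rn n) : Rn n × Rn n :=
  extChartAt (prodModel n) z₀ (F ((extChartAt 𝓘(ℝ, Rn n) p₀).symm w))

lemma inCharts_mem_target {F : L → M × M'} {p₀ : L} {z₀ : M × M'} {w : Rn n}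
    (hz : F ((extChartAt 𝓘(ℝ, Rn n) p₀).symm w) ∈ (extChartAt (prodModel n) z₀).source) :
    inCharts F p₀ z₀ w ∈ (extChartAt (prodModel n) z₀).target :=
  (extChartAt (prodModel n) z₀).map_source hz

lemma symm_inCharts {F : L → M × M'} {p₀ : L} {z₀ : M × M'} {w : Rn n}
    (hz : F ((extChartAt 𝓘(ℝ, Rn n) p₀).symm w) ∈ (extChartAt (prodModel n) z₀).source) :
    (extChartAt (prodModel n) z₀).symm (inCharts F p₀ z₀ w)
      = F ((extChartAt 𝓘(ℝ, Rn n) p₀).symm w) :=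
  (extChartAt (prodModel n) z₀).left_inv hz

section

variable [IsManifold 𝓘(ℝ, Rn n) ∞ M] [IsManifold 𝓘(ℝ, Rn n) ∞ M'] [IsManifold 𝓘(ℝ, Rn n) ∞ L]

lemma chartD_fderiv_inCharts {F : L → M × M'} {p₀ : L} {z₀ : M × M'} {w : Rn n}
    (hw : w ∈ (extChartAt 𝓘(ℝ, Rn n) p₀).target)
    (hd : MDifferentiableAt 𝓘(ℝ, Rn n) (prodModel n) F ((extChartAt 𝓘(ℝ, Rn n) p₀).symm w))
    (hz : F ((extChartAt 𝓘(ℝ, Rn n) p₀).symm w) ∈ (extChartAt (prodModel n) z₀).source) (v : Rn n) :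
    chartD (prodModel n) z₀ (inCharts F p₀ z₀ w) (fderiv ℝ (inCharts F p₀ z₀) w v)
      = dF F ((extChartAt 𝓘(ℝ, Rn n) p₀).symm w) (chartD 𝓘(ℝ, Rn n) p₀ w v) :=
  chartD_fderiv 𝓘(ℝ, Rn n) (prodModel n) hw hd hz v

/-- The angle does not depend on the coordinates: a change of frame of `T_p L` multiplies both
densities by the same determinant. -/
lemma GKM.angle_eq_angleInChart (G : GKM n M M') {F : L → M × M'} {p₀ : L} {z₀ : M × M'} {w : Rn n}
    (hw : w ∈ (extChartAt 𝓘(ℝ, Rn n) p₀).target)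
    (hd : MDifferentiableAt 𝓘(ℝ, Rn n) (prodModel n) F ((extChartAt 𝓘(ℝ, Rn n) p₀).symm w))
    (hz : F ((extChartAt 𝓘(ℝ, Rn n) p₀).symm w) ∈ (extChartAt (prodModel n) z₀).source)
    (h1 : G.ρ (F ((extChartAt 𝓘(ℝ, Rn n) p₀).symm w)).1
      (fun i => (dF F ((extChartAt 𝓘(ℝ, Rn n) p₀).symm w) (coordVec i)).1) ≠ 0)
    (h2 : G.ρ' (F ((extChartAt 𝓘(ℝ, Rn n) p₀).symm w)).2
      (fun i => (dF F ((extChartAt 𝓘(ℝ, Rn n) p₀).symm w) (coordVec i)).2) ≠ 0) :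
    G.angle F ((extChartAt 𝓘(ℝ, Rn n) p₀).symm w)
      = G.angleInChart z₀ (inCharts F p₀ z₀ w) (fderiv ℝ (inCharts F p₀ z₀) w) := by
  set q := (extChartAt 𝓘(ℝ, Rn n) p₀).symm w with hq
  set z := inCharts F p₀ z₀ w with hzdef
  set φ := fderiv ℝ (inCharts F p₀ z₀) w with hφ
  have hzt : z ∈ (extChartAt (prodModel n) z₀).target := inCharts_mem_target hz
  have hsymm := symm_inCharts hz
  rw [← hzdef, ← hq, extChartAt_prodModel_symm] at hsymm
  have hchain (v : Rn n) : (chartD 𝓘(ℝ, Rn n) z₀.1 z.1 (φ v).1, chartD 𝓘(ℝ, Rn n) z₀.2 z.2 (φ v).2)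
      = dF F q (chartD 𝓘(ℝ, Rn n) p₀ w v) := by
    rw [← chartD_prod hzt]
    exact chartD_fderiv_inCharts hw hd hz v
  have hD := det_endMatrix_ne_zero (chartD_isInvertible 𝓘(ℝ, Rn n) hw)
  have e1 : coordDensity G.ρ z₀.1 z.1 * (endMatrix (fstD φ)).det
      = (endMatrix (chartD 𝓘(ℝ, Rn n) p₀ w)).det
        * G.ρ (F q).1 fun i => (dF F q (coordVec i)).1 := by
    have a1 := density_comp G.ρ z₀.1 z.1 (fstD φ)
    have a2 := density_frame (G.ρ (F q).1) (fstD (n := n) (dF F q)) (chartD 𝓘(ℝ, Rn n) p₀ w)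
    simp only [fstD_apply] at a1 a2
    rw [← a1, ← a2, ← hsymm]
    congr 1
    funext i
    exact congrArg Prod.fst (hchain (coordVec i))
  have e2 : coordDensity G.ρ' z₀.2 z.2 * (endMatrix (sndD φ)).det
      = (endMatrix (chartD 𝓘(ℝ, Rn n) p₀ w)).det
        * G.ρ' (F q).2 fun i => (dF F q (coordVec i)).2 := by
    have a1 := density_comp G.ρ' z₀.2 z.2 (sndD φ)
    have a2 := density_frame (G.ρ' (F q).2) (sndD (n := n) (dF F q)) (chartD 𝓘(ℝ, Rn n) p₀ w)
    simp only [sndD_apply] at a1 a2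
    rw [← a1, ← a2, ← hsymm]
    congr 1
    funext i
    exact congrArg Prod.snd (hchain (coordVec i))
  rw [GKM.angleInChart, e1, e2, Real.log_mul hD h1, Real.log_mul hD h2, GKM.angle]
  ring

section Derivative

variable {X : Type*} [NormedAddCommGroup X] [NormedSpace ℝ X] {s : Set X} {x : X}
  {z : X → Rn n × Rn n} {φ : X → Rn n →L[ℝ] Rn n × Rn n}

lemma GKM.contDiffWithinAt_angleInChart (G : GKM n M M') {z₀ : M × M'}
    (hz : ContDiffWithinAt ℝ 2 z s x) (hφ : ContDiffWithinAt ℝ 2 φ s x)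
    (hzt : z x ∈ (extChartAt (prodModel n) z₀).target)
    (h1 : (fstD (φ x)).IsInvertible) (h2 : (sndD (φ x)).IsInvertible) :
    ContDiffWithinAt ℝ 2 (fun y => G.angleInChart z₀ (z y) (φ y)) s x := by
  obtain ⟨t1, t2⟩ := mem_extChartAt_prodModel_target.1 hzt
  have c1 : ContDiffWithinAt ℝ 2 (fun y => coordDensity G.ρ z₀.1 (z y).1) s x :=
    ContDiffAt.comp_contDiffWithinAt (g := coordDensity G.ρ z₀.1) (f := fun y => (z y).1) x
      (contDiffAt_coordDensity G.ρ_contDiff t1) hz.fst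
  have c2 : ContDiffWithinAt ℝ 2 (fun y => coordDensity G.ρ' z₀.2 (z y).2) s x :=
    ContDiffAt.comp_contDiffWithinAt (g := coordDensity G.ρ' z₀.2) (f := fun y => (z y).2) x
      (contDiffAt_coordDensity G.ρ'_contDiff t2) hz.snd
  have d1 : ContDiffWithinAt ℝ 2 (fun y => (endMatrix (fstD (φ y))).det) s x :=
    contDiff_det_endMatrix.contDiffAt.comp_contDiffWithinAt x (contDiffWithinAt_const.clm_comp hφ)
  have d2 : ContDiffWithinAt ℝ 2 (fun y => (endMatrix (sndD (φ y))).det) s x :=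
    contDiff_det_endMatrix.contDiffAt.comp_contDiffWithinAt x (contDiffWithinAt_const.clm_comp hφ)
  have n1 := mul_ne_zero (coordDensity_ne_zero G.ρ_ne_zero t1) (det_endMatrix_ne_zero h1)
  have n2 := mul_ne_zero (coordDensity_ne_zero G.ρ'_ne_zero t2) (det_endMatrix_ne_zero h2)
  exact contDiffWithinAt_const.mul (((c1.mul d1).log n1).sub ((c2.mul d2).log n2))

/-- The derivative of the angle of a family of maps. -/
lemma GKM.hasFDerivWithinAt_angleInChart (G : GKM n M M') {z₀ : M × M'} {z' : X →L[ℝ] Rn n × Rn n}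
    {φ' : X →L[ℝ] Rn n →L[ℝ] Rn n × Rn n} (hz : HasFDerivWithinAt z z' s x)
    (hφ : HasFDerivWithinAt φ φ' s x) (hzx : z x = extChartAt (prodModel n) z₀ z₀)
    (h1 : (fstD (φ x)).IsInvertible) (h2 : (sndD (φ x)).IsInvertible) :
    ∃ D : X →L[ℝ] ℝ, (∀ v, 2 * D v
        = dlogDensity G.ρ z₀.1 (z' v).1 + endTrace ((fstD (φ x)).inverse ∘L fstD (φ' v))
          - (dlogDensity G.ρ' z₀.2 (z' v).2 + endTrace ((sndD (φ x)).inverse ∘L sndD (φ' v)))) ∧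
      HasFDerivWithinAt (fun y => G.angleInChart z₀ (z y) (φ y)) D s x := by
  have hzt : z x ∈ (extChartAt (prodModel n) z₀).target := hzx ▸ mem_extChartAt_target z₀
  obtain ⟨t1, t2⟩ := mem_extChartAt_prodModel_target.1 hzt
  have c1 : HasFDerivWithinAt (fun y => coordDensity G.ρ z₀.1 (z y).1)
      ((fderiv ℝ (coordDensity G.ρ z₀.1) (z x).1).comp
        ((ContinuousLinearMap.fst ℝ (Rn n) (Rn n)).comp z')) s x :=
    HasFDerivAt.comp_hasFDerivWithinAt (g := coordDensity G.ρ z₀.1) (f := fun y => (z y).1) x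
      ((contDiffAt_coordDensity G.ρ_contDiff t1).differentiableAt two_ne_zero).hasFDerivAt hz.fst
  have c2 : HasFDerivWithinAt (fun y => coordDensity G.ρ' z₀.2 (z y).2)
      ((fderiv ℝ (coordDensity G.ρ' z₀.2) (z x).2).comp
        ((ContinuousLinearMap.snd ℝ (Rn n) (Rn n)).comp z')) s x :=
    HasFDerivAt.comp_hasFDerivWithinAt (g := coordDensity G.ρ' z₀.2) (f := fun y => (z y).2) x
      ((contDiffAt_coordDensity G.ρ'_contDiff t2).differentiableAt two_ne_zero).hasFDerivAt hz.snd
  have d1 := (hasFDerivWithinAt_const (ContinuousLinearMap.fst ℝ (Rn n) (Rn n)) x s).clm_comp hφ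
  have d2 := (hasFDerivWithinAt_const (ContinuousLinearMap.snd ℝ (Rn n) (Rn n)) x s).clm_comp hφ
  obtain ⟨D1, hD1, e1⟩ := hasFDerivWithinAt_log_mul_det c1 d1
    (coordDensity_ne_zero G.ρ_ne_zero t1) h1
  obtain ⟨D2, hD2, e2⟩ := hasFDerivWithinAt_log_mul_det c2 d2
    (coordDensity_ne_zero G.ρ'_ne_zero t2) h2
  refine ⟨(1 / 2 : ℝ) • (D1 - D2), fun v => ?_, (e1.sub e2).const_mul (1 / 2)⟩
  have f1 : (z x).1 = extChartAt 𝓘(ℝ, Rn n) z₀.1 z₀.1 := by rw [hzx, extChartAt_prodModel]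
  have f2 : (z x).2 = extChartAt 𝓘(ℝ, Rn n) z₀.2 z₀.2 := by rw [hzx, extChartAt_prodModel]
  rw [smul_apply, sub_apply, hD1, hD2, dlogDensity, dlogDensity, f1, f2]
  simp only [smul_apply, smul_eq_mul, ContinuousLinearMap.comp_apply,
    ContinuousLinearMap.compL_apply, ContinuousLinearMap.comp_zero, add_zero,
    ContinuousLinearMap.coe_fst', ContinuousLinearMap.coe_snd', fstD, sndD]
  ring

end Derivative

end

end AngleInChart

/-! ### The differential of the angle of a spacelike Lagrangian immersion -/

section FixedTime

variable {n : ℕ} {M : Type*} [TopologicalSpace M] [ChartedSpace (Rn n) M]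
  {M' : Type*} [TopologicalSpace M'] [ChartedSpace (Rn n) M']
  {L : Type*} [TopologicalSpace L] [ChartedSpace (Rn n) L]

open GKM (dF velocity)

lemma three_le_infty : (3 : ℕ∞ω) ≤ ∞ := ENat.LEInfty.out

/-- The second derivative of the immersion in the preferred charts. -/
def secondDeriv (F : L → M × M') (p : L) : Rn n →L[ℝ] Rn n →L[ℝ] Rn n × Rn n :=
  fderiv ℝ (fderiv ℝ (inCharts F p (F p))) (extChartAt 𝓘(ℝ, Rn n) p p)

lemma inCharts_self (p : L) (F : L → M × M') :
    inCharts F p (F p) (extChartAt 𝓘(ℝ, Rn n) p p) = extChartAt (prodModel n) (F p) (F p) := by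
  rw [inCharts, extChartAt_to_inv]

/-- The para-complex structure as a continuous linear map. -/
def kMap (n : ℕ) : (Rn n × Rn n) →L[ℝ] Rn n × Rn n :=
  (ContinuousLinearMap.fst ℝ (Rn n) (Rn n)).prod (-ContinuousLinearMap.snd ℝ (Rn n) (Rn n))

/-- The product rule for `w ↦ h(f(w))(A (φ(w) u), φ(w) v)`. -/
lemma hasFDerivAt_bilin_comp {E V : Type*} [NormedAddCommGroup E] [NormedSpace ℝ E]
    [NormedAddCommGroup V] [NormedSpace ℝ V] {H : E → E →L[ℝ] E →L[ℝ] ℝ}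
    {D : E →L[ℝ] E →L[ℝ] E →L[ℝ] ℝ} {f : V → E} {f' : V →L[ℝ] E} {φ : V → V →L[ℝ] E}
    {φ' : V →L[ℝ] V →L[ℝ] E} {w : V} (hH : HasFDerivAt H D (f w)) (hf : HasFDerivAt f f' w)
    (hφ : HasFDerivAt φ φ' w) (A : E →L[ℝ] E) (u v : V) :
    ∃ D' : V →L[ℝ] ℝ, (∀ x, D' x = D (f' x) (A (φ w u)) (φ w v) + H (f w) (A (φ' x u)) (φ w v)
        + H (f w) (A (φ w u)) (φ' x v)) ∧
      HasFDerivAt (fun y => H (f y) (A (φ y u)) (φ y v)) D' w := by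
  have h1 : HasFDerivAt (fun y => H (f y)) (D.comp f') w :=
    HasFDerivAt.comp (g := H) (f := f) w hH hf
  have h2 : HasFDerivAt (fun y => φ y u) (φ'.flip u) w := by
    refine (hφ.clm_apply (hasFDerivAt_const u w)).congr_fderiv ?_
    ext x
    simp
  have h3 : HasFDerivAt (fun y => φ y v) (φ'.flip v) w := by
    refine (hφ.clm_apply (hasFDerivAt_const v w)).congr_fderiv ?_
    ext x
    simp
  have h4 : HasFDerivAt (fun y => A (φ y u)) (A.comp (φ'.flip u)) w := A.hasFDerivAt.comp w h2
  refine ⟨_, fun x => ?_, (h1.clm_apply h4).clm_apply h3⟩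
  simp
  ring

variable [IsManifold 𝓘(ℝ, Rn n) ∞ M] [IsManifold 𝓘(ℝ, Rn n) ∞ M']

/-- Product charts respect the splitting of the tangent spaces, hence `K`. -/
lemma chartD_K {z₀ : M × M'} {w : Rn n × Rn n} (hw : w ∈ (extChartAt (prodModel n) z₀).target)
    (U : Rn n × Rn n) : chartD (prodModel n) z₀ w (K U) = K (chartD (prodModel n) z₀ w U) := by
  rw [chartD_prod hw, chartD_prod hw]
  simp [K]

omit [IsManifold 𝓘(ℝ, Rn n) ∞ M] [IsManifold 𝓘(ℝ, Rn n) ∞ M'] in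
lemma isOpen_chart_source (z₀ : M × M') : IsOpen (extChartAt (prodModel n) z₀).source :=
  isOpen_extChartAt_source z₀

lemma contDiffWithinAt_chart {X : Type*} [NormedAddCommGroup X] [NormedSpace ℝ X] {s : Set X}
    {x : X} {f : X → M × M'} {z₀ : M × M'} (hf : ContMDiffWithinAt 𝓘(ℝ, X) (prodModel n) 3 f s x)
    (hz : f x ∈ (extChartAt (prodModel n) z₀).source) :
    ContDiffWithinAt ℝ 3 (fun y => extChartAt (prodModel n) z₀ (f y)) s x := by
  have : IsManifold (prodModel n) 3 (M × M') := IsManifold.of_le (n := ∞) three_le_infty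
  have hz' : f x ∈ (chartAt (ModelProd (Rn n) (Rn n)) z₀).source := by
    rwa [← extChartAt_source (prodModel n)]
  have h1 := (contMDiffAt_extChartAt' (I := prodModel n) (n := 3) hz').comp_contMDiffWithinAt x hf
  exact h1.contDiffWithinAt

variable [IsManifold 𝓘(ℝ, Rn n) ∞ L]

lemma contMDiffAt_chart_symm {p₀ : L} {w : Rn n} (hw : w ∈ (extChartAt 𝓘(ℝ, Rn n) p₀).target) :
    ContMDiffAt 𝓘(ℝ, Rn n) 𝓘(ℝ, Rn n) 3 (extChartAt 𝓘(ℝ, Rn n) p₀).symm w := by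
  have : IsManifold 𝓘(ℝ, Rn n) 3 L := IsManifold.of_le (n := ∞) three_le_infty
  exact (contMDiffOn_extChartAt_symm p₀).contMDiffAt
    ((isOpen_extChartAt_target p₀).mem_nhds hw)

lemma contDiffAt_inCharts {F : L → M × M'} {p₀ : L} {z₀ : M × M'} {w : Rn n}
    (hF : ContMDiff 𝓘(ℝ, Rn n) (prodModel n) 3 F)
    (hw : w ∈ (extChartAt 𝓘(ℝ, Rn n) p₀).target)
    (hz : F ((extChartAt 𝓘(ℝ, Rn n) p₀).symm w) ∈ (extChartAt (prodModel n) z₀).source) :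
    ContDiffAt ℝ 3 (inCharts F p₀ z₀) w := by
  have h1 : ContMDiffAt 𝓘(ℝ, Rn n) (prodModel n) 3
      (fun y => F ((extChartAt 𝓘(ℝ, Rn n) p₀).symm y)) w :=
    hF.contMDiffAt.comp w (contMDiffAt_chart_symm hw)
  exact contDiffWithinAt_chart h1 hz

variable {G : GKM n M M'} {F : L → M × M'} (hF : IsSpacelikeLagrangian G F)

include hF

namespace IsSpacelikeLagrangian

lemma eventually_inCharts {p₀ : L} {z₀ : M × M'} {w : Rn n}
    (hw : w ∈ (extChartAt 𝓘(ℝ, Rn n) p₀).target)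
    (hz : F ((extChartAt 𝓘(ℝ, Rn n) p₀).symm w) ∈ (extChartAt (prodModel n) z₀).source) :
    ∀ᶠ y in 𝓝 w, y ∈ (extChartAt 𝓘(ℝ, Rn n) p₀).target ∧
      F ((extChartAt 𝓘(ℝ, Rn n) p₀).symm y) ∈ (extChartAt (prodModel n) z₀).source := by
  have h1 : ContinuousAt (fun y => F ((extChartAt 𝓘(ℝ, Rn n) p₀).symm y)) w :=
    hF.contMDiff.continuous.continuousAt.comp (contMDiffAt_chart_symm hw).continuousAt
  exact Filter.inter_mem ((isOpen_extChartAt_target p₀).mem_nhds hw)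
    (h1.preimage_mem_nhds ((isOpen_chart_source z₀).mem_nhds hz))

lemma mdifferentiableAt (p : L) : MDifferentiableAt 𝓘(ℝ, Rn n) (prodModel n) F p :=
  (hF.contMDiff p).mdifferentiableAt (by norm_num)

section Nearby

variable {p₀ : L} {z₀ : M × M'} {w : Rn n} (hw : w ∈ (extChartAt 𝓘(ℝ, Rn n) p₀).target)
  (hz : F ((extChartAt 𝓘(ℝ, Rn n) p₀).symm w) ∈ (extChartAt (prodModel n) z₀).source)

include hw hz

lemma inChart_fderiv (U : Rn n × Rn n) (v : Rn n) :
    inChart (prodModel n) G.h z₀ (inCharts F p₀ z₀ w) U (fderiv ℝ (inCharts F p₀ z₀) w v)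
      = G.h (F ((extChartAt 𝓘(ℝ, Rn n) p₀).symm w))
        (chartD (prodModel n) z₀ (inCharts F p₀ z₀ w) U)
        (dF F ((extChartAt 𝓘(ℝ, Rn n) p₀).symm w) (chartD 𝓘(ℝ, Rn n) p₀ w v)) := by
  rw [inChart_apply, symm_inCharts hz, chartD_fderiv_inCharts hw (hF.mdifferentiableAt _) hz]

lemma inChart_K_fderiv (U : Rn n × Rn n) (v : Rn n) :
    inChart (prodModel n) G.h z₀ (inCharts F p₀ z₀ w) U (K (fderiv ℝ (inCharts F p₀ z₀) w v))
      = G.h (F ((extChartAt 𝓘(ℝ, Rn n) p₀).symm w))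
        (chartD (prodModel n) z₀ (inCharts F p₀ z₀ w) U)
        (K (dF F ((extChartAt 𝓘(ℝ, Rn n) p₀).symm w) (chartD 𝓘(ℝ, Rn n) p₀ w v))) := by
  rw [inChart_apply, symm_inCharts hz, chartD_K (inCharts_mem_target hz),
    chartD_fderiv_inCharts hw (hF.mdifferentiableAt _) hz]

lemma inChart_induced (u v : Rn n) :
    inChart 𝓘(ℝ, Rn n) (G.induced F) p₀ w u v
      = inChart (prodModel n) G.h z₀ (inCharts F p₀ z₀ w) (fderiv ℝ (inCharts F p₀ z₀) w u)
        (fderiv ℝ (inCharts F p₀ z₀) w v) := by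
  rw [hF.inChart_fderiv hw hz, chartD_fderiv_inCharts hw (hF.mdifferentiableAt _) hz]
  rfl

lemma lagrangian_inCharts (u v : Rn n) :
    inChart (prodModel n) G.h z₀ (inCharts F p₀ z₀ w) (K (fderiv ℝ (inCharts F p₀ z₀) w u))
      (fderiv ℝ (inCharts F p₀ z₀) w v) = 0 := by
  rw [hF.inChart_fderiv hw hz, chartD_K (inCharts_mem_target hz),
    chartD_fderiv_inCharts hw (hF.mdifferentiableAt _) hz]
  exact hF.isLagrangian _ _ _

lemma isKMForm_inCharts : IsKMForm (inChart (prodModel n) G.h z₀ (inCharts F p₀ z₀ w)) :=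
  G.isKMForm_inChart (inCharts_mem_target hz) (by
    rw [symm_inCharts hz]
    exact hF.notMem_cut _)

lemma spacelike_inCharts (u : Rn n) (hu : u ≠ 0) :
    0 < inChart (prodModel n) G.h z₀ (inCharts F p₀ z₀ w) (fderiv ℝ (inCharts F p₀ z₀) w u)
      (fderiv ℝ (inCharts F p₀ z₀) w u) := by
  have hne : chartD 𝓘(ℝ, Rn n) p₀ w u ≠ 0 := by
    intro h0
    have := inverse_comp_apply (chartD_isInvertible 𝓘(ℝ, Rn n) hw) u
    rw [h0, map_zero] at this
    exact hu this.symm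
  rw [← hF.inChart_induced hw hz, inChart_apply]
  exact hF.isSpacelike _ _ hne

lemma isInvertible_fst_inCharts : (fstD (fderiv ℝ (inCharts F p₀ z₀) w)).IsInvertible :=
  isInvertible_fstD (hF.isKMForm_inCharts hw hz) (hF.spacelike_inCharts hw hz)
    (hF.lagrangian_inCharts hw hz)

lemma isInvertible_snd_inCharts : (sndD (fderiv ℝ (inCharts F p₀ z₀) w)).IsInvertible :=
  isInvertible_sndD (hF.isKMForm_inCharts hw hz) (hF.spacelike_inCharts hw hz)
    (hF.lagrangian_inCharts hw hz)

lemma angle_inCharts : G.angle F ((extChartAt 𝓘(ℝ, Rn n) p₀).symm w)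
    = G.angleInChart z₀ (inCharts F p₀ z₀ w) (fderiv ℝ (inCharts F p₀ z₀) w) :=
  G.angle_eq_angleInChart hw (hF.mdifferentiableAt _) hz (hF.density_ne_zero _)
    (hF.density'_ne_zero _)

lemma contDiffAt_angle_comp :
    ContDiffAt ℝ 2 (G.angle F ∘ (extChartAt 𝓘(ℝ, Rn n) p₀).symm) w := by
  have hf := contDiffAt_inCharts hF.contMDiff hw hz
  have h1 : ContDiffAt ℝ 2 (fun y => G.angleInChart z₀ (inCharts F p₀ z₀ y)
      (fderiv ℝ (inCharts F p₀ z₀) y)) w :=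
    G.contDiffWithinAt_angleInChart (hf.of_le (by norm_num))
      (hf.fderiv_right (m := 2) (by norm_num)) (inCharts_mem_target hz)
      (hF.isInvertible_fst_inCharts hw hz)
      (hF.isInvertible_snd_inCharts hw hz)
  refine h1.congr_of_eventuallyEq ?_
  filter_upwards [hF.eventually_inCharts hw hz] with y hy
  exact hF.angle_inCharts hy.1 hy.2

end Nearby

section Center

variable (p : L)

/-- The hypothesis of the chart lemmas above, at the centre of the charts. -/
lemma mem_source_self : F ((extChartAt 𝓘(ℝ, Rn n) p).symm (extChartAt 𝓘(ℝ, Rn n) p p))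
    ∈ (extChartAt (prodModel n) (F p)).source := by
  rw [extChartAt_to_inv]
  exact mem_extChartAt_source (F p)

lemma fderiv_inCharts_self :
    fderiv ℝ (inCharts F p (F p)) (extChartAt 𝓘(ℝ, Rn n) p p) = dF F p := by
  ext1 v
  have h := chartD_fderiv_inCharts (mem_extChartAt_target p) (hF.mdifferentiableAt _)
    (hF.mem_source_self p) v
  rw [inCharts_self, chartD_self, chartD_self, extChartAt_to_inv] at h
  exact h

lemma contDiffAt_self : ContDiffAt ℝ 3 (inCharts F p (F p)) (extChartAt 𝓘(ℝ, Rn n) p p) :=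
  contDiffAt_inCharts hF.contMDiff (mem_extChartAt_target p) (hF.mem_source_self p)

lemma hasFDerivAt_self :
    HasFDerivAt (inCharts F p (F p)) (dF F p) (extChartAt 𝓘(ℝ, Rn n) p p) := by
  have h := ((hF.contDiffAt_self p).differentiableAt (by norm_num)).hasFDerivAt
  rwa [hF.fderiv_inCharts_self] at h

lemma hasFDerivAt_fderiv_self : HasFDerivAt (fderiv ℝ (inCharts F p (F p))) (secondDeriv F p)
    (extChartAt 𝓘(ℝ, Rn n) p p) :=
  (((hF.contDiffAt_self p).fderiv_right (m := 2) (by norm_num)).differentiableAt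
    (by norm_num)).hasFDerivAt

lemma hasFDerivAt_inChart_self : HasFDerivAt (inChart (prodModel n) G.h (F p))
    (G.metricDeriv (F p)) (inCharts F p (F p) (extChartAt 𝓘(ℝ, Rn n) p p)) := by
  rw [inCharts_self]
  exact G.hasFDerivAt_inChart (hF.notMem_cut p)

lemma eventually_self : ∀ᶠ y in 𝓝 (extChartAt 𝓘(ℝ, Rn n) p p),
    y ∈ (extChartAt 𝓘(ℝ, Rn n) p).target ∧
      F ((extChartAt 𝓘(ℝ, Rn n) p).symm y) ∈ (extChartAt (prodModel n) (F p)).source :=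
  hF.eventually_inCharts (mem_extChartAt_target p) (hF.mem_source_self p)

/-- The derivative of the Lagrangian condition in fixed charts. -/
lemma isLagrangianJet :
    IsLagrangianJet (G.h (F p)) (G.metricDeriv (F p)) (dF F p) (secondDeriv F p) where
  form := G.isKMForm (hF.notMem_cut p)
  deriv := G.isKMDeriv (hF.notMem_cut p)
  spacelike := hF.isSpacelike p
  lagrangian := hF.isLagrangian p
  symm := ((hF.contDiffAt_self p).isSymmSndFDerivAt (by simp; norm_num)).eq
  deriv_lagrangian w u v := by
    obtain ⟨D', hD', h⟩ := hasFDerivAt_bilin_comp (hF.hasFDerivAt_inChart_self p)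
      (hF.hasFDerivAt_self p) (hF.hasFDerivAt_fderiv_self p) (kMap n) u v
    have h0 := h.unique ((hasFDerivAt_const (0 : ℝ) _).congr_of_eventuallyEq
      ((hF.eventually_self p).mono fun y hy => hF.lagrangian_inCharts hy.1 hy.2 u v))
    have h1 := hD' w
    rw [h0, inCharts_self, inChart_self, hF.fderiv_inCharts_self] at h1
    exact h1.symm

/-- The derivative of the induced metric in the preferred chart. -/
lemma hasFDerivAt_inChart_induced (u v : Rn n) :
    ∃ D' : Rn n →L[ℝ] ℝ, (∀ w, D' w = G.metricDeriv (F p) (dF F p w) (dF F p u) (dF F p v)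
        + G.h (F p) (secondDeriv F p w u) (dF F p v) + G.h (F p) (dF F p u) (secondDeriv F p w v)) ∧
      HasFDerivAt (fun y => inChart 𝓘(ℝ, Rn n) (G.induced F) p y u v) D'
        (extChartAt 𝓘(ℝ, Rn n) p p) := by
  obtain ⟨D', hD', h⟩ := hasFDerivAt_bilin_comp (hF.hasFDerivAt_inChart_self p)
    (hF.hasFDerivAt_self p) (hF.hasFDerivAt_fderiv_self p) (ContinuousLinearMap.id ℝ _) u v
  refine ⟨D', fun w => ?_, h.congr_of_eventuallyEq
    ((hF.eventually_self p).mono fun y hy => hF.inChart_induced hy.1 hy.2 u v)⟩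
  rw [hD', inCharts_self, inChart_self, hF.fderiv_inCharts_self]
  rfl

lemma mdifferentiableAt_angle : MDifferentiableAt 𝓘(ℝ, Rn n) 𝓘(ℝ, ℝ) (G.angle F) p :=
  mdifferentiableAt_of_chart 𝓘(ℝ, Rn n) ((hF.contDiffAt_angle_comp (mem_extChartAt_target p)
    (hF.mem_source_self p)).differentiableAt two_ne_zero)

/-- The logarithmic derivatives of the two densities on the frame of coordinate vectors give the
differential of the angle. -/
lemma differential_angle (u : Rn n) : 2 * differential 𝓘(ℝ, Rn n) (G.angle F) p u
    = dlogDensity G.ρ (F p).1 (dF F p u).1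
        + endTrace ((fstD (n := n) (dF F p)).inverse ∘L fstD (secondDeriv F p u))
      - (dlogDensity G.ρ' (F p).2 (dF F p u).2
        + endTrace ((sndD (n := n) (dF F p)).inverse ∘L sndD (secondDeriv F p u))) := by
  have hw := mem_extChartAt_target (I := 𝓘(ℝ, Rn n)) p
  have hz := hF.mem_source_self p
  obtain ⟨D, hD, h⟩ := G.hasFDerivWithinAt_angleInChart (z₀ := F p) (s := Set.univ)
    (hF.hasFDerivAt_self p).hasFDerivWithinAt (hF.hasFDerivAt_fderiv_self p).hasFDerivWithinAt
    (inCharts_self p F) (hF.isInvertible_fst_inCharts hw hz) (hF.isInvertible_snd_inCharts hw hz)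
  rw [hasFDerivWithinAt_univ] at h
  have h1 := h.congr_of_eventuallyEq (f₁ := G.angle F ∘ (extChartAt 𝓘(ℝ, Rn n) p).symm)
    ((hF.eventually_self p).mono fun y hy => hF.angle_inCharts hy.1 hy.2)
  rw [← fderiv_comp_chart_symm_self 𝓘(ℝ, Rn n) (hF.mdifferentiableAt_angle p), h1.fderiv, hD,
    hF.fderiv_inCharts_self]

lemma contMDiff_angle : ContMDiff 𝓘(ℝ, Rn n) 𝓘(ℝ, ℝ) 2 (G.angle F) := by
  intro p
  have h := hF.contDiffAt_angle_comp (mem_extChartAt_target p) (hF.mem_source_self p)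
  have : IsManifold 𝓘(ℝ, Rn n) 2 L :=
    IsManifold.of_le (n := ∞) (le_trans (by norm_num) three_le_infty)
  have h1 : ContMDiffAt 𝓘(ℝ, Rn n) 𝓘(ℝ, ℝ) 2
      ((G.angle F ∘ (extChartAt 𝓘(ℝ, Rn n) p).symm) ∘ extChartAt 𝓘(ℝ, Rn n) p) p :=
    h.contMDiffAt.comp p contMDiffAt_extChartAt
  refine h1.congr_of_eventuallyEq ?_
  filter_upwards [extChartAt_source_mem_nhds (I := 𝓘(ℝ, Rn n)) p] with q hq
  simp only [Function.comp]
  rw [(extChartAt 𝓘(ℝ, Rn n) p).left_inv hq]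

end Center

end IsSpacelikeLagrangian

end FixedTime

/-! ### The Laplacian as a divergence -/

section Divergence

variable {n : ℕ}

lemma metricTrace_flip {g : Rn n →L[ℝ] Rn n →L[ℝ] ℝ} (hg : g.IsInvertible)
    (hs : ∀ u v, g u v = g v u) (b : Rn n →L[ℝ] Rn n →L[ℝ] ℝ) :
    metricTrace g (fun u v => b v u) = metricTrace g (fun u v => b u v) := by
  have h1 : (fun u v => b v u) = fun u v => b.flip u v := rfl
  rw [h1, metricTrace_eq_sum, metricTrace_eq_sum, Finset.sum_comm]
  refine Finset.sum_congr rfl fun i _ => Finset.sum_congr rfl fun j _ => ?_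
  rw [sharp_proj_comm hg hs]
  rfl

lemma map_metricTrace {W W₂ : Type*} [NormedAddCommGroup W] [NormedSpace ℝ W]
    [NormedAddCommGroup W₂] [NormedSpace ℝ W₂] (A : W →L[ℝ] W₂) (g : Rn n →L[ℝ] Rn n →L[ℝ] ℝ)
    (b : Rn n → Rn n → W) : A (metricTrace g b) = metricTrace g (fun u v => A (b u v)) := by
  simp [metricTrace]

variable {L : Type*} [TopologicalSpace L] [ChartedSpace (Rn n) L]
  [IsManifold 𝓘(ℝ, Rn n) ∞ L]

/-- If the vector field `Y` is the gradient of `f` near `p`, then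
`Δf = ∂ᵢYⁱ + (1 / 2) gⁱʲ ∂_Y gᵢⱼ`, the divergence of `Y`. -/
lemma laplacian_eq_divergence {g : L → Rn n →L[ℝ] Rn n →L[ℝ] ℝ} {f : L → ℝ} {p : L}
    (hg : (g p).IsInvertible) (hs : ∀ q u v, g q u v = g q v u)
    (hgd : DifferentiableAt ℝ (inChart 𝓘(ℝ, Rn n) g p) (extChartAt 𝓘(ℝ, Rn n) p p))
    (hf : ContDiffAt ℝ 2 (f ∘ (extChartAt 𝓘(ℝ, Rn n) p).symm) (extChartAt 𝓘(ℝ, Rn n) p p))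
    {Y : Rn n → Rn n} {Y' : Rn n →L[ℝ] Rn n}
    (hY : HasFDerivAt Y Y' (extChartAt 𝓘(ℝ, Rn n) p p))
    (hgrad : ∀ᶠ w in 𝓝 (extChartAt 𝓘(ℝ, Rn n) p p), ∀ v,
      inChart 𝓘(ℝ, Rn n) g p w (Y w) v = fderiv ℝ (f ∘ (extChartAt 𝓘(ℝ, Rn n) p).symm) w v) :
    laplacian g f p = endTrace Y' + 1 / 2 * metricTrace (g p)
      (fderiv ℝ (inChart 𝓘(ℝ, Rn n) g p) (extChartAt 𝓘(ℝ, Rn n) p p)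
        (Y (extChartAt 𝓘(ℝ, Rn n) p p)) · ·) := by
  set w₀ := extChartAt 𝓘(ℝ, Rn n) p p with hw₀
  set fc := f ∘ (extChartAt 𝓘(ℝ, Rn n) p).symm with hfc
  set D := fderiv ℝ (inChart 𝓘(ℝ, Rn n) g p) w₀ with hD
  have hmf : MDifferentiableAt 𝓘(ℝ, Rn n) 𝓘(ℝ, ℝ) f p :=
    mdifferentiableAt_of_chart 𝓘(ℝ, Rn n) (hf.differentiableAt two_ne_zero)
  have hself : inChart 𝓘(ℝ, Rn n) g p w₀ = g p := inChart_self 𝓘(ℝ, Rn n) g p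
  have hdf (v : Rn n) : differential 𝓘(ℝ, Rn n) f p v = g p (Y w₀) v := by
    rw [← fderiv_comp_chart_symm_self 𝓘(ℝ, Rn n) hmf, ← hself]
    exact (hgrad.self_of_nhds v).symm
  have hf1 : DifferentiableAt ℝ (fderiv ℝ fc) w₀ :=
    (hf.fderiv_right (m := 1) (by norm_num)).differentiableAt one_ne_zero
  have hsecond (u v : Rn n) : fderiv ℝ (fderiv ℝ fc) w₀ u v = D u (Y w₀) v + g p (Y' u) v := by
    rw [fderiv_apply_eq hf1]
    have h1 := (hgd.hasFDerivAt.clm_apply hY).clm_apply (hasFDerivAt_const v w₀)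
    have h2 := h1.congr_of_eventuallyEq (f₁ := fun w => fderiv ℝ fc w v)
      (hgrad.mono fun w hw => (hw v).symm)
    rw [h2.fderiv]
    simp [hself]
    ring
  have hDs (x u v : Rn n) : D x u v = D x v u := by
    have h1 (u v : Rn n) : D x u v = fderiv ℝ (fun w => inChart 𝓘(ℝ, Rn n) g p w u v) w₀ x := by
      have := ((hgd.hasFDerivAt.clm_apply (hasFDerivAt_const u w₀)).clm_apply
        (hasFDerivAt_const v w₀)).fderiv
      rw [this]
      simp [hD]
    rw [h1, h1]
    congr 2
    funext w
    rw [inChart_apply, inChart_apply, hs]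
  have hchr (u v : Rn n) : differential 𝓘(ℝ, Rn n) f p (christoffel 𝓘(ℝ, Rn n) g p u v)
      = 1 / 2 * (D u (Y w₀) v + (D v (Y w₀) u - D (Y w₀) u v)) := by
    rw [hdf, hs]
    unfold christoffel
    simp only
    rw [apply_sharp hg]
    simp only [smul_apply, sub_apply, add_apply, ContinuousLinearMap.flip_apply, smul_eq_mul]
    rw [← hw₀, ← hD, hDs u v, hDs v u]
    ring
  have hint : (fun u v => fderiv ℝ (fderiv ℝ fc) w₀ u v
      - differential 𝓘(ℝ, Rn n) f p (christoffel 𝓘(ℝ, Rn n) g p u v))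
      = fun u v => D u (Y w₀) v + g p (Y' u) v
        - 1 / 2 * (D u (Y w₀) v + (D v (Y w₀) u - D (Y w₀) u v)) := by
    funext u v
    rw [hsecond, hchr]
  have hflip := metricTrace_flip hg (hs p) (D.flip (Y w₀))
  simp only [ContinuousLinearMap.flip_apply] at hflip
  unfold laplacian
  rw [← hw₀, ← hfc, hint, metricTrace_sub, metricTrace_const_mul, metricTrace_add, metricTrace_add,
    metricTrace_sub, hflip, metricTrace_eq_endTrace hg (hs p) fun u v => rfl]
  ring

end Divergence

/-! ### The mean curvature form is the differential of the angle -/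

section MeanCurvature

variable {n : ℕ} {M : Type*} [TopologicalSpace M] [ChartedSpace (Rn n) M]
  {M' : Type*} [TopologicalSpace M'] [ChartedSpace (Rn n) M']
  {L : Type*} [TopologicalSpace L] [ChartedSpace (Rn n) L]
  [IsManifold 𝓘(ℝ, Rn n) ∞ M] [IsManifold 𝓘(ℝ, Rn n) ∞ M'] [IsManifold 𝓘(ℝ, Rn n) ∞ L]
  {G : GKM n M M'} {F : L → M × M'} (hF : IsSpacelikeLagrangian G F)

open GKM (dF velocity)

include hF

namespace IsSpacelikeLagrangian

lemma apply_dF_K (p : L) (u v : Rn n) : G.h (F p) (dF F p u) (K (dF F p v)) = 0 := by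
  rw [G.h_symm _ (hF.notMem_cut p)]
  exact hF.isLagrangian p v u

lemma normal_apply_K (p : L) (w : Rn n × Rn n) (u : Rn n) :
    G.h (F p) (G.normal F p w) (K (dF F p u)) = G.h (F p) w (K (dF F p u)) := by
  have h1 := hF.apply_dF_K p (G.tangential F p w) u
  rw [GKM.normal, map_sub, sub_apply]
  exact sub_eq_self.2 h1

lemma induced_nonneg (p : L) (u : Rn n) : 0 ≤ G.induced F p u u := by
  by_cases h : u = 0
  · simp [h]
  · exact (hF.isSpacelike p u h).le

lemma induced_tangential (p : L) (w : Rn n × Rn n) (u : Rn n) :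
    G.induced F p (G.tangential F p w) u = G.h (F p) w (dF F p u) := by
  rw [GKM.tangential, apply_sharp (hF.induced_isInvertible p)]
  rfl

lemma normal_apply_tangent (p : L) (w : Rn n × Rn n) (u : Rn n) :
    G.h (F p) (G.normal F p w) (dF F p u) = 0 := by
  have h1 := hF.induced_tangential p w u
  rw [GKM.normal, map_sub, sub_apply]
  exact sub_eq_zero.2 h1.symm

lemma tangential_normal (p : L) (w : Rn n × Rn n) :
    G.tangential F p (G.normal F p w) = 0 := by
  refine eq_of_forall_apply_eq (hF.induced_isInvertible p) fun u => ?_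
  rw [hF.induced_tangential, hF.normal_apply_tangent, map_zero]
  rfl

/-- The form `h(H - n ∇̂ψ, K dF ·)` is `-dθ`: the generalized mean curvature vector is
`K dF(∇θ)`. -/
lemma genMeanCurvature_apply_K (hn : 1 ≤ n) (p : L) (w : Rn n) :
    G.h (F p) (G.genMeanCurvature F p) (K (dF F p w))
      = -differential 𝓘(ℝ, Rn n) (G.angle F) p w := by
  have hz := hF.notMem_cut p
  have J := hF.isLagrangianJet p
  have hH : G.h (F p) (G.meanCurvature F p) (K (dF F p w))
      = 1 / 2 * (endTrace ((sndD (n := n) (dF F p)).inverse ∘L sndD (secondDeriv F p w))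
        - endTrace ((fstD (n := n) (dF F p)).inverse ∘L fstD (secondDeriv F p w))
        + mixedLogDet (G.h (F p)) (G.metricDeriv (F p)) (0, (dF F p w).2)
        - mixedLogDet (G.h (F p)) (G.metricDeriv (F p)) ((dF F p w).1, 0)) := by
    rw [← J.metricTrace_secondFF_form]
    have h1 := map_metricTrace ((G.h (F p)).flip (K (dF F p w))) (G.induced F p) (G.secondFF F p)
    simp only [ContinuousLinearMap.flip_apply] at h1
    refine h1.trans ?_
    have h2 (u v : Rn n) := hF.normal_apply_K p
      (secondDeriv F p u v + christoffel (prodModel n) G.h (F p) (dF F p u) (dF F p v)) w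
    exact congrArg (metricTrace (G.induced F p)) (funext fun u => funext fun v => h2 u v)
  have hψ := (G.differential_psi hn hz).2 (K (dF F p w))
  have hgrad : G.h (F p) (G.normal F p (grad (prodModel n) G.h G.ψ (F p))) (K (dF F p w))
      = differential (prodModel n) G.ψ (F p) (K (dF F p w)) := by
    rw [hF.normal_apply_K, grad, apply_sharp (G.isKMForm hz).isInvertible]
  have hmix : mixedLogDet (G.h (F p)) (G.metricDeriv (F p)) (K (dF F p w))
      = mixedLogDet (G.h (F p)) (G.metricDeriv (F p)) ((dF F p w).1, 0)
        - mixedLogDet (G.h (F p)) (G.metricDeriv (F p)) (0, (dF F p w).2) := by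
    have : K (dF F p w) = ((dF F p w).1, (0 : Rn n)) + -((0 : Rn n), (dF F p w).2) := by
      simp [K]
    rw [this, mixedLogDet_add, mixedLogDet_neg, sub_eq_add_neg]
  have hθ := hF.differential_angle p w
  rw [hmix] at hψ
  simp only [K, map_neg] at hψ
  have h2 : G.h (F p) (G.genMeanCurvature F p) (K (dF F p w))
      = G.h (F p) (G.meanCurvature F p) (K (dF F p w))
        - n * G.h (F p) (G.normal F p (grad (prodModel n) G.h G.ψ (F p))) (K (dF F p w)) := by
    rw [GKM.genMeanCurvature, map_sub, map_smul]
    rfl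
  rw [h2, hH, hgrad]
  simp only [K] at hψ ⊢
  linarith

lemma hasMFDerivAt_psi_comp (hn : 1 ≤ n) (p : L) :
    HasMFDerivAt 𝓘(ℝ, Rn n) 𝓘(ℝ, ℝ) (fun q => G.ψ (F q)) p
      ((mfderiv (prodModel n) 𝓘(ℝ, ℝ) G.ψ (F p)).comp
        (mfderiv 𝓘(ℝ, Rn n) (prodModel n) F p)) :=
  HasMFDerivAt.comp (g := G.ψ) (f := F) p ((G.differential_psi hn (hF.notMem_cut p)).1).hasMFDerivAt
    (hF.mdifferentiableAt p).hasMFDerivAt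

lemma differential_psi_comp (hn : 1 ≤ n) (p : L) (w : Rn n) :
    differential 𝓘(ℝ, Rn n) (fun q => G.ψ (F q)) p w
      = differential (prodModel n) G.ψ (F p) (dF F p w) :=
  congrArg (fun A : Rn n →L[ℝ] ℝ => A w) (hF.hasMFDerivAt_psi_comp hn p).mfderiv

lemma contDiffAt_inChart_induced (p : L) :
    ContDiffAt ℝ 1 (inChart 𝓘(ℝ, Rn n) (G.induced F) p) (extChartAt 𝓘(ℝ, Rn n) p p) := by
  refine contDiffAt_of_apply fun u => contDiffAt_of_apply fun v => ?_
  refine ContDiffAt.congr_of_eventuallyEq ?_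
    ((hF.eventually_self p).mono fun y hy => hF.inChart_induced hy.1 hy.2 u v)
  have hf := hF.contDiffAt_self p
  have h1 : ContDiffAt ℝ 1 (inChart (prodModel n) G.h (F p))
      (inCharts F p (F p) (extChartAt 𝓘(ℝ, Rn n) p p)) := by
    rw [inCharts_self]
    exact (G.contDiffAt_inChart (hF.notMem_cut p)).of_le (by norm_num)
  have h2 := h1.comp (extChartAt 𝓘(ℝ, Rn n) p p) (hf.of_le (by norm_num))
  have h3 : ContDiffAt ℝ 1 (fderiv ℝ (inCharts F p (F p))) (extChartAt 𝓘(ℝ, Rn n) p p) :=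
    hf.fderiv_right (m := 1) (by norm_num)
  exact (h2.clm_apply (h3.clm_apply contDiffAt_const)).clm_apply (h3.clm_apply contDiffAt_const)

/-- The logarithmic derivative of `ρ(dx) ρ̄(dx̄) = exp (2nψ) det g`. -/
lemma logDeriv_densities (hn : 1 ≤ n) (p : L) (w : Rn n) :
    dlogDensity G.ρ (F p).1 (dF F p w).1
        + endTrace ((fstD (n := n) (dF F p)).inverse ∘L fstD (secondDeriv F p w))
      + (dlogDensity G.ρ' (F p).2 (dF F p w).2
        + endTrace ((sndD (n := n) (dF F p)).inverse ∘L sndD (secondDeriv F p w)))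
      = 2 * n * differential 𝓘(ℝ, Rn n) (fun q => G.ψ (F q)) p w
        + metricTrace (G.induced F p)
          (fderiv ℝ (inChart 𝓘(ℝ, Rn n) (G.induced F) p) (extChartAt 𝓘(ℝ, Rn n) p p) w · ·) := by
  have h1 := (G.differential_psi hn (hF.notMem_cut p)).2 (dF F p w)
  have h2 := (hF.isLagrangianJet p).metricTrace_deriv_induced w
  have h3 : (fun u v : Rn n => G.metricDeriv (F p) (dF F p w) (dF F p u) (dF F p v)
      + G.h (F p) (secondDeriv F p w u) (dF F p v) + G.h (F p) (dF F p u) (secondDeriv F p w v))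
      = (fderiv ℝ (inChart 𝓘(ℝ, Rn n) (G.induced F) p) (extChartAt 𝓘(ℝ, Rn n) p p) w · ·) := by
    funext u v
    obtain ⟨D', hD', h⟩ := hF.hasFDerivAt_inChart_induced p u v
    have h4 := ((hF.contDiffAt_inChart_induced p).differentiableAt one_ne_zero).hasFDerivAt
    have h5 := (h4.clm_apply (hasFDerivAt_const u _)).clm_apply (hasFDerivAt_const v _)
    have h6 := congrArg (fun A : Rn n →L[ℝ] ℝ => A w) (h5.unique h)
    simp only [hD'] at h6
    rw [← h6]
    simp
  rw [h3] at h2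
  rw [hF.differential_psi_comp hn, h1]
  have h4 : metricTrace ((G.h (F p)).bilinearComp (dF F p) (dF F p))
      (fderiv ℝ (inChart 𝓘(ℝ, Rn n) (G.induced F) p) (extChartAt 𝓘(ℝ, Rn n) p p) w · ·)
      = metricTrace (G.induced F p)
      (fderiv ℝ (inChart 𝓘(ℝ, Rn n) (G.induced F) p) (extChartAt 𝓘(ℝ, Rn n) p p) w · ·) := rfl
  rw [← h4, h2]
  ring

end IsSpacelikeLagrangian

end MeanCurvature

/-! ### The flow in fixed charts -/

section FlowInCharts

variable {n : ℕ}

/-- The derivative of `Φ⁻¹ y` when the derivative of `Φ` is symmetric. -/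
lemma exists_hasFDerivAt_inverse_apply {Φ : Rn n → Rn n →L[ℝ] Rn n} {y : Rn n → Rn n}
    {Φ' : Rn n →L[ℝ] Rn n →L[ℝ] Rn n} {y' : Rn n →L[ℝ] Rn n} {w₀ : Rn n}
    (hΦ : HasFDerivAt Φ Φ' w₀) (hs : ∀ u v, Φ' u v = Φ' v u) (hy : HasFDerivAt y y' w₀)
    (hinv : ∀ᶠ w in 𝓝 w₀, (Φ w).IsInvertible) :
    ∃ Z' : Rn n →L[ℝ] Rn n, HasFDerivAt (fun w => (Φ w).inverse (y w)) Z' w₀ ∧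
      endTrace ((Φ w₀).inverse ∘L y')
        = endTrace ((Φ w₀).inverse ∘L Φ' ((Φ w₀).inverse (y w₀))) + endTrace Z' := by
  have h0 := hinv.self_of_nhds
  have hd : DifferentiableAt ℝ (fun w => (Φ w).inverse) w₀ := by
    obtain ⟨e, he⟩ := h0
    have h1 := contDiffAt_map_inverse (𝕜 := ℝ) (n := 1) e
    rw [he] at h1
    exact (h1.differentiableAt one_ne_zero).comp w₀ hΦ.differentiableAt
  have hZ := (hd.clm_apply hy.differentiableAt).hasFDerivAt
  set Z := fun w => (Φ w).inverse (y w) with hZdef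
  set Z' := fderiv ℝ Z w₀ with hZ'
  refine ⟨Z', hZ, ?_⟩
  have h1 := (hΦ.clm_apply hZ).congr_of_eventuallyEq (f₁ := y)
    (hinv.mono fun w hw => (comp_inverse_apply hw (y w)).symm)
  have h2 : y' = Φ w₀ ∘L Z' + Φ' (Z w₀) := by
    rw [hy.unique h1]
    ext1 v
    simp [hs v]
  rw [← endTrace_add]
  congr 1
  ext1 v
  simp only [h2, ContinuousLinearMap.comp_apply, add_apply, map_add, inverse_comp_apply h0]
  exact add_comm _ _

variable {M : Type*} [TopologicalSpace M] [ChartedSpace (Rn n) M]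
  {M' : Type*} [TopologicalSpace M'] [ChartedSpace (Rn n) M']
  {L : Type*} [TopologicalSpace L] [ChartedSpace (Rn n) L]

open GKM (dF velocity)

/-- The domain of the flow in coordinates. -/
abbrev flowDomain (n : ℕ) (T : ℝ) : Set (ℝ × Rn n) := Set.Ico 0 T ×ˢ Set.univ

lemma uniqueDiffOn_flowDomain (T : ℝ) : UniqueDiffOn ℝ (flowDomain n T) :=
  (uniqueDiffOn_Ico 0 T).prod uniqueDiffOn_univ

lemma flowDomain_subset_closure_interior (T : ℝ) :
    flowDomain n T ⊆ closure (interior (flowDomain n T)) := by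
  rw [interior_prod_eq, interior_Ico, interior_univ, closure_prod_eq, closure_univ]
  rintro ⟨t, w⟩ ⟨ht, -⟩
  have ht' : 0 < T := ht.1.trans_lt ht.2
  rw [closure_Ioo ht'.ne]
  exact ⟨⟨ht.1, ht.2.le⟩, trivial⟩

/-- A family of maps in fixed charts, as a function of time and space. -/
def flowInCharts (F : ℝ → L → M × M') (p₀ : L) (z₀ : M × M') (q : ℝ × Rn n) : Rn n × Rn n :=
  inCharts (F q.1) p₀ z₀ q.2

variable [IsManifold 𝓘(ℝ, Rn n) ∞ M] [IsManifold 𝓘(ℝ, Rn n) ∞ M'] [IsManifold 𝓘(ℝ, Rn n) ∞ L]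
  {G : GKM n M M'} {T : ℝ} {F : ℝ → L → M × M'}

namespace GKM.IsGLMCF

variable (hF : G.IsGLMCF T F)

include hF

lemma isSpacelikeLagrangian {t : ℝ} (ht : t ∈ Set.Ico 0 T) : IsSpacelikeLagrangian G (F t) where
  contMDiff := by
    rw [← contMDiffOn_univ]
    refine hF.contMDiffOn.comp (f := fun p : L => (t, p)) ?_ fun p _ => ⟨ht, trivial⟩
    exact (contMDiff_const.prodMk contMDiff_id).contMDiffOn
  notMem_cut := hF.notMem_cut t ht
  isSpacelike := hF.isSpacelike t ht
  isLagrangian := hF.isLagrangian t ht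

lemma contMDiffWithinAt_chart_symm {p₀ : L} {t : ℝ} (ht : t ∈ Set.Ico 0 T) {w : Rn n}
    (hw : w ∈ (extChartAt 𝓘(ℝ, Rn n) p₀).target) :
    ContMDiffWithinAt 𝓘(ℝ, ℝ × Rn n) (prodModel n) 3
      (fun q : ℝ × Rn n => F q.1 ((extChartAt 𝓘(ℝ, Rn n) p₀).symm q.2))
      (flowDomain n T) (t, w) := by
  have h1 : ContMDiffAt 𝓘(ℝ, ℝ × Rn n) 𝓘(ℝ, ℝ) 3 (fun q : ℝ × Rn n => q.1) (t, w) :=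
    contDiff_fst.contMDiff.contMDiffAt
  have h2 : ContMDiffAt 𝓘(ℝ, ℝ × Rn n) 𝓘(ℝ, Rn n) 3 (fun q : ℝ × Rn n => q.2) (t, w) :=
    contDiff_snd.contMDiff.contMDiffAt
  have h3 : ContMDiffAt 𝓘(ℝ, ℝ × Rn n) 𝓘(ℝ, Rn n) 3
      (fun q : ℝ × Rn n => (extChartAt 𝓘(ℝ, Rn n) p₀).symm q.2) (t, w) :=
    ContMDiffAt.comp (g := (extChartAt 𝓘(ℝ, Rn n) p₀).symm) (f := fun q : ℝ × Rn n => q.2) (t, w)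
      (contMDiffAt_chart_symm hw) h2
  have h4 := (h1.prodMk h3).contMDiffWithinAt (s := flowDomain n T)
  exact ContMDiffWithinAt.comp (g := fun q : ℝ × L => F q.1 q.2)
    (f := fun q : ℝ × Rn n => (q.1, (extChartAt 𝓘(ℝ, Rn n) p₀).symm q.2)) (t, w)
    (hF.contMDiffOn (t, (extChartAt 𝓘(ℝ, Rn n) p₀).symm w) ⟨ht, trivial⟩) h4
    fun q hq => ⟨hq.1, trivial⟩

section Nearby

variable {p₀ : L} {z₀ : M × M'} {t : ℝ} (ht : t ∈ Set.Ico 0 T) {w : Rn n}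
  (hw : w ∈ (extChartAt 𝓘(ℝ, Rn n) p₀).target)
  (hz : F t ((extChartAt 𝓘(ℝ, Rn n) p₀).symm w) ∈ (extChartAt (prodModel n) z₀).source)

include ht hw hz

lemma contDiffWithinAt_flowInCharts :
    ContDiffWithinAt ℝ 3 (flowInCharts F p₀ z₀) (flowDomain n T) (t, w) :=
  contDiffWithinAt_chart (hF.contMDiffWithinAt_chart_symm ht hw) hz

lemma eventually_flowInCharts : ∀ᶠ q : ℝ × Rn n in 𝓝[flowDomain n T] (t, w),
    q.1 ∈ Set.Ico 0 T ∧ q.2 ∈ (extChartAt 𝓘(ℝ, Rn n) p₀).target ∧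
      F q.1 ((extChartAt 𝓘(ℝ, Rn n) p₀).symm q.2) ∈ (extChartAt (prodModel n) z₀).source := by
  have h1 := (hF.contMDiffWithinAt_chart_symm ht hw).continuousWithinAt.preimage_mem_nhdsWithin
    ((isOpen_chart_source z₀).mem_nhds hz)
  have h2 : ∀ᶠ q : ℝ × Rn n in 𝓝 (t, w), q.2 ∈ (extChartAt 𝓘(ℝ, Rn n) p₀).target :=
    continuous_snd.continuousAt.preimage_mem_nhds ((isOpen_extChartAt_target p₀).mem_nhds hw)
  filter_upwards [h1, nhdsWithin_le_nhds h2, self_mem_nhdsWithin] with q hq1 hq2 hq3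
  exact ⟨hq3.1, hq2, hq1⟩

lemma hasFDerivWithinAt_flowInCharts : HasFDerivWithinAt (flowInCharts F p₀ z₀)
    (fderivWithin ℝ (flowInCharts F p₀ z₀) (flowDomain n T) (t, w)) (flowDomain n T) (t, w) :=
  ((hF.contDiffWithinAt_flowInCharts ht hw hz).differentiableWithinAt
    (by norm_num)).hasFDerivWithinAt

lemma fderiv_inCharts_eq : fderiv ℝ (inCharts (F t) p₀ z₀) w
    = (fderivWithin ℝ (flowInCharts F p₀ z₀) (flowDomain n T) (t, w)).comp
      (ContinuousLinearMap.inr ℝ ℝ (Rn n)) :=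
  (HasFDerivWithinAt.comp_hasFDerivAt (g := flowInCharts F p₀ z₀) (f := fun y : Rn n => (t, y)) w
    (hF.hasFDerivWithinAt_flowInCharts ht hw hz) (hasFDerivAt_prodMk_right t w)
    (Filter.Eventually.of_forall fun _ => ⟨ht, trivial⟩)).fderiv

/-- The time derivative in fixed charts represents the velocity. -/
lemma chartD_velocity : chartD (prodModel n) z₀ (inCharts (F t) p₀ z₀ w)
    (fderivWithin ℝ (flowInCharts F p₀ z₀) (flowDomain n T) (t, w) (1, 0))
      = velocity T F t ((extChartAt 𝓘(ℝ, Rn n) p₀).symm w) := by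
  set q := (extChartAt 𝓘(ℝ, Rn n) p₀).symm w with hq
  have h1 : HasFDerivWithinAt (fun s => extChartAt (prodModel n) z₀ (F s q))
      ((fderivWithin ℝ (flowInCharts F p₀ z₀) (flowDomain n T) (t, w)).comp
        (ContinuousLinearMap.inl ℝ ℝ (Rn n))) (Set.Ico 0 T) t :=
    HasFDerivWithinAt.comp (g := flowInCharts F p₀ z₀) (f := fun s : ℝ => (s, w)) t
      (hF.hasFDerivWithinAt_flowInCharts ht hw hz) (hasFDerivAt_prodMk_left t w).hasFDerivWithinAt
      fun s hs => ⟨hs, trivial⟩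
  have h2 : ContMDiffWithinAt 𝓘(ℝ, ℝ) (prodModel n) 3 (fun s => F s q) (Set.Ico 0 T) t :=
    ContMDiffWithinAt.comp (g := fun q : ℝ × L => F q.1 q.2) (f := fun s : ℝ => (s, q)) t
      (hF.contMDiffOn (t, q) ⟨ht, trivial⟩)
      (contMDiff_id.prodMk contMDiff_const).contMDiffAt.contMDiffWithinAt fun s hs => ⟨hs, trivial⟩
  have hu := uniqueDiffOn_Ico 0 T t ht
  have h3 := (chartD_fderivWithin (prodModel n) (z₂ := z₀) hu
    (h2.mdifferentiableWithinAt (by norm_num)) hz 1).2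
  rw [h1.fderivWithin hu] at h3
  exact h3

lemma angle_flowInCharts : G.angle (F t) ((extChartAt 𝓘(ℝ, Rn n) p₀).symm w)
    = G.angleInChart z₀ (flowInCharts F p₀ z₀ (t, w))
      ((fderivWithin ℝ (flowInCharts F p₀ z₀) (flowDomain n T) (t, w)).comp
        (ContinuousLinearMap.inr ℝ ℝ (Rn n))) := by
  rw [← hF.fderiv_inCharts_eq ht hw hz]
  exact (hF.isSpacelikeLagrangian ht).angle_inCharts hw hz

lemma contDiffWithinAt_fderivWithin : ContDiffWithinAt ℝ 2
    (fderivWithin ℝ (flowInCharts F p₀ z₀) (flowDomain n T)) (flowDomain n T) (t, w) :=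
  (hF.contDiffWithinAt_flowInCharts ht hw hz).fderivWithin_right (uniqueDiffOn_flowDomain T)
    (by norm_num) ⟨ht, trivial⟩

lemma contDiffWithinAt_angle : ContDiffWithinAt ℝ 2
    (fun q : ℝ × Rn n => G.angle (F q.1) ((extChartAt 𝓘(ℝ, Rn n) p₀).symm q.2))
    (flowDomain n T) (t, w) := by
  have hFt := hF.isSpacelikeLagrangian ht
  have e := hF.fderiv_inCharts_eq ht hw hz
  have h1 := G.contDiffWithinAt_angleInChart (z₀ := z₀)
    ((hF.contDiffWithinAt_flowInCharts ht hw hz).of_le (by norm_num))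
    ((hF.contDiffWithinAt_fderivWithin ht hw hz).clm_comp
      (contDiffWithinAt_const (c := ContinuousLinearMap.inr ℝ ℝ (Rn n))))
    (inCharts_mem_target hz) (by rw [← e]; exact hFt.isInvertible_fst_inCharts hw hz)
    (by rw [← e]; exact hFt.isInvertible_snd_inCharts hw hz)
  refine h1.congr_of_eventuallyEq ?_ (hF.angle_flowInCharts ht hw hz)
  filter_upwards [hF.eventually_flowInCharts ht hw hz] with q hq
  exact hF.angle_flowInCharts hq.1 hq.2.1 hq.2.2

/-- The flow equation in fixed charts: `h(∂F/∂t, K dF ·) = -dθ`. -/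
lemma flow_inCharts (hn : 1 ≤ n) (v : Rn n) :
    inChart (prodModel n) G.h z₀ (inCharts (F t) p₀ z₀ w)
      (fderivWithin ℝ (flowInCharts F p₀ z₀) (flowDomain n T) (t, w) (1, 0))
      (K (fderiv ℝ (inCharts (F t) p₀ z₀) w v))
      = -fderiv ℝ (G.angle (F t) ∘ (extChartAt 𝓘(ℝ, Rn n) p₀).symm) w v := by
  have hFt := hF.isSpacelikeLagrangian ht
  rw [hFt.inChart_K_fderiv hw hz, hF.chartD_velocity ht hw hz, ← hFt.normal_apply_K,
    hF.flow t ht, hFt.genMeanCurvature_apply_K hn,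
    (hasFDerivAt_comp_chart_symm 𝓘(ℝ, Rn n) hw (hFt.mdifferentiableAt_angle _)).fderiv]
  rfl

end Nearby

end GKM.IsGLMCF

end FlowInCharts

/-! ### The evolution equation of the angle -/

section Evolution

variable {n : ℕ}
  {M : Type*} [TopologicalSpace M] [ChartedSpace (Rn n) M] [IsManifold 𝓘(ℝ, Rn n) ∞ M]
  {M' : Type*} [TopologicalSpace M'] [ChartedSpace (Rn n) M'] [IsManifold 𝓘(ℝ, Rn n) ∞ M']
  {L : Type*} [TopologicalSpace L] [ChartedSpace (Rn n) L] [IsManifold 𝓘(ℝ, Rn n) ∞ L]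
  {G : GKM n M M'} {T : ℝ} {F : ℝ → L → M × M'}

open GKM (dF velocity)

/-- The time derivative in the preferred charts at a point, as a function of the coordinates. -/
def velocityInCharts (T : ℝ) (F : ℝ → L → M × M') (t : ℝ) (p : L) (w : Rn n) :
    Rn n × Rn n :=
  fderivWithin ℝ (flowInCharts F p (F t p)) (flowDomain n T) (t, w) (1, 0)

namespace GKM.IsGLMCF

variable (hF : G.IsGLMCF T F)

include hF

variable {t : ℝ} (ht : t ∈ Set.Ico 0 T) (p : L)

include ht

/-- The chart at the base point represents tangent vectors by themselves. -/
lemma velocityInCharts_self :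
    velocityInCharts T F t p (extChartAt 𝓘(ℝ, Rn n) p p) = velocity T F t p := by
  have h := hF.chartD_velocity ht (mem_extChartAt_target p)
    ((hF.isSpacelikeLagrangian ht).mem_source_self p)
  rw [inCharts_self, chartD_self, extChartAt_to_inv] at h
  exact h

/-- The derivatives in time of the differential and in space of the velocity agree. -/
lemma exists_hasFDerivWithinAt_fderivWithin :
    ∃ f₂ : ℝ × Rn n →L[ℝ] ℝ × Rn n →L[ℝ] Rn n × Rn n,
      HasFDerivWithinAt (fderivWithin ℝ (flowInCharts F p (F t p)) (flowDomain n T)) f₂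
        (flowDomain n T) (t, extChartAt 𝓘(ℝ, Rn n) p p) ∧
      HasFDerivAt (velocityInCharts T F t p)
        ((f₂ (1, 0)).comp (ContinuousLinearMap.inr ℝ ℝ (Rn n))) (extChartAt 𝓘(ℝ, Rn n) p p) := by
  have hw := mem_extChartAt_target (I := 𝓘(ℝ, Rn n)) p
  have hz := (hF.isSpacelikeLagrangian ht).mem_source_self p
  have hmem : (t, extChartAt 𝓘(ℝ, Rn n) p p) ∈ flowDomain n T := ⟨ht, trivial⟩
  have h1 := ((hF.contDiffWithinAt_fderivWithin ht hw hz).differentiableWithinAt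
    (by norm_num)).hasFDerivWithinAt
  refine ⟨_, h1, ?_⟩
  have h2 := HasFDerivWithinAt.comp_hasFDerivAt
    (g := fderivWithin ℝ (flowInCharts F p (F t p)) (flowDomain n T))
    (f := fun y : Rn n => (t, y)) (extChartAt 𝓘(ℝ, Rn n) p p) h1
    (hasFDerivAt_prodMk_right t _) (Filter.Eventually.of_forall fun _ => ⟨ht, trivial⟩)
  have h3 := h2.clm_apply (hasFDerivAt_const ((1 : ℝ), (0 : Rn n)) _)
  refine h3.congr_fderiv ?_
  ext1 v
  have hs := ((hF.contDiffWithinAt_flowInCharts ht hw hz).isSymmSndFDerivWithinAt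
    (by simp; norm_num) (uniqueDiffOn_flowDomain T) (flowDomain_subset_closure_interior T hmem)
    hmem).eq (1, 0) (0, v)
  simp only [add_apply, ContinuousLinearMap.comp_apply, ContinuousLinearMap.flip_apply,
    zero_apply, map_zero, zero_add, ContinuousLinearMap.inr_apply]
  exact hs.symm

/-- The evolution equation. If the velocity has the components `dx(Z)` and `dx̄(Z')`, the time
derivative of `2θ` is the divergence of `Z` with respect to the density `ρ(dx)` minus that of `Z'`
with respect to `ρ̄(dx̄)`. The flow equation says that `Z = X + ∇θ` and `Z' = X - ∇θ`, with `X` the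
tangential part of the velocity, and the product of the two densities is `exp (2nψ) det g`. -/
lemma hasDerivWithinAt_angle (hn : 1 ≤ n) :
    HasDerivWithinAt (fun s => G.angle (F s) p)
      (laplacian (G.induced (F t)) (G.angle (F t)) p
        + n * G.induced (F t) p
            (grad 𝓘(ℝ, Rn n) (G.induced (F t)) (fun q => G.ψ (F t q)) p)
            (grad 𝓘(ℝ, Rn n) (G.induced (F t)) (G.angle (F t)) p)
        + differential 𝓘(ℝ, Rn n) (G.angle (F t)) p
            (G.tangential (F t) p (velocity T F t p)))
      (Set.Ico 0 T) t := by
  have hFt := hF.isSpacelikeLagrangian ht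
  set w₀ := extChartAt 𝓘(ℝ, Rn n) p p with hw₀
  have hw : w₀ ∈ (extChartAt 𝓘(ℝ, Rn n) p).target := mem_extChartAt_target p
  have hz := hFt.mem_source_self p
  have hg := hFt.induced_isInvertible p
  set f := inCharts (n := n) (F t) p (F t p) with hf
  set y := velocityInCharts (n := n) T F t p with hy
  set Φ := dF (n := n) (F t) p with hΦ
  have hy0 : y w₀ = velocity T F t p := hF.velocityInCharts_self ht p
  have hΦ0 : fderiv ℝ f w₀ = Φ := hFt.fderiv_inCharts_self p
  have hsymm := (hFt.isLagrangianJet p).symm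
  obtain ⟨f₂, hf₂, hy'⟩ := hF.exists_hasFDerivWithinAt_fderivWithin ht p
  rw [← hw₀, ← hy] at hy'
  rw [← hw₀] at hf₂
  set y' := (f₂ (1, 0)).comp (ContinuousLinearMap.inr ℝ ℝ (Rn n)) with hy'def
  have hev := hFt.eventually_self p
  -- the fields `Z = (dx)⁻¹ ∂x/∂t` and `Z' = (dx̄)⁻¹ ∂x̄/∂t`
  have hΦd := hFt.hasFDerivAt_fderiv_self p
  have hA : HasFDerivAt (fun w => fstD (fderiv ℝ f w))
      ((ContinuousLinearMap.compL ℝ (Rn n) (Rn n × Rn n) (Rn n)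
        (ContinuousLinearMap.fst ℝ (Rn n) (Rn n))).comp (secondDeriv (F t) p)) w₀ :=
    hasFDerivAt_clm_comp (E := Rn n →L[ℝ] Rn n × Rn n) (F := Rn n →L[ℝ] Rn n)
      (ContinuousLinearMap.compL ℝ (Rn n) (Rn n × Rn n) (Rn n)
        (ContinuousLinearMap.fst ℝ (Rn n) (Rn n))) hΦd
  have hB : HasFDerivAt (fun w => sndD (fderiv ℝ f w))
      ((ContinuousLinearMap.compL ℝ (Rn n) (Rn n × Rn n) (Rn n)
        (ContinuousLinearMap.snd ℝ (Rn n) (Rn n))).comp (secondDeriv (F t) p)) w₀ :=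
    hasFDerivAt_clm_comp (E := Rn n →L[ℝ] Rn n × Rn n) (F := Rn n →L[ℝ] Rn n)
      (ContinuousLinearMap.compL ℝ (Rn n) (Rn n × Rn n) (Rn n)
        (ContinuousLinearMap.snd ℝ (Rn n) (Rn n))) hΦd
  obtain ⟨DZ, hZ, htrZ⟩ := exists_hasFDerivAt_inverse_apply hA
    (fun u v => congrArg Prod.fst (hsymm u v)) hy'.fst
    (hev.mono fun w hw => hFt.isInvertible_fst_inCharts hw.1 hw.2)
  obtain ⟨DZ', hZ', htrZ'⟩ := exists_hasFDerivAt_inverse_apply hB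
    (fun u v => congrArg Prod.snd (hsymm u v)) hy'.snd
    (hev.mono fun w hw => hFt.isInvertible_snd_inCharts hw.1 hw.2)
  set Z := fun w => (fstD (fderiv ℝ f w)).inverse (y w).1 with hZdef
  set Z' := fun w => (sndD (fderiv ℝ f w)).inverse (y w).2 with hZ'def
  have hyZ (w : Rn n) (hw1 : w ∈ (extChartAt 𝓘(ℝ, Rn n) p).target)
      (hw2 : F t ((extChartAt 𝓘(ℝ, Rn n) p).symm w) ∈ (extChartAt (prodModel n) (F t p)).source) :
      (fderiv ℝ f w (Z w)).1 = (y w).1 ∧ (fderiv ℝ f w (Z' w)).2 = (y w).2 :=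
    ⟨comp_inverse_apply (hFt.isInvertible_fst_inCharts hw1 hw2) (y w).1,
      comp_inverse_apply (hFt.isInvertible_snd_inCharts hw1 hw2) (y w).2⟩
  -- half their difference is the gradient of the angle
  have hgrad : ∀ᶠ w in 𝓝 w₀, ∀ v,
      inChart 𝓘(ℝ, Rn n) (G.induced (F t)) p w ((1 / 2 : ℝ) • (Z w - Z' w)) v
        = fderiv ℝ (G.angle (F t) ∘ (extChartAt 𝓘(ℝ, Rn n) p).symm) w v := by
    filter_upwards [hev] with w hw v
    obtain ⟨e1, e2⟩ := hyZ w hw.1 hw.2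
    have hKM := hFt.isKMForm_inCharts hw.1 hw.2
    have hflow := hF.flow_inCharts ht hw.1 hw.2 hn v
    have hlag := hFt.lagrangian_inCharts hw.1 hw.2
    rw [hFt.inChart_induced hw.1 hw.2]
    set ĥ := inChart (prodModel n) G.h (F t p) (inCharts (F t) p (F t p) w) with hĥ
    have i1 := induced_eq_mixedBlock hKM hlag (Z w) v
    have i2 := induced_eq_mixedBlock hKM hlag v (Z' w)
    rw [hKM.symm, ← hf, e2] at i2
    rw [← hf, e1] at i1
    have h1 : ĥ (y w) (K (fderiv ℝ f w v))
        = -fderiv ℝ (G.angle (F t) ∘ (extChartAt 𝓘(ℝ, Rn n) p).symm) w v := hflow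
    rw [hKM.apply_eq] at h1
    simp only [K, map_neg] at h1
    rw [map_smul, map_sub, map_smul, map_sub]
    simp only [smul_apply, sub_apply, smul_eq_mul]
    linarith
  have hY := (hZ.sub hZ').const_smul (1 / 2 : ℝ)
  have hlap := laplacian_eq_divergence hg (fun q u v => hFt.induced_comm q u v)
    ((hFt.contDiffAt_inChart_induced p).differentiableAt one_ne_zero)
    (hFt.contDiffAt_angle_comp hw hz) hY hgrad
  -- at the point itself, `Z = X + ∇θ` and `Z' = X - ∇θ`
  set X := G.tangential (F t) p (velocity T F t p) with hX
  set Y₀ := grad 𝓘(ℝ, Rn n) (G.induced (F t)) (G.angle (F t)) p with hY₀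
  have hYg (v : Rn n) : G.induced (F t) p Y₀ v = differential 𝓘(ℝ, Rn n) (G.angle (F t)) p v := by
    rw [hY₀, grad, apply_sharp hg]
  have hdiff : (1 / 2 : ℝ) • (Z w₀ - Z' w₀) = Y₀ := by
    refine eq_of_forall_apply_eq hg fun v => ?_
    have h1 := hgrad.self_of_nhds v
    rw [inChart_self, fderiv_comp_chart_symm_self 𝓘(ℝ, Rn n) (hFt.mdifferentiableAt_angle p)] at h1
    rw [h1, hYg]
  obtain ⟨e1, e2⟩ := hyZ w₀ hw hz
  rw [hΦ0] at e1 e2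
  have hsum : (1 / 2 : ℝ) • (Z w₀ + Z' w₀) = X := by
    refine eq_of_forall_apply_eq hg fun v => ?_
    rw [hX, hFt.induced_tangential, ← hy0, (G.isKMForm (hFt.notMem_cut p)).apply_eq, ← e1, ← e2]
    have i1 : G.induced (F t) p (Z w₀) v = 2 * mixedBlock (G.h (F t p)) (Φ (Z w₀)).1 (Φ v).2 :=
      induced_eq_mixedBlock (G.isKMForm (hFt.notMem_cut p)) (hFt.isLagrangian p) (Z w₀) v
    have i2 : G.induced (F t) p v (Z' w₀) = 2 * mixedBlock (G.h (F t p)) (Φ v).1 (Φ (Z' w₀)).2 :=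
      induced_eq_mixedBlock (G.isKMForm (hFt.notMem_cut p)) (hFt.isLagrangian p) v (Z' w₀)
    rw [hFt.induced_comm] at i2
    rw [map_smul, map_add]
    simp only [smul_apply, add_apply, smul_eq_mul]
    linarith
  have hZ0 : Z w₀ = X + Y₀ := by
    rw [← hsum, ← hdiff]
    module
  have hZ'0 : Z' w₀ = X - Y₀ := by
    rw [← hsum, ← hdiff]
    module
  -- the derivative of the angle in time and space
  obtain ⟨D, hD, hθ⟩ := G.hasFDerivWithinAt_angleInChart (z₀ := F t p)
    (φ := fun q => (fderivWithin ℝ (flowInCharts F p (F t p)) (flowDomain n T) q).comp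
      (ContinuousLinearMap.inr ℝ ℝ (Rn n)))
    (φ' := (((ContinuousLinearMap.compL ℝ (Rn n) (ℝ × Rn n) (Rn n × Rn n)).flip
      (ContinuousLinearMap.inr ℝ ℝ (Rn n)))).comp f₂)
    (hF.hasFDerivWithinAt_flowInCharts ht hw hz)
    ((((ContinuousLinearMap.compL ℝ (Rn n) (ℝ × Rn n) (Rn n × Rn n)).flip
      (ContinuousLinearMap.inr ℝ ℝ (Rn n)))).hasFDerivAt.comp_hasFDerivWithinAt _ hf₂)
    (inCharts_self p (F t))
    (by rw [← hF.fderiv_inCharts_eq ht hw hz]; exact hFt.isInvertible_fst_inCharts hw hz)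
    (by rw [← hF.fderiv_inCharts_eq ht hw hz]; exact hFt.isInvertible_snd_inCharts hw hz)
  have hθ1 := hθ.congr_of_eventuallyEq
    (f₁ := fun q : ℝ × Rn n => G.angle (F q.1) ((extChartAt 𝓘(ℝ, Rn n) p).symm q.2))
    (by
      filter_upwards [hF.eventually_flowInCharts ht hw hz] with q hq
      exact hF.angle_flowInCharts hq.1 hq.2.1 hq.2.2) (hF.angle_flowInCharts ht hw hz)
  have hθ2 := HasFDerivWithinAt.comp (s := Set.Ico 0 T)
    (g := fun q : ℝ × Rn n => G.angle (F q.1) ((extChartAt 𝓘(ℝ, Rn n) p).symm q.2))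
    (f := fun s : ℝ => (s, w₀)) t hθ1 (hasFDerivAt_prodMk_left t w₀).hasFDerivWithinAt
    fun s hs => ⟨hs, trivial⟩
  have hθ3 : HasDerivWithinAt (fun s => G.angle (F s) p) (D (1, 0)) (Set.Ico 0 T) t := by
    have h1 := hθ2.hasDerivWithinAt
    simp only [Function.comp_def, hw₀, extChartAt_to_inv] at h1
    exact h1
  refine hθ3.congr_deriv ?_
  have hD1 := hD (1, 0)
  rw [← hF.fderiv_inCharts_eq ht hw hz] at hD1
  have t1 : endTrace ((fstD (n := n) Φ).inverse ∘L fstD y')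
      = endTrace ((fstD (n := n) Φ).inverse ∘L fstD (secondDeriv (F t) p (X + Y₀)))
        + endTrace DZ := by
    rw [← hΦ0, ← hZ0]
    exact htrZ
  have t2 : endTrace ((sndD (n := n) Φ).inverse ∘L sndD y')
      = endTrace ((sndD (n := n) Φ).inverse ∘L sndD (secondDeriv (F t) p (X - Y₀)))
        + endTrace DZ' := by
    rw [← hΦ0, ← hZ'0]
    exact htrZ'
  have hD2 : 2 * D (1, 0) = dlogDensity G.ρ (F t p).1 (y w₀).1
        + endTrace ((fstD (n := n) Φ).inverse ∘L fstD y')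
      - (dlogDensity G.ρ' (F t p).2 (y w₀).2
        + endTrace ((sndD (n := n) Φ).inverse ∘L sndD y')) := by
    rw [← hΦ0]
    exact hD1
  rw [t1, t2, ← e1, ← e2, hZ0, hZ'0] at hD2
  have a1 := hFt.differential_angle p X
  have a2 := hFt.logDeriv_densities hn p Y₀
  have htr : endTrace ((1 / 2 : ℝ) • (DZ - DZ')) = 1 / 2 * (endTrace DZ - endTrace DZ') := by
    rw [endTrace_smul, endTrace_sub]
  have hψ : G.induced (F t) p
      (grad 𝓘(ℝ, Rn n) (G.induced (F t)) (fun q => G.ψ (F t q)) p) Y₀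
      = differential 𝓘(ℝ, Rn n) (fun q => G.ψ (F t q)) p Y₀ := by
    rw [grad, apply_sharp hg]
  have hlap' : laplacian (G.induced (F t)) (G.angle (F t)) p
      = 1 / 2 * (endTrace DZ - endTrace DZ') + 1 / 2 * metricTrace (G.induced (F t) p)
        (fderiv ℝ (inChart 𝓘(ℝ, Rn n) (G.induced (F t)) p) w₀ Y₀ · ·) := by
    rw [← htr, ← hdiff]
    exact hlap
  rw [hψ, hlap']
  have s1 : endTrace ((fstD (n := n) Φ).inverse ∘L fstD (secondDeriv (F t) p (X + Y₀)))
      = endTrace ((fstD (n := n) Φ).inverse ∘L fstD (secondDeriv (F t) p X))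
        + endTrace ((fstD (n := n) Φ).inverse ∘L fstD (secondDeriv (F t) p Y₀)) := by
    rw [← endTrace_add, map_add, ← ContinuousLinearMap.comp_add]
    congr 2
  have s2 : endTrace ((sndD (n := n) Φ).inverse ∘L sndD (secondDeriv (F t) p (X - Y₀)))
      = endTrace ((sndD (n := n) Φ).inverse ∘L sndD (secondDeriv (F t) p X))
        - endTrace ((sndD (n := n) Φ).inverse ∘L sndD (secondDeriv (F t) p Y₀)) := by
    rw [← endTrace_sub, map_sub, ← ContinuousLinearMap.comp_sub]
    congr 2
  rw [s1, s2, map_add, map_sub, Prod.fst_add, Prod.snd_sub, map_add, map_sub] at hD2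
  linarith

end GKM.IsGLMCF

end Evolution

/-! ### The maximum principle -/

section MaximumPrinciple

/-- The derivative is not negative where a function attains its maximum over the past. -/
lemma nonneg_of_hasDerivWithinAt_of_le {g : ℝ → ℝ} {g' a T t : ℝ}
    (hg : HasDerivWithinAt g g' (Set.Ico a T) t) (hat : a < t) (htT : t < T)
    (hle : ∀ s ∈ Set.Ioo a t, g s ≤ g t) : 0 ≤ g' := by
  have h1 : HasDerivWithinAt g g' (Set.Ioo a t) t :=
    hg.mono fun s hs => ⟨hs.1.le, hs.2.trans htT⟩
  rw [hasDerivWithinAt_iff_tendsto_slope' fun h => lt_irrefl _ h.2] at h1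
  have := right_nhdsWithin_Ioo_neBot hat
  refine ge_of_tendsto h1 ?_
  filter_upwards [self_mem_nhdsWithin] with s hs
  rw [slope_def_field]
  exact div_nonneg_of_nonpos (sub_nonpos.2 (hle s hs)) (sub_nonpos.2 hs.2.le)

/-- The weak maximum principle for a function whose time derivative is not positive at the spatial
maxima. -/
lemma le_of_deriv_nonpos_at_max {L : Type*} [TopologicalSpace L] [CompactSpace L] {T : ℝ}
    {u u' : ℝ → L → ℝ}
    (hcont : ContinuousOn (fun q : ℝ × L => u q.1 q.2) (Set.Ico 0 T ×ˢ Set.univ))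
    (hd : ∀ t ∈ Set.Ico 0 T, ∀ p, HasDerivWithinAt (fun s => u s p) (u' t p) (Set.Ico 0 T) t)
    (hmax : ∀ t ∈ Set.Ico 0 T, ∀ p, (∀ q, u t q ≤ u t p) → u' t p ≤ 0) {m : ℝ}
    (h0 : ∀ p, u 0 p ≤ m) {t : ℝ} (ht : t ∈ Set.Ico 0 T) (p : L) : u t p ≤ m := by
  have key (ε : ℝ) (hε : 0 < ε) : u t p - ε * t ≤ m := by
    have hsub : Set.Icc 0 t ×ˢ (Set.univ : Set L) ⊆ Set.Ico 0 T ×ˢ Set.univ :=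
      Set.prod_mono (fun s hs => ⟨hs.1, hs.2.trans_lt ht.2⟩) le_rfl
    have hc : ContinuousOn (fun q : ℝ × L => u q.1 q.2 - ε * q.1)
        (Set.Icc 0 t ×ˢ (Set.univ : Set L)) :=
      (hcont.mono hsub).sub (by fun_prop)
    have hne : (Set.Icc 0 t ×ˢ (Set.univ : Set L)).Nonempty := ⟨(t, p), ⟨ht.1, le_rfl⟩, trivial⟩
    obtain ⟨⟨s, q⟩, ⟨hs, -⟩, hsq⟩ := (isCompact_Icc.prod isCompact_univ).exists_isMaxOn hne hc
    have hle (s' : ℝ) (hs' : s' ∈ Set.Icc 0 t) (q' : L) : u s' q' - ε * s' ≤ u s q - ε * s :=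
      hsq (show (s', q') ∈ _ from ⟨hs', trivial⟩)
    have hsT : s ∈ Set.Ico 0 T := ⟨hs.1, hs.2.trans_lt ht.2⟩
    have hs0 : 0 ≤ s := hs.1
    rcases hs0.eq_or_lt with h | h
    · have h1 := hle t ⟨ht.1, le_rfl⟩ p
      rw [← h, mul_zero, sub_zero] at h1
      exact h1.trans (h0 q)
    · exfalso
      have h1 : u' s q ≤ 0 := hmax s hsT q fun q' => by
        have := hle s hs q'
        linarith
      have h2 : HasDerivWithinAt (fun s' => u s' q - ε * s') (u' s q - ε * 1) (Set.Ico 0 T) s :=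
        (hd s hsT q).sub ((hasDerivWithinAt_id s _).const_mul ε)
      have h3 := nonneg_of_hasDerivWithinAt_of_le h2 h hsT.2 fun s' hs' =>
        hle s' ⟨hs'.1.le, hs'.2.le.trans hs.2⟩ q
      linarith
  by_contra hlt
  rw [not_le] at hlt
  have h1 := key ((u t p - m) / (2 * (t + 1))) (div_pos (sub_pos.2 hlt) (by linarith [ht.1]))
  have h2 : (u t p - m) / (2 * (t + 1)) * t ≤ (u t p - m) / 2 := by
    rw [div_mul_eq_mul_div, div_le_div_iff₀ (by linarith [ht.1]) two_pos]
    nlinarith [ht.1]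
  linarith

variable {n : ℕ}

/-- The second derivative at a local maximum is negative semidefinite. -/
lemma fderiv_fderiv_nonpos_of_isLocalMax {E : Type*} [NormedAddCommGroup E] [NormedSpace ℝ E]
    {f : E → ℝ} {w₀ : E} (hf : ContDiffAt ℝ 2 f w₀)
    (hmax : IsLocalMax f w₀) (v : E) : fderiv ℝ (fderiv ℝ f) w₀ v v ≤ 0 := by
  set c : ℝ → E := fun s => w₀ + s • v with hc
  have hcd (s : ℝ) : HasDerivAt c v s := by
    have h := ((hasDerivAt_id s).smul_const v).const_add w₀
    rw [one_smul] at h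
    exact h
  have hc0 : c 0 = w₀ := by simp [hc]
  have hct : Filter.Tendsto c (𝓝 0) (𝓝 w₀) := by
    have := (hcd 0).continuousAt
    rwa [ContinuousAt, hc0] at this
  have h1 : deriv (f ∘ c) =ᶠ[𝓝 0] fun s => fderiv ℝ f (c s) v := by
    filter_upwards [hct.eventually (hf.eventually (by simp))] with s hs
    exact ((hs.differentiableAt two_ne_zero).hasFDerivAt.comp_hasDerivAt s (hcd s)).deriv
  have h2 : deriv (deriv (f ∘ c)) 0 = fderiv ℝ (fderiv ℝ f) w₀ v v := by
    rw [h1.deriv_eq]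
    have h3 : HasFDerivAt (fderiv ℝ f) (fderiv ℝ (fderiv ℝ f) w₀) (c 0) := by
      rw [hc0]
      exact ((hf.fderiv_right (m := 1) (by norm_num)).differentiableAt one_ne_zero).hasFDerivAt
    have h4 := (h3.comp_hasDerivAt (0 : ℝ) (hcd 0)).clm_apply (hasDerivAt_const (0 : ℝ) v)
    simpa using h4.deriv
  by_contra hlt
  rw [not_le, ← h2] at hlt
  have hmax' : IsLocalMax (f ∘ c) 0 := by
    have := hct.eventually hmax
    simpa [IsLocalMax, IsMaxFilter, hc0] using this
  have hcont : ContinuousAt (f ∘ c) 0 :=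
    ContinuousAt.comp (by rw [hc0]; exact hf.continuousAt) (hcd 0).continuousAt
  have hmin := isLocalMin_of_deriv_deriv_pos hlt hmax'.deriv_eq_zero hcont
  have heq : f ∘ c =ᶠ[𝓝 0] fun _ => (f ∘ c) 0 := by
    filter_upwards [hmax', hmin] with s hs1 hs2
    exact le_antisymm hs1 hs2
  have h5 : deriv (deriv (f ∘ c)) 0 = 0 := by
    rw [heq.deriv.deriv_eq]
    simp
  exact hlt.ne' h5

lemma fderiv_fderiv_nonneg_of_isLocalMin {E : Type*} [NormedAddCommGroup E] [NormedSpace ℝ E]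
    {f : E → ℝ} {w₀ : E} (hf : ContDiffAt ℝ 2 f w₀)
    (hmin : IsLocalMin f w₀) (v : E) : 0 ≤ fderiv ℝ (fderiv ℝ f) w₀ v v := by
  have h := fderiv_fderiv_nonpos_of_isLocalMax hf.neg hmin.neg v
  have h1 : fderiv ℝ (fun w => -f w) = fun w => -fderiv ℝ f w := by
    funext w
    exact fderiv_fun_neg
  rw [h1, fderiv_fun_neg] at h
  simpa using h

variable {L : Type*} [TopologicalSpace L] [ChartedSpace (Rn n) L]
  [IsManifold 𝓘(ℝ, Rn n) ∞ L]

section Extrema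

variable {g : L → Rn n →L[ℝ] Rn n →L[ℝ] ℝ} {f : L → ℝ} {p : L}

lemma laplacian_eq_of_differential_eq_zero (h : differential 𝓘(ℝ, Rn n) f p = 0) :
    laplacian g f p = metricTrace (g p)
      (fderiv ℝ (fderiv ℝ (f ∘ (extChartAt 𝓘(ℝ, Rn n) p).symm))
        (extChartAt 𝓘(ℝ, Rn n) p p) · ·) := by
  unfold laplacian
  rw [h]
  simp

variable (hg : (g p).IsInvertible) (hs : ∀ u v, g p u v = g p v u) (hpos : ∀ u, 0 ≤ g p u u)
  (hf : ContDiffAt ℝ 2 (f ∘ (extChartAt 𝓘(ℝ, Rn n) p).symm) (extChartAt 𝓘(ℝ, Rn n) p p))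

include hg hs hpos hf

lemma differential_eq_zero_and_laplacian_nonpos (hmax : ∀ q, f q ≤ f p) :
    differential 𝓘(ℝ, Rn n) f p = 0 ∧ laplacian g f p ≤ 0 := by
  have hloc : IsLocalMax (f ∘ (extChartAt 𝓘(ℝ, Rn n) p).symm) (extChartAt 𝓘(ℝ, Rn n) p p) :=
    Filter.Eventually.of_forall fun w => by
      simp only [Function.comp, extChartAt_to_inv]
      exact hmax _
  have hd : differential 𝓘(ℝ, Rn n) f p = 0 := by
    rw [← fderiv_comp_chart_symm_self 𝓘(ℝ, Rn n)
      (mdifferentiableAt_of_chart 𝓘(ℝ, Rn n) (hf.differentiableAt two_ne_zero))]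
    exact hloc.fderiv_eq_zero
  refine ⟨hd, ?_⟩
  rw [laplacian_eq_of_differential_eq_zero hd]
  exact metricTrace_nonpos hg hs hpos _ (fderiv_fderiv_nonpos_of_isLocalMax hf hloc)

lemma differential_eq_zero_and_laplacian_nonneg (hmin : ∀ q, f p ≤ f q) :
    differential 𝓘(ℝ, Rn n) f p = 0 ∧ 0 ≤ laplacian g f p := by
  have hloc : IsLocalMin (f ∘ (extChartAt 𝓘(ℝ, Rn n) p).symm) (extChartAt 𝓘(ℝ, Rn n) p p) :=
    Filter.Eventually.of_forall fun w => by
      simp only [Function.comp, extChartAt_to_inv]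
      exact hmin _
  have hd : differential 𝓘(ℝ, Rn n) f p = 0 := by
    rw [← fderiv_comp_chart_symm_self 𝓘(ℝ, Rn n)
      (mdifferentiableAt_of_chart 𝓘(ℝ, Rn n) (hf.differentiableAt two_ne_zero))]
    exact hloc.fderiv_eq_zero
  refine ⟨hd, ?_⟩
  rw [laplacian_eq_of_differential_eq_zero hd]
  have h1 := metricTrace_nonpos hg hs hpos
    (-fderiv ℝ (fderiv ℝ (f ∘ (extChartAt 𝓘(ℝ, Rn n) p).symm)) (extChartAt 𝓘(ℝ, Rn n) p p))
    fun v => neg_nonpos.2 (fderiv_fderiv_nonneg_of_isLocalMin hf hloc v)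
  have h2 := metricTrace_const_mul (g p) (-1)
    (fderiv ℝ (fderiv ℝ (f ∘ (extChartAt 𝓘(ℝ, Rn n) p).symm)) (extChartAt 𝓘(ℝ, Rn n) p p) · ·)
  simp only [neg_apply] at h1
  simp only [neg_one_mul] at h2
  linarith

end Extrema

variable {M : Type*} [TopologicalSpace M] [ChartedSpace (Rn n) M] [IsManifold 𝓘(ℝ, Rn n) ∞ M]
  {M' : Type*} [TopologicalSpace M'] [ChartedSpace (Rn n) M'] [IsManifold 𝓘(ℝ, Rn n) ∞ M']
  {G : GKM n M M'} {T : ℝ} {F : ℝ → L → M × M'}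

open GKM (dF velocity)

namespace GKM.IsGLMCF

variable (hF : G.IsGLMCF T F)

include hF

lemma continuousOn_angle :
    ContinuousOn (fun q : ℝ × L => G.angle (F q.1) q.2) (Set.Ico 0 T ×ˢ Set.univ) := by
  rintro ⟨t, p⟩ ⟨ht, -⟩
  have h1 := (hF.contDiffWithinAt_angle (p₀ := p) ht (mem_extChartAt_target p)
    ((hF.isSpacelikeLagrangian ht).mem_source_self p)).continuousWithinAt
  have h2 : ContinuousWithinAt (fun q : ℝ × L => (q.1, extChartAt 𝓘(ℝ, Rn n) p q.2))
      (Set.Ico 0 T ×ˢ Set.univ) (t, p) :=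
    (continuousAt_fst.prodMk (ContinuousAt.comp (f := fun q : ℝ × L => q.2) (x := (t, p))
      (continuousAt_extChartAt p) continuousAt_snd)).continuousWithinAt
  have h3 := ContinuousWithinAt.comp
    (g := fun q : ℝ × Rn n => G.angle (F q.1) ((extChartAt 𝓘(ℝ, Rn n) p).symm q.2))
    (f := fun q : ℝ × L => (q.1, extChartAt 𝓘(ℝ, Rn n) p q.2)) h1 h2
    fun q hq => ⟨hq.1, trivial⟩
  refine h3.congr_of_eventuallyEq ?_ ?_
  · have h4 : ∀ᶠ q : ℝ × L in 𝓝 (t, p), q.2 ∈ (extChartAt 𝓘(ℝ, Rn n) p).source :=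
      continuousAt_snd.preimage_mem_nhds (extChartAt_source_mem_nhds p)
    filter_upwards [nhdsWithin_le_nhds h4] with q hq
    simp only [Function.comp]
    rw [(extChartAt 𝓘(ℝ, Rn n) p).left_inv hq]
  · simp only [Function.comp]
    rw [extChartAt_to_inv]

variable (hn : 1 ≤ n)

include hn

/-- At a point where the differential of the angle vanishes its time derivative is its Laplacian. -/
lemma hasDerivWithinAt_angle_of_critical {t : ℝ} (ht : t ∈ Set.Ico 0 T) {p : L}
    (h : differential 𝓘(ℝ, Rn n) (G.angle (F t)) p = 0) :
    HasDerivWithinAt (fun s => G.angle (F s) p) (laplacian (G.induced (F t)) (G.angle (F t)) p)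
      (Set.Ico 0 T) t := by
  refine (hF.hasDerivWithinAt_angle ht p hn).congr_deriv ?_
  have h0 : grad 𝓘(ℝ, Rn n) (G.induced (F t)) (G.angle (F t)) p = 0 := by
    rw [grad, h]
    exact map_zero _
  rw [h0, h]
  simp

variable [CompactSpace L]

lemma angle_le {m : ℝ} (hm : ∀ p, G.angle (F 0) p ≤ m) {t : ℝ} (ht : t ∈ Set.Ico 0 T) (p : L) :
    G.angle (F t) p ≤ m := by
  refine le_of_deriv_nonpos_at_max (u := fun t p => G.angle (F t) p) hF.continuousOn_angle
    (fun t ht p => hF.hasDerivWithinAt_angle ht p hn) (fun t ht p hp => ?_) hm ht p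
  have hFt := hF.isSpacelikeLagrangian ht
  obtain ⟨h1, h2⟩ := differential_eq_zero_and_laplacian_nonpos (hFt.induced_isInvertible p)
    (hFt.induced_comm p) (fun u => hFt.induced_nonneg p u)
    (hFt.contDiffAt_angle_comp (mem_extChartAt_target p) (hFt.mem_source_self p)) hp
  have h3 := (uniqueDiffOn_Ico 0 T t ht).eq_deriv _ (hF.hasDerivWithinAt_angle ht p hn)
    (hF.hasDerivWithinAt_angle_of_critical hn ht h1)
  exact h3.trans_le h2

lemma le_angle {m : ℝ} (hm : ∀ p, m ≤ G.angle (F 0) p) {t : ℝ} (ht : t ∈ Set.Ico 0 T) (p : L) :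
    m ≤ G.angle (F t) p := by
  refine neg_le_neg_iff.1 (le_of_deriv_nonpos_at_max (u := fun t p => -G.angle (F t) p)
    hF.continuousOn_angle.neg (fun t ht p => (hF.hasDerivWithinAt_angle ht p hn).neg)
    (fun t ht p hp => ?_) (fun p => neg_le_neg (hm p)) ht p)
  have hFt := hF.isSpacelikeLagrangian ht
  obtain ⟨h1, h2⟩ := differential_eq_zero_and_laplacian_nonneg (hFt.induced_isInvertible p)
    (hFt.induced_comm p) (fun u => hFt.induced_nonneg p u)
    (hFt.contDiffAt_angle_comp (mem_extChartAt_target p) (hFt.mem_source_self p))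
    (fun q => neg_le_neg_iff.1 (hp q))
  have h3 := (uniqueDiffOn_Ico 0 T t ht).eq_deriv _ (hF.hasDerivWithinAt_angle ht p hn)
    (hF.hasDerivWithinAt_angle_of_critical hn ht h1)
  exact neg_nonpos.2 (h2.trans h3.ge)

end GKM.IsGLMCF

end MaximumPrinciple

end KimMcCann

end

open KimMcCann in
theorem mainTheorem5 {n : ℕ} (hn : 1 ≤ n)
    {M : Type*} [TopologicalSpace M] [ChartedSpace (Rn n) M] [IsManifold 𝓘(ℝ, Rn n) ∞ M]
    {M' : Type*} [TopologicalSpace M'] [ChartedSpace (Rn n) M'] [IsManifold 𝓘(ℝ, Rn n) ∞ M']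
    {L : Type*} [TopologicalSpace L] [ChartedSpace (Rn n) L] [IsManifold 𝓘(ℝ, Rn n) ∞ L]
    (G : GKM n M M') (T : ℝ) (hT : 0 < T) (F : ℝ → L → M × M') (hF : G.IsGLMCF T F) :
    ∃ θ : ℝ → L → ℝ,
      (∀ t ∈ Set.Ico 0 T, ∀ p : L, ∀ a : ℝ, G.IsLagrangianAngle (F t) p a ↔ a = θ t p) ∧
      (∀ t ∈ Set.Ico 0 T, ContMDiff 𝓘(ℝ, Rn n) 𝓘(ℝ, ℝ) 2 (θ t)) ∧
      (∀ t ∈ Set.Ico 0 T, ∀ p : L,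
        HasDerivWithinAt (fun s => θ s p)
          (laplacian (G.induced (F t)) (θ t) p
            + n * G.induced (F t) p
                (grad 𝓘(ℝ, Rn n) (G.induced (F t)) (fun q => G.ψ (F t q)) p)
                (grad 𝓘(ℝ, Rn n) (G.induced (F t)) (θ t) p)
            + differential 𝓘(ℝ, Rn n) (θ t) p
                (G.tangential (F t) p (GKM.velocity T F t p)))
          (Set.Ico 0 T) t) ∧
      (∀ t ∈ Set.Ico 0 T, ∀ p : L,
        GKM.velocity T F t p = G.genMeanCurvature (F t) p →
        HasDerivWithinAt (fun s => θ s p)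
          (laplacian (G.induced (F t)) (θ t) p
            + n * G.induced (F t) p
                (grad 𝓘(ℝ, Rn n) (G.induced (F t)) (fun q => G.ψ (F t q)) p)
                (grad 𝓘(ℝ, Rn n) (G.induced (F t)) (θ t) p))
          (Set.Ico 0 T) t) ∧
      (CompactSpace L → Nonempty L →
        ∃ m₀ m₁ : ℝ, IsLeast (Set.range (θ 0)) m₀ ∧ IsGreatest (Set.range (θ 0)) m₁ ∧
          ∀ t ∈ Set.Ico 0 T, ∀ p : L, m₀ ≤ θ t p ∧ θ t p ≤ m₁) := by
  have hL (t : ℝ) (ht : t ∈ Set.Ico 0 T) := hF.isSpacelikeLagrangian ht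
  refine ⟨fun t p => G.angle (F t) p, fun t ht p a => (hL t ht).isLagrangianAngle_iff hn p a,
    fun t ht => (hL t ht).contMDiff_angle, fun t ht p => hF.hasDerivWithinAt_angle ht p hn,
    fun t ht p hp => ?_, fun _ _ => ?_⟩
  · -- the velocity is normal, so that its tangential part vanishes
    refine (hF.hasDerivWithinAt_angle ht p hn).congr_deriv ?_
    have h1 : GKM.velocity T F t p = G.normal (F t) p (GKM.velocity T F t p) :=
      hp.trans (hF.flow t ht p).symm
    rw [h1, (hL t ht).tangential_normal, map_zero, add_zero]
  · have hc : IsCompact (Set.range (G.angle (F 0))) :=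
      isCompact_range (hL 0 ⟨le_rfl, hT⟩).contMDiff_angle.continuous
    obtain ⟨m₀, hm₀⟩ := hc.exists_isLeast (Set.range_nonempty _)
    obtain ⟨m₁, hm₁⟩ := hc.exists_isGreatest (Set.range_nonempty _)
    exact ⟨m₀, m₁, hm₀, hm₁, fun t ht p =>
      ⟨hF.le_angle hn (fun q => hm₀.2 ⟨q, rfl⟩) ht p,
        hF.angle_le hn (fun q => hm₁.2 ⟨q, rfl⟩) ht p⟩⟩
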